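/- Setting. Let $\Delta$ be a tetrahedron whose four boundary faces are numbered $1,2,3,4$, oriented so that its corners opposite to the faces $1,2,3,4$, in this order, are positively oriented. Let $\Delta$ carry a finite triangulation $K$ (a finite geometric simplicial complex with underlying space $\Delta$) with an arbitrary branching structure: every edge is oriented and no 2-simplex contains an oriented cycle, so that the vertices $0,1,\dots,k$ of each $k$-simplex are ordered. For cochains, $(f\cup g)(0,\dots,m+n)=f(0,\dots,m)\,g(m,\dots,m+n)$; for 1-cochains, $(f\cup_1 g)(e)=f(e)g(e)$; and $\int_M f=\sum_{s\subset M}\sigma(s)f(s)$, where $\sigma(s)=\pm1$ is the orientation of $s$. The 4th face $\mathrm{bdry}_4$ is oriented as part of $\partial\Delta$, and the edge $\mathrm{hinge}_{1,4}$ shared by the faces 1 and 4 is oriented as part of $\partial\,\mathrm{bdry}_4$. Code. Every edge $e$ of $K$ carries four qubits of colors $r,g,b,y$; $Z^c_e=(-1)^{a_c(e)}$, $a_c(e)\in\{0,1\}$, defines the gauge fields $a_c$, and $\tilde a_c$ is the integer lift of $a_c$ with values in $\{0,1\}$. For a vertex $v$, let $$S^r_{X;v}=\prod_{e\ni v}X^r_e\prod_{\int\tilde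 v\cup\tilde e'\cup\tilde e''\cup\tilde e'''\neq0}CCZ^{y,b,g}_{e',e'',e'''},\qquad S^y_{X;v}=\prod_{e\ni v}X^y_e\prod_{\int\tilde e'\cup\tilde v\cup\tilde e''\cup\tilde e'''\neq0}CCZ^{r,b,g}_{e',e'',e'''},$$ $$S^b_{X;v}=\prod_{e\ni v}X^b_e\prod_{\int\tilde e'\cup\tilde e''\cup\tilde v\cup\tilde e'''\neq0}CCZ^{r,y,g}_{e',e'',e'''},\qquad S^g_{X;v}=\prod_{e\ni v}X^g_e\prod_{\int\tilde e'\cup\tilde e''\cup\tilde e'''\cup\tilde v\neq0}CCZ^{r,y,b}_{e',e'',e'''},$$ where $\tilde v,\tilde e$ are indicator cochains and all integrals are over $\Delta$. The stabilizers are: - $\prod_{e\in\partial f}Z^c_e$ for all 2-simplices $f$ and colors $c$; - for the edges $e$ on the boundary: $Z^b_e$ on face 1, $Z^r_e$ on face 2, $Z^g_e$ on face 3, and $Z^r_eZ^g_eZ^b_e$ and $Z^y_e$ on face 4; - for vertices $v$ not on face 4: $S^c_{X;v}$ for every color $c$, except $c=b$ if $v$ is on face 1, $c=r$ if $v$ is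 on face 2, $c=g$ if $v$ is on face 3; - for vertices $v$ on face 4: $S^c_{X;v}S^{c'}_{X;v}$ for distinct $c,c'\in\{r,g,b\}$, neither of them excluded by another face containing $v$ as in the previous item. The code space is the space of states fixed by all stabilizers. Claim. The code space has dimension 2, i.e. the code stores a single logical qubit. Let $U=WV$ with $$V=\prod_e \mathrm{CNOT}^{(r,y)}_e\,\mathrm{CNOT}^{(g,y)}_e\,\mathrm{CNOT}^{(b,y)}_e$$ ($y$ is the target) and $$W=\exp\Big(\pi i\int_{\Delta}\Big(\tfrac12\tilde a_r\cup\tilde a_b\cup\tilde a_g+a_r\cup(a_g\cup_1a_b)\cup a_g\Big)-\pi i\int_{\mathrm{bdry}_4}\tfrac14\tilde a_r\cup\tilde a_g+\pi i\int_{\mathrm{hinge}_{1,4}}\tfrac18\tilde a_r\Big).$$ Then $W$ is the product, over the 3-simplices $s=(0123)$, of $\big(CCS^{r,b,g}_{01,12,23}\big)^{\sigma(s)}$ and of the triply controlled $Z$ gates $CCCZ^{r,g,b,g}_{01,12,12,23}$; over the 2-simplices $s=(012)$ of face 4, of $\big((CT^\dagger)^{r,g}_{01,12}\big)^{\sigma(s)}$;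 and over the edges $e$ of $\mathrm{hinge}_{1,4}$, of $\big(\sqrt T^{\,r}_e\big)^{\sigma(e)}$, where $\sqrt T=\mathrm{diag}(1,e^{2\pi i/16})$. The operator $U$ is unitary and maps the code space onto itself, and the code space has an orthonormal basis $\overline{|0\rangle},\overline{|1\rangle}$ with $$\prod_{e\in\mathrm{hinge}_{1,4}}Z^r_e\,\overline{|m\rangle}=(-1)^m\,\overline{|m\rangle},\qquad U\,\overline{|m\rangle}=e^{2\pi i m/16}\,\overline{|m\rangle}\qquad(m=0,1),$$ i.e. $U$ implements the logical gate $\sqrt T=\mathrm{diag}(1,e^{2\pi i/16})$. -/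

import Mathlib

open scoped BigOperators

noncomputable section

namespace SqrtTCode

/-! ### Triangulated tetrahedra with a branching structure -/

/-- A finite triangulation of the tetrahedron together with a branching structure.  Points of the
tetrahedron are given by their barycentric coordinates `x 0, x 1, x 2, x 3`; for `i = 0, 1, 2, 3`
the `(i+1)`-st boundary face is `{x | x i = 0}`.  `dir u v` says that the edge with end points
`u, v` is oriented from `u` to `v`. -/
structure TriangulatedTetrahedron where
  K : Geometry.SimplicialComplex ℝ (Fin 4 → ℝ)
  finite_faces : K.faces.Finite
  space_eq : K.space = stdSimplex ℝ (Fin 4)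
  dir : (Fin 4 → ℝ) → (Fin 4 → ℝ) → Prop
  dir_irrefl : ∀ u, ¬ dir u u
  dir_edge : ∀ u v, {u, v} ∈ K.faces → u ≠ v → (dir u v ↔ ¬ dir v u)
  dir_acyclic : ∀ u v w, {u, v, w} ∈ K.faces → dir u v → dir v w → ¬ dir w u

variable (T : TriangulatedTetrahedron)

/-- A `k`-simplex of the triangulation, with its vertices `0, 1, …, k` listed in the order given by
the branching structure. -/
def Simplex (k : ℕ) : Type :=
  {v : Fin (k + 1) → Fin 4 → ℝ // Finset.univ.image v ∈ T.K.faces ∧ ∀ i j, i < j → T.dir (v i) (v j)}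

theorem simplex_finite (k : ℕ) : Finite (Simplex T k) := by
  have hV : (⋃ s ∈ T.K.faces, (s : Set (Fin 4 → ℝ))).Finite :=
    T.finite_faces.biUnion fun s _ => s.finite_toSet
  have hA : {v : Fin (k + 1) → Fin 4 → ℝ |
      ∀ i, v i ∈ ⋃ s ∈ T.K.faces, (s : Set (Fin 4 → ℝ))}.Finite := by
    simpa [Set.pi] using
      Set.Finite.pi' (fun _ : Fin (k + 1) => hV)
  refine Set.Finite.to_subtype (s := {v | Finset.univ.image v ∈ T.K.faces ∧
    ∀ i j, i < j → T.dir (v i) (v j)}) (hA.subset ?_)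
  intro v hv i
  exact Set.mem_biUnion hv.1 (by simp)

instance (k : ℕ) : Fintype (Simplex T k) :=
  haveI := simplex_finite T k
  Fintype.ofFinite _

instance (k : ℕ) : DecidableEq (Simplex T k) := Classical.decEq _

variable {T}

/-- The subsimplex of `s` whose vertices are number `φ 0 < … < φ k` of `s`. -/
def Simplex.sub {n k : ℕ} (s : Simplex T n) (φ : Fin (k + 1) → Fin (n + 1)) (hφ : StrictMono φ) :
    Simplex T k :=
  ⟨fun i => s.1 (φ i),
    T.K.down_closed s.2.1
      (by
        intro x hx
        obtain ⟨i, _, rfl⟩ := Finset.mem_image.1 hx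
        exact Finset.mem_image_of_mem _ (Finset.mem_univ _))
      (Finset.univ_nonempty.image _),
    fun _ _ h => s.2.2 _ _ (hφ h)⟩

/-- The edge of `s` joining the vertices number `i < j`. -/
def Simplex.edge {n : ℕ} (s : Simplex T n) (i j : Fin (n + 1)) (h : i < j) : Simplex T 1 :=
  s.sub ![i, j] (by
    intro a b hab
    fin_cases a <;> fin_cases b <;> simp_all)

/-- The `m`-simplex spanned by the first vertices of an `(m + n)`-simplex. -/
def Simplex.front (m n : ℕ) (s : Simplex T (m + n)) : Simplex T m :=
  s.sub (fun i => ⟨i.1, by omega⟩) (fun _ _ h => h)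

/-- The `n`-simplex spanned by the last vertices of an `(m + n)`-simplex. -/
def Simplex.back (m n : ℕ) (s : Simplex T (m + n)) : Simplex T n :=
  s.sub (fun i => ⟨m + i.1, by omega⟩) (fun _ _ h => Nat.add_lt_add_left h m)

/-- The simplex lies on the `(i+1)`-st boundary face of the tetrahedron. -/
def Simplex.OnFace {k : ℕ} (i : Fin 4) (s : Simplex T k) : Prop := ∀ j, s.1 j i = 0

/-! ### Cochains, cup products and integrals -/

variable (T) in
/-- `R`-valued `k`-cochains. -/
abbrev Cochain (k : ℕ) (R : Type) : Type := Simplex T k → R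

section Cochains

variable {R : Type} [CommRing R]

def cup {m n : ℕ} (f : Cochain T m R) (g : Cochain T n R) : Cochain T (m + n) R :=
  fun s => f (s.front m n) * g (s.back m n)

/-- The product `∪₁` of two 1-cochains. -/
def cupOne (f g : Cochain T 1 R) : Cochain T 1 R := fun e => f e * g e

/-- The indicator cochain of a simplex. -/
def indicator (R : Type) [CommRing R] {k : ℕ} (s : Simplex T k) : Cochain T k R :=
  Pi.single s 1

/-- Orientation sign of four points of the tetrahedron, normalized such that the four corners
(opposite to the 1st, 2nd, 3rd, 4th face, in this order) are positively oriented. -/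
def orient (x : Fin 4 → Fin 4 → ℝ) : ℤ := (SignType.sign (Matrix.det (Matrix.of x)) : ℤ)

/-- The corner of the tetrahedron opposite to the `(i+1)`-st face. -/
def corner (i : Fin 4) : Fin 4 → ℝ := Pi.single i 1

/-- Orientation `±1` of a 3-simplex. -/
def bulkSign (s : Simplex T 3) : ℤ := orient s.1

/-- Orientation `±1` of a 2-simplex on the 4th face, for the boundary orientation: the sign is
that of the 3-simplex obtained by putting a point on the inner side of the face in front. -/
def bdrySign (s : Simplex T 2) : ℤ := orient ![corner 3, s.1 0, s.1 1, s.1 2]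

/-- Orientation `±1` of a 1-simplex on the hinge between the 1st and the 4th face, where the hinge
is oriented as a part of the boundary of the 4th face. -/
def hingeSign (s : Simplex T 1) : ℤ := orient ![corner 3, corner 0, s.1 0, s.1 1]

variable (T) in
open Classical in
/-- The 2-simplices on the 4th face. -/
def bdry : Finset (Simplex T 2) := Finset.univ.filter fun s => s.OnFace 3

variable (T) in
open Classical in
/-- The 1-simplices on the hinge between the 1st and the 4th face. -/
def hinge : Finset (Simplex T 1) := Finset.univ.filter fun s => s.OnFace 0 ∧ s.OnFace 3

def bulkIntegral (f : Cochain T 3 R) : R := ∑ s, (bulkSign s : R) * f s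

def bdryIntegral (f : Cochain T 2 R) : R := ∑ s ∈ bdry T, (bdrySign s : R) * f s

def hingeIntegral (f : Cochain T 1 R) : R := ∑ s ∈ hinge T, (hingeSign s : R) * f s

end Cochains

/-! ### Qubits and gates -/

inductive Color
  | red | green | blue | yellow
  deriving DecidableEq

instance : Fintype Color :=
  ⟨{Color.red, Color.green, Color.blue, Color.yellow}, fun c => by cases c <;> decide⟩

open Color

variable (T) in
/-- Four qubits, one of each color, on every edge. -/
abbrev Qubit : Type := Simplex T 1 × Color

variable (T) in
/-- Labels of the computational (Pauli `Z`) basis. -/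
abbrev Config : Type := Qubit T → ZMod 2

variable (T) in
/-- The Hilbert space of all physical qubits; `ψ a` is the amplitude of the basis state `|a⟩`. -/
abbrev State : Type := EuclideanSpace ℂ (Config T)

variable (T) in
abbrev Op : Type := Module.End ℂ (State T)

/-- The diagonal operator `|a⟩ ↦ f a • |a⟩`. -/
def diagOp (f : Config T → ℂ) : Op T where
  toFun ψ := WithLp.toLp 2 fun a => f a * ψ a
  map_add' ψ φ := by ext a; simp [mul_add]
  map_smul' c ψ := by ext a; simp [mul_left_comm]

/-- The operator `|a⟩ ↦ |π a⟩`. -/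
def permOp (π : Equiv.Perm (Config T)) : Op T where
  toFun ψ := WithLp.toLp 2 fun a => ψ (π.symm a)
  map_add' ψ φ := by ext a; simp
  map_smul' c ψ := by ext a; simp

/-- The product of the operators `f i`, `i ∈ S`; it is only used for commuting families, for which
the order of the factors does not matter. -/
def opProd {ι : Type} (S : Finset ι) (f : ι → Op T) : Op T := (S.toList.map f).prod

/-- Pauli `X` on the qubit `q`. -/
def pauliX (q : Qubit T) : Op T := permOp (Equiv.addRight (Pi.single q 1))

/-- The multiply controlled phase gate: multiplies `|a⟩` by `z` if all qubits of `S` are in the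
state `1`. -/
def phaseGate (S : Finset (Qubit T)) (z : ℂ) : Op T :=
  diagOp fun a => if ∀ q ∈ S, a q = 1 then z else 1

/-- Pauli `Z` on the qubit `q`. -/
def pauliZ (q : Qubit T) : Op T := phaseGate {q} (-1)

/-- The gate `CCZ`. -/
def ccz (q₁ q₂ q₃ : Qubit T) : Op T := phaseGate {q₁, q₂, q₃} (-1)

/-- The gate `CNOT` with control `c` and target `t`. -/
def cnot (c t : Qubit T) (h : c ≠ t) : Op T :=
  permOp
    { toFun := fun a => Function.update a t (a t + a c)
      invFun := fun a => Function.update a t (a t + a c)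
      left_inv := by
        intro a
        funext q
        by_cases hq : q = t
        · subst hq
          simp [Function.update_of_ne h, add_assoc, CharTwo.add_self_eq_zero]
        · simp [Function.update_of_ne hq]
      right_inv := by
        intro a
        funext q
        by_cases hq : q = t
        · subst hq
          simp [Function.update_of_ne h, add_assoc, CharTwo.add_self_eq_zero]
        · simp [Function.update_of_ne hq] }

/-! ### Stabilizers and code space -/

open Classical in
/-- The edges containing the vertex `v`. -/
def edgeStar (v : Simplex T 0) : Finset (Simplex T 1) :=
  Finset.univ.filter fun e => v.1 0 = e.1 0 ∨ v.1 0 = e.1 1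

open Classical in
/-- The `CCZ` dressing of the `X`-stabilizer of color `c` at the vertex `v`.  The color of the
dressed stabilizer determines the slot of `r ∪ y ∪ b ∪ g` that is occupied by `v`. -/
def dressing (v : Simplex T 0) : Color → Op T
  | red => opProd (Finset.univ.filter fun t : Simplex T 1 × Simplex T 1 × Simplex T 1 =>
        bulkIntegral (cup (cup (cup (indicator (ZMod 2) v) (indicator (ZMod 2) t.1))
          (indicator (ZMod 2) t.2.1)) (indicator (ZMod 2) t.2.2)) ≠ 0)
      fun t => ccz (t.1, yellow) (t.2.1, blue) (t.2.2, green)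
  | yellow => opProd (Finset.univ.filter fun t : Simplex T 1 × Simplex T 1 × Simplex T 1 =>
        bulkIntegral (cup (cup (cup (indicator (ZMod 2) t.1) (indicator (ZMod 2) v))
          (indicator (ZMod 2) t.2.1)) (indicator (ZMod 2) t.2.2)) ≠ 0)
      fun t => ccz (t.1, red) (t.2.1, blue) (t.2.2, green)
  | blue => opProd (Finset.univ.filter fun t : Simplex T 1 × Simplex T 1 × Simplex T 1 =>
        bulkIntegral (cup (cup (cup (indicator (ZMod 2) t.1) (indicator (ZMod 2) t.2.1))
          (indicator (ZMod 2) v)) (indicator (ZMod 2) t.2.2)) ≠ 0)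
      fun t => ccz (t.1, red) (t.2.1, yellow) (t.2.2, green)
  | green => opProd (Finset.univ.filter fun t : Simplex T 1 × Simplex T 1 × Simplex T 1 =>
        bulkIntegral (cup (cup (cup (indicator (ZMod 2) t.1) (indicator (ZMod 2) t.2.1))
          (indicator (ZMod 2) t.2.2)) (indicator (ZMod 2) v)) ≠ 0)
      fun t => ccz (t.1, red) (t.2.1, yellow) (t.2.2, blue)

/-- The operator `S_{X;v}` of color `c` (truncated to the tetrahedron if `v` is on its boundary). -/
def xStab (v : Simplex T 0) (c : Color) : Op T :=
  opProd (edgeStar v) (fun e => pauliX (e, c)) * dressing v c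

/-- The operator `S_{Z;f}` of color `c`: the product of `Z` over the three edges of `f`. -/
def zStab (f : Simplex T 2) (c : Color) : Op T :=
  opProd (Finset.univ : Finset (Fin 3)) fun i =>
    pauliZ (f.sub i.succAbove (Fin.strictMono_succAbove i), c)

/-- `S_{X;v}` of color `c` commutes with the `Z`-stabilizers of those among the 1st, 2nd and 3rd
faces (where blue, red, green vanish, respectively) that contain `v`. -/
def Unbroken (v : Simplex T 0) (c : Color) : Prop :=
  (v.OnFace 0 → c ≠ blue) ∧ (v.OnFace 1 → c ≠ red) ∧ (v.OnFace 2 → c ≠ green)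

variable (T) in
/-- The stabilizers, including those at the boundary.  A vertex on a hinge or at a corner carries the
`X`-stabilizers that commute with the boundary `Z`-stabilizers of all the faces it belongs to. -/
inductive IsStabilizer : Op T → Prop
  | z (f : Simplex T 2) (c : Color) : IsStabilizer (zStab f c)
  | z_face1 (e : Simplex T 1) (h : e.OnFace 0) : IsStabilizer (pauliZ (e, blue))
  | z_face2 (e : Simplex T 1) (h : e.OnFace 1) : IsStabilizer (pauliZ (e, red))
  | z_face3 (e : Simplex T 1) (h : e.OnFace 2) : IsStabilizer (pauliZ (e, green))
  | z_face4 (e : Simplex T 1) (h : e.OnFace 3) :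
      IsStabilizer (pauliZ (e, red) * pauliZ (e, green) * pauliZ (e, blue))
  | z_face4' (e : Simplex T 1) (h : e.OnFace 3) : IsStabilizer (pauliZ (e, yellow))
  | x (v : Simplex T 0) (c : Color) (h : ¬ v.OnFace 3) (hc : Unbroken v c) :
      IsStabilizer (xStab v c)
  | x_face4 (v : Simplex T 0) (c c' : Color) (h : v.OnFace 3) (hcc' : c ≠ c')
      (hy : c ≠ yellow) (hy' : c' ≠ yellow) (hc : Unbroken v c) (hc' : Unbroken v c') :
      IsStabilizer (xStab v c * xStab v c')

variable (T) in
/-- The code space: the states fixed by all stabilizers. -/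
def codeSpace : Submodule ℂ (State T) where
  carrier := {ψ | ∀ S : Op T, IsStabilizer T S → S ψ = ψ}
  add_mem' hψ hφ S hS := by rw [map_add, hψ S hS, hφ S hS]
  zero_mem' S _ := map_zero S
  smul_mem' c ψ hψ S hS := by rw [map_smul, hψ S hS]

/-! ### The logical gate -/

variable (T) in
/-- The transversal `CNOT` operator. -/
def V : Op T :=
  opProd (Finset.univ : Finset (Simplex T 1)) fun e =>
    cnot (e, red) (e, yellow) (by simp) * cnot (e, green) (e, yellow) (by simp) *
      cnot (e, blue) (e, yellow) (by simp)

/-- The gauge field of color `c`. -/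
def gauge (a : Config T) (c : Color) : Cochain T 1 (ZMod 2) := fun e => a (e, c)

/-- The integer lift, with values in `{0, 1}`, of a gauge field. -/
def lift (a : Config T) (c : Color) : Cochain T 1 ℤ := fun e => ((a (e, c)).val : ℤ)

variable (T) in
/-- The operator `W`, as the exponential of integrals of cochains. -/
def W : Op T :=
  diagOp fun a => Complex.exp (Real.pi * Complex.I *
    ((bulkIntegral (cup (cup (lift a red) (lift a blue)) (lift a green)) : ℤ) / 2
      + ((bulkIntegral (cup (cup (gauge a red) (cupOne (gauge a green) (gauge a blue)))
            (gauge a green)) : ZMod 2).val : ℂ)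
      - (bdryIntegral (cup (lift a red) (lift a green)) : ℤ) / 4
      + (hingeIntegral (lift a red) : ℤ) / 8))

variable (T) in
/-- The circuit of `CCS` (and `CCCZ`) gates in the bulk, `CT†` gates on the 4th face and `√T` gates
on the hinge, each raised to the power `±1` given by the orientation of its simplex. -/
def circuitW : Op T :=
  opProd (Finset.univ : Finset (Simplex T 3)) (fun s =>
      phaseGate {(s.edge 0 1 (by decide), red), (s.edge 1 2 (by decide), blue),
          (s.edge 2 3 (by decide), green)} (Complex.I ^ bulkSign s) *
        phaseGate {(s.edge 0 1 (by decide), red), (s.edge 1 2 (by decide), green),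
          (s.edge 1 2 (by decide), blue), (s.edge 2 3 (by decide), green)} (-1)) *
    opProd (bdry T) (fun s =>
      phaseGate {(s.edge 0 1 (by decide), red), (s.edge 1 2 (by decide), green)}
        (Complex.exp (-(Real.pi * Complex.I / 4)) ^ bdrySign s)) *
    opProd (hinge T) (fun e =>
      phaseGate {(e, red)} (Complex.exp (2 * Real.pi * Complex.I / 16) ^ hingeSign e))

variable (T) in
/-- The operator `U = W V`. -/
def U : Op T := W T * V T

variable (T) in
/-- The logical Pauli `Z`: the product of the red `Z` over the hinge between the 1st and the 4th
face, i.e. the holonomy of the red gauge field along this hinge. -/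
def logicalZ : Op T := opProd (hinge T) fun e => pauliZ (e, red)

end SqrtTCode

end

open scoped BigOperators

noncomputable section

namespace SqrtTCode

open Finset Color

variable {T : TriangulatedTetrahedron}

/-! ### Simplices and their vertices -/

/-! The `Z`-stabilizers confine code states to flat gauge fields that obey the boundary conditions.
On a triangulated tetrahedron a flat field is a coboundary (`exists_potential`), so such a
configuration comes from potentials `l c` on the vertices. These can be normalized: blue, red,
green, yellow vanish on faces 1, 2, 3, 4 respectively. They are then unique (`Normalized.eq`), and
on face 4 the sum of the red, green and blue potentials is a constant `k`. This `k` is the logical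
value.

An `X`-stabilizer changes potentials at one vertex. Its `CCZ` phase is exactly the variation of the
action, the mod 2 integral of `l_r ∪ dl_y ∪ dl_b ∪ dl_g` (`action_shift`); the boundary terms of the
integration by parts vanish by the boundary conditions. So for a code state `ψ` the function
`(-1)^action · ψ` is invariant under these moves, and the moves connect all potentials in a sector
(`relAmplitude_eq`). Hence there is one code state for each `k`, and the dimension is 2.

The operator `V` adds `l_r + l_g + l_b + k` to the yellow potential, which changes the action by
`mixExponent`. In units of `2π/16`, the exponent of `W` plus eight times this change is evaluated by
descent (`exponent_eq`): the bulk density is a coboundary; its primitive on face 4, combined with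
the face term of `W`, is again a coboundary; and so is the result on the hinge. What remains is the
red potential at the end `corner 1` of the hinge, which equals `k`. Thus `U` multiplies sector `k`
by `e^{2πik/16}`.

Two topological facts are derived directly from the geometric simplicial complex. Stokes' theorem
(`stokes`) follows by counting cofaces of a simplex: one on each side in the interior of a face of
the tetrahedron, a single one at its boundary. Potentials for flat fields are obtained by gluing
local potentials along a bisection of the unit cube. -/

theorem dir_asymm {u v : Fin 4 → ℝ} (h : {u, v} ∈ T.K.faces) (huv : T.dir u v) : ¬ T.dir v u := by
  have hne : u ≠ v := fun h => T.dir_irrefl u (by rw [← h] at huv; exact huv)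
  exact (T.dir_edge u v h hne).1 huv

theorem dir_total {u v : Fin 4 → ℝ} (h : {u, v} ∈ T.K.faces) (hne : u ≠ v) :
    T.dir u v ∨ T.dir v u := by
  by_contra! hc
  exact hc.1 ((T.dir_edge u v h hne).2 hc.2)

theorem Simplex.injective {k : ℕ} (s : Simplex T k) : Function.Injective s.1 := by
  intro i j hij
  by_contra hne
  rcases lt_or_gt_of_ne hne with h | h
  · have := s.2.2 i j h
    rw [hij] at this
    exact T.dir_irrefl _ this
  · have := s.2.2 j i h
    rw [hij] at this
    exact T.dir_irrefl _ this

theorem pair_mem_faces {t : Finset (Fin 4 → ℝ)} (ht : t ∈ T.K.faces) {u v : Fin 4 → ℝ}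
    (hu : u ∈ t) (hv : v ∈ t) : {u, v} ∈ T.K.faces :=
  T.K.down_closed ht (by intro x hx; simp only [mem_insert, mem_singleton] at hx; aesop) (by simp)

theorem triple_mem_faces {t : Finset (Fin 4 → ℝ)} (ht : t ∈ T.K.faces) {u v w : Fin 4 → ℝ}
    (hu : u ∈ t) (hv : v ∈ t) (hw : w ∈ t) : {u, v, w} ∈ T.K.faces :=
  T.K.down_closed ht (by intro x hx; simp only [mem_insert, mem_singleton] at hx; aesop) (by simp)

theorem Simplex.mem_image {k : ℕ} (s : Simplex T k) (i : Fin (k + 1)) : s.1 i ∈ univ.image s.1 :=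
  mem_image_of_mem _ (mem_univ _)

/-- A simplex is determined by its set of vertices. -/
theorem Simplex.ext_image {k : ℕ} {s s' : Simplex T k} (h : univ.image s.1 = univ.image s'.1) :
    s = s' := by
  have h1 : ∀ i, ∃ j, s.1 j = s'.1 i := by
    intro i
    have : s'.1 i ∈ univ.image s.1 := by rw [h]; exact s'.mem_image i
    simpa using this
  choose p hp using h1
  have hmono : StrictMono p := by
    intro i j hij
    have hd := s'.2.2 i j hij
    rw [← hp i, ← hp j] at hd
    rcases lt_trichotomy (p i) (p j) with h | h | h
    · exact h
    · rw [h] at hd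
      exact (T.dir_irrefl _ hd).elim
    · exact (dir_asymm (pair_mem_faces s.2.1 (s.mem_image _) (s.mem_image _)) hd
        (s.2.2 _ _ h)).elim
  have hsurj : Function.Surjective p := Finite.injective_iff_surjective.1 hmono.injective
  -- A strictly increasing surjection of `Fin (k + 1)` has the same range as the identity, hence is
  -- the identity.
  have hid : p = id := (hmono.range_inj strictMono_id).1 (by simp [hsurj.range_eq])
  apply Subtype.ext
  funext i
  rw [← hp i, hid]
  rfl

theorem exists_enumeration {α : Type*} [Fintype α] (r : α → α → Prop) [IsStrictTotalOrder α r]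
    {n : ℕ} (h : Fintype.card α = n) : ∃ e : Fin n ≃ α, ∀ i j, i < j → r (e i) (e j) := by
  classical
  let : LinearOrder α := linearOrderOfSTO r
  exact ⟨(Fintype.orderIsoFinOfCardEq α h).toEquiv,
    fun i j hij => (Fintype.orderIsoFinOfCardEq α h).strictMono hij⟩

/-- The vertices of a face are totally ordered by the branching structure. -/
theorem exists_simplex {k : ℕ} {t : Finset (Fin 4 → ℝ)} (ht : t ∈ T.K.faces)
    (hc : t.card = k + 1) : ∃ s : Simplex T k, univ.image s.1 = t := by
  have : IsStrictTotalOrder {x // x ∈ t} fun u v => T.dir u.1 v.1 :=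
    { trichotomous := by
        intro u v huv hvu
        by_contra h
        rcases dir_total (pair_mem_faces ht u.2 v.2) (fun h' => h (Subtype.ext h')) with h | h
        exacts [huv h, hvu h]
      irrefl := fun u => T.dir_irrefl _
      trans := by
        intro u v w huv hvw
        have hn := T.dir_acyclic _ _ _ (triple_mem_faces ht u.2 v.2 w.2) huv hvw
        by_contra h
        by_cases he : u.1 = w.1
        · rw [he] at huv
          exact dir_asymm (pair_mem_faces ht w.2 v.2) huv hvw
        · rcases dir_total (pair_mem_faces ht u.2 w.2) he with h' | h'
          exacts [h h', hn h'] }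
  obtain ⟨e, he⟩ := exists_enumeration (fun u v : {x // x ∈ t} => T.dir u.1 v.1)
    (n := k + 1) (by simp [hc])
  have himg : univ.image (fun i => (e i).1) = t := by
    ext x
    simp only [Finset.mem_image, mem_univ, true_and]
    constructor
    · rintro ⟨i, rfl⟩
      exact (e i).2
    · intro hx
      exact ⟨e.symm ⟨x, hx⟩, by simp⟩
  exact ⟨⟨fun i => (e i).1, by rw [himg]; exact ht, he⟩, himg⟩

theorem mem_stdSimplex_of_mem {t : Finset (Fin 4 → ℝ)} (ht : t ∈ T.K.faces) {v : Fin 4 → ℝ}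
    (hv : v ∈ t) : v ∈ stdSimplex ℝ (Fin 4) := by
  rw [← T.space_eq]
  exact T.K.subset_space ht hv

theorem Simplex.mem_stdSimplex {k : ℕ} (s : Simplex T k) (i : Fin (k + 1)) :
    s.1 i ∈ stdSimplex ℝ (Fin 4) := mem_stdSimplex_of_mem s.2.1 (s.mem_image i)

theorem Simplex.sum_coord {k : ℕ} (s : Simplex T k) (i : Fin (k + 1)) : ∑ j, s.1 i j = 1 :=
  (s.mem_stdSimplex i).2

theorem Simplex.coord_nonneg {k : ℕ} (s : Simplex T k) (i : Fin (k + 1)) (j : Fin 4) :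
    0 ≤ s.1 i j := (s.mem_stdSimplex i).1 j

/-- All vertices lie in the affine hyperplane of coordinate sum 1, which misses the origin. Summing
coordinates in a linear relation shows that its coefficients add up to 0, so affine independence
applies. -/
theorem Simplex.linearIndependent {k : ℕ} (s : Simplex T k) : LinearIndependent ℝ s.1 := by
  have hA : AffineIndependent ℝ s.1 := by
    have h := T.K.indep s.2.1
    let f : Fin (k + 1) ↪ {x // x ∈ univ.image s.1} :=
      ⟨fun i => ⟨s.1 i, s.mem_image i⟩, fun i j hij => s.injective (congrArg Subtype.val hij)⟩
    exact h.comp_embedding f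
  rw [affineIndependent_iff] at hA
  rw [Fintype.linearIndependent_iff]
  intro c hc i
  refine hA univ c ?_ hc i (mem_univ i)
  have h1 : ∑ j, (∑ i, c i • s.1 i) j = 0 := by rw [hc]; simp
  simp only [Finset.sum_apply, Pi.smul_apply, smul_eq_mul] at h1
  rw [sum_comm] at h1
  simpa [← mul_sum, s.sum_coord] using h1

/-! ### Carriers -/

/-- A point of the tetrahedron has positive barycentric coordinates in some face. -/
theorem exists_carrier {x : Fin 4 → ℝ} {t : Finset (Fin 4 → ℝ)} (ht : t ∈ T.K.faces)
    (hx : x ∈ convexHull ℝ (t : Set (Fin 4 → ℝ))) :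
    ∃ t' ∈ T.K.faces, t' ⊆ t ∧ ∃ w : (Fin 4 → ℝ) → ℝ, (∀ v ∈ t', 0 < w v) ∧ ∑ v ∈ t', w v = 1 ∧
      ∑ v ∈ t', w v • v = x := by
  rw [Finset.mem_convexHull'] at hx
  obtain ⟨w, h0, h1, h2⟩ := hx
  have hs : ∑ v ∈ t with 0 < w v, w v = 1 := by
    rw [← h1]
    refine sum_filter_of_ne fun v hv hne => lt_of_le_of_ne (h0 v hv) hne.symm
  refine ⟨t.filter fun v => 0 < w v, T.K.down_closed ht (filter_subset _ _) ?_, filter_subset _ _,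
    w, fun v hv => (mem_filter.1 hv).2, hs, ?_⟩
  · by_contra hne
    rw [not_nonempty_iff_eq_empty] at hne
    rw [hne] at hs
    simp at hs
  · rw [← h2]
    refine sum_filter_of_ne fun v hv hne => lt_of_le_of_ne (h0 v hv) ?_
    intro h
    rw [← h, zero_smul] at hne
    exact hne rfl

/-- The vertices of the carrier of a point lie on every face of the tetrahedron that contains the
point. -/
theorem coord_eq_zero_of_carrier {x : Fin 4 → ℝ} {t : Finset (Fin 4 → ℝ)} (ht : t ∈ T.K.faces)
    {w : (Fin 4 → ℝ) → ℝ} (hw : ∀ v ∈ t, 0 < w v) (hx : ∑ v ∈ t, w v • v = x) {i : Fin 4}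
    (hi : x i = 0) {v : Fin 4 → ℝ} (hv : v ∈ t) : v i = 0 := by
  rw [← hx] at hi
  simp only [Finset.sum_apply, Pi.smul_apply, smul_eq_mul] at hi
  rw [sum_eq_zero_iff_of_nonneg] at hi
  · exact (mul_eq_zero.1 (hi v hv)).resolve_left (hw v hv).ne'
  · intro u hu
    exact mul_nonneg (hw u hu).le ((mem_stdSimplex_of_mem ht hu).1 i)

/-- Every point lies in a face all of whose vertices share the vanishing coordinates of the
point. -/
theorem exists_face {x : Fin 4 → ℝ} (hx : x ∈ stdSimplex ℝ (Fin 4)) :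
    ∃ t ∈ T.K.faces, x ∈ convexHull ℝ (t : Set (Fin 4 → ℝ)) ∧
      ∀ v ∈ t, ∀ i, x i = 0 → v i = 0 := by
  rw [← T.space_eq, T.K.mem_space_iff] at hx
  obtain ⟨t, ht, hxt⟩ := hx
  obtain ⟨t', ht', -, w, hw, hw1, hwx⟩ := exists_carrier ht hxt
  refine ⟨t', ht', ?_, fun v hv i hi => coord_eq_zero_of_carrier ht' hw hwx hi hv⟩
  rw [Finset.mem_convexHull']
  exact ⟨w, fun v hv => (hw v hv).le, hw1, hwx⟩

/-- Some vertex lies in all the faces that contain a given point. -/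
theorem exists_common_vertex {x : Fin 4 → ℝ} (hx : x ∈ stdSimplex ℝ (Fin 4)) :
    ∃ u : Fin 4 → ℝ, ∀ t ∈ T.K.faces, x ∈ convexHull ℝ (t : Set (Fin 4 → ℝ)) → u ∈ t := by
  classical
  have hne : ∃ n, ∃ t ∈ T.K.faces, x ∈ convexHull ℝ (t : Set (Fin 4 → ℝ)) ∧ t.card = n := by
    rw [← T.space_eq, T.K.mem_space_iff] at hx
    obtain ⟨t, ht, hxt⟩ := hx
    exact ⟨_, t, ht, hxt, rfl⟩
  -- `t0` has the fewest vertices among the faces containing `x`. Its intersection with any other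
  -- such face `t` is again one, so by minimality `t0 ⊆ t`, and any vertex of `t0` will do.
  obtain ⟨t0, ht0, hx0, hc⟩ := Nat.find_spec hne
  obtain ⟨u, hu⟩ := T.K.nonempty_of_mem_faces ht0
  refine ⟨u, fun t ht hxt => ?_⟩
  have hi : x ∈ convexHull ℝ ((t0 ∩ t : Finset _) : Set (Fin 4 → ℝ)) := by
    rw [coe_inter]
    exact T.K.inter_subset_convexHull ht0 ht ⟨hx0, hxt⟩
  have hmem : t0 ∩ t ∈ T.K.faces := by
    refine T.K.down_closed ht0 inter_subset_left ?_
    rw [← coe_nonempty, ← convexHull_nonempty_iff (𝕜 := ℝ)]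
    exact ⟨x, hi⟩
  have hle := Nat.find_min' hne ⟨_, hmem, hi, rfl⟩
  rw [← hc] at hle
  have := eq_of_subset_of_card_le inter_subset_left hle
  rw [← this] at hu
  exact (mem_inter.1 hu).2

/-- The point with equal barycentric coordinates in a simplex. -/
def Simplex.centroid {k : ℕ} (s : Simplex T k) : Fin 4 → ℝ := ∑ i, ((k : ℝ) + 1)⁻¹ • s.1 i

theorem Simplex.mem_convexHull {k : ℕ} (s : Simplex T k) {c : Fin (k + 1) → ℝ}
    (h0 : ∀ i, 0 ≤ c i) (h1 : ∑ i, c i = 1) :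
    ∑ i, c i • s.1 i ∈ convexHull ℝ ((univ.image s.1 : Finset _) : Set (Fin 4 → ℝ)) := by
  refine (convex_convexHull ℝ _).sum_mem (fun i _ => h0 i) h1 fun i _ => ?_
  exact subset_convexHull ℝ _ (mem_coe.2 (s.mem_image i))

theorem Simplex.centroid_mem {k : ℕ} (s : Simplex T k) :
    s.centroid ∈ convexHull ℝ ((univ.image s.1 : Finset _) : Set (Fin 4 → ℝ)) := by
  refine s.mem_convexHull (fun i => by positivity) ?_
  simp only [sum_const, card_univ, Fintype.card_fin, nsmul_eq_mul]
  push_cast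
  exact mul_inv_cancel₀ (by positivity)

/-- The centroid lies in the hull of the common vertices of `s` and `t`. Were a vertex of `s`
missing, the centroid, and with it that vertex, would lie in the span of the other vertices. -/
theorem Simplex.subset_of_centroid_mem {k : ℕ} (s : Simplex T k) {t : Finset (Fin 4 → ℝ)}
    (ht : t ∈ T.K.faces) (h : s.centroid ∈ convexHull ℝ (t : Set (Fin 4 → ℝ))) :
    univ.image s.1 ⊆ t := by
  intro x hx
  obtain ⟨i, -, rfl⟩ := Finset.mem_image.1 hx
  by_contra hi
  have h1 := T.K.inter_subset_convexHull s.2.1 ht ⟨s.centroid_mem, h⟩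
  have hli := s.linearIndependent
  rw [linearIndependent_iff_notMem_span] at hli
  apply hli i
  have hsub : convexHull ℝ (((univ.image s.1 : Finset _) : Set (Fin 4 → ℝ)) ∩ t) ⊆
      Submodule.span ℝ (s.1 '' (Set.univ \ {i})) := by
    refine convexHull_min ?_ (Submodule.convex _)
    rintro y ⟨hy, hyt⟩
    rw [mem_coe, Finset.mem_image] at hy
    obtain ⟨j, -, rfl⟩ := hy
    refine Submodule.subset_span ⟨j, ⟨trivial, ?_⟩, rfl⟩
    rintro rfl
    exact hi hyt
  have h2 := hsub h1
  have h3 : s.1 i = ((k : ℝ) + 1) • s.centroid - ∑ j ∈ univ.erase i, s.1 j := by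
    rw [Simplex.centroid, smul_sum]
    simp_rw [smul_smul]
    rw [mul_inv_cancel₀ (by positivity)]
    simp only [one_smul]
    rw [← add_sum_erase univ s.1 (mem_univ i)]
    abel
  rw [h3]
  refine Submodule.sub_mem _ (Submodule.smul_mem _ _ h2) (Submodule.sum_mem _ fun j hj => ?_)
  exact Submodule.subset_span ⟨j, ⟨trivial, by simpa using (mem_erase.1 hj).1⟩, rfl⟩

/-! ### Cofaces of a simplex on one side of a hyperplane -/

theorem Simplex.map_centroid {k : ℕ} (f : Simplex T k) {ℓ : (Fin 4 → ℝ) →ₗ[ℝ] ℝ}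
    (hf : ∀ i, ℓ (f.1 i) = 0) : ℓ f.centroid = 0 := by
  simp [Simplex.centroid, hf]

theorem Simplex.centroid_mem_stdSimplex {k : ℕ} (f : Simplex T k) :
    f.centroid ∈ stdSimplex ℝ (Fin 4) := by
  rw [← T.space_eq]
  exact T.K.convexHull_subset_space f.2.1 f.centroid_mem

/-- Displace the centroid by a small `ε • u`. There are finitely many closed faces, so for small `ε`
every face containing the displaced point contains the centroid, hence `f`. Since `ℓ` is positive at
the displaced point, it is positive at some vertex `w` of such a face. Taking the face from
`exists_face` keeps `w` in the prescribed coordinate subspace. -/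
theorem Simplex.exists_coface {k : ℕ} (f : Simplex T k) {ℓ : (Fin 4 → ℝ) →ₗ[ℝ] ℝ}
    (hf : ∀ i, ℓ (f.1 i) = 0) {I : Finset (Fin 4)} {u : Fin 4 → ℝ} (hu : 0 < ℓ u) {δ : ℝ}
    (hδ : 0 < δ) (hP : ∀ ε, 0 < ε → ε < δ → f.centroid + ε • u ∈ stdSimplex ℝ (Fin 4) ∧
      ∀ i ∈ I, (f.centroid + ε • u) i = 0) :
    ∃ w, 0 < ℓ w ∧ insert w (univ.image f.1) ∈ T.K.faces ∧ ∀ i ∈ I, w i = 0 := by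
  have hev : ∀ᶠ ε : ℝ in nhdsWithin 0 (Set.Ioi 0), ∀ t ∈ T.K.faces,
      f.centroid ∉ convexHull ℝ (t : Set (Fin 4 → ℝ)) →
        f.centroid + ε • u ∉ convexHull ℝ (t : Set (Fin 4 → ℝ)) := by
    rw [Filter.eventually_all_finite T.finite_faces]
    intro t _
    by_cases hc : f.centroid ∈ convexHull ℝ (t : Set (Fin 4 → ℝ))
    · exact Filter.Eventually.of_forall fun ε h => (h hc).elim
    · have hcl : IsClosed (convexHull ℝ (t : Set (Fin 4 → ℝ))) :=
        t.finite_toSet.isClosed_convexHull ℝ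
      have hcont : Continuous fun ε : ℝ => f.centroid + ε • u := by fun_prop
      have := hcont.continuousAt (x := 0) |>.eventually
        (hcl.isOpen_compl.mem_nhds (by simpa using hc))
      exact (this.filter_mono nhdsWithin_le_nhds).mono fun ε h _ => h
  have hev2 : ∀ᶠ ε : ℝ in nhdsWithin 0 (Set.Ioi 0), ε ∈ Set.Ioo 0 δ := Ioo_mem_nhdsGT hδ
  obtain ⟨ε, hε, h0, hd⟩ := (hev.and hev2).exists
  obtain ⟨hmem, hI⟩ := hP ε h0 hd
  obtain ⟨t, ht, hxt, hcoord⟩ := exists_face (T := T) hmem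
  have hct : f.centroid ∈ convexHull ℝ (t : Set (Fin 4 → ℝ)) := by
    by_contra h
    exact hε t ht h hxt
  have hsub := f.subset_of_centroid_mem ht hct
  obtain ⟨w, hwt, hw⟩ : ∃ w ∈ t, 0 < ℓ w := by
    by_contra! hall
    have hle : convexHull ℝ (t : Set (Fin 4 → ℝ)) ⊆ {x | ℓ x ≤ 0} :=
      convexHull_min (fun x hx => hall x hx) (convex_halfSpace_le ℓ.isLinear 0)
    have := hle hxt
    simp only [Set.mem_ofPred_eq, map_add, map_smul, f.map_centroid hf, smul_eq_mul, zero_add] at this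
    exact absurd this (not_le.2 (mul_pos h0 hu))
  refine ⟨w, hw, T.K.down_closed ht (insert_subset hwt hsub) (insert_nonempty _ _), ?_⟩
  exact fun i hi => hcoord w hwt i (hI i hi)

theorem sum_coord_of_mem {t : Finset (Fin 4 → ℝ)} (ht : t ∈ T.K.faces) {v : Fin 4 → ℝ}
    (hv : v ∈ t) : ∑ j, v j = 1 := (mem_stdSimplex_of_mem ht hv).2

/-- Two cofaces on the same side overlap: a point slightly off the centroid towards `w` lies in
both. If `w ≠ w'`, their common vertices all belong to `f`, so the overlap would lie in the kernel
of `ℓ`, where this point is not. -/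
theorem Simplex.coface_unique {k : ℕ} (f : Simplex T k) {ℓ : (Fin 4 → ℝ) →ₗ[ℝ] ℝ}
    (hf : ∀ i, ℓ (f.1 i) = 0) {w w' : Fin 4 → ℝ} (hw : 0 < ℓ w) (hw' : 0 < ℓ w')
    (h : insert w (univ.image f.1) ∈ T.K.faces) (h' : insert w' (univ.image f.1) ∈ T.K.faces)
    {c : ℝ} {d : Fin (k + 1) → ℝ} (hspan : w = c • w' + ∑ i, d i • f.1 i) : w = w' := by
  have hc : 0 < c := by
    have h1 : ℓ w = c * ℓ w' := by
      rw [hspan]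
      simp [hf]
    rw [h1] at hw
    exact (pos_iff_pos_of_mul_pos hw).2 hw'
  have hsum : c + ∑ i, d i = 1 := by
    have h1 : ∑ j, w j = c * ∑ j, w' j + ∑ i, d i * ∑ j, f.1 i j := by
      rw [hspan]
      simp only [Pi.add_apply, Pi.smul_apply, Finset.sum_apply, smul_eq_mul, sum_add_distrib,
        mul_sum]
      congr 1
      exact sum_comm
    rw [sum_coord_of_mem h (mem_insert_self _ _), sum_coord_of_mem h' (mem_insert_self _ _)] at h1
    simp only [f.sum_coord, mul_one] at h1
    exact h1.symm
  have hk : (0 : ℝ) < ((k : ℝ) + 1)⁻¹ := by positivity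
  -- The weights of the point at the vertices of `f`, in coordinates of the other coface; they are
  -- near `1 / (k + 1)` for small `ε`, whatever the signs of `d`.
  have hev : ∀ᶠ ε : ℝ in nhdsWithin 0 (Set.Ioi 0),
      ∀ i, 0 < (1 - ε) * ((k : ℝ) + 1)⁻¹ + ε * d i := by
    rw [Filter.eventually_all]
    intro i
    have hcont : Continuous fun ε : ℝ => (1 - ε) * ((k : ℝ) + 1)⁻¹ + ε * d i := by fun_prop
    have := hcont.continuousAt (x := 0) |>.eventually (lt_mem_nhds (a := 0) (by simpa using hk))
    exact this.filter_mono nhdsWithin_le_nhds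
  have hev2 : ∀ᶠ ε : ℝ in nhdsWithin 0 (Set.Ioi 0), ε ∈ Set.Ioo (0 : ℝ) 1 :=
    Ioo_mem_nhdsGT one_pos
  obtain ⟨ε, hε, h0, h1⟩ := (hev.and hev2).exists
  have hx1 : (1 - ε) • f.centroid + ε • w ∈
      convexHull ℝ ((insert w (univ.image f.1) : Finset _) : Set (Fin 4 → ℝ)) := by
    refine (convex_convexHull ℝ _) ?_ ?_ (by linarith) h0.le (by ring)
    · exact convexHull_mono (by simp) f.centroid_mem
    · exact subset_convexHull ℝ _ (by simp)
  have hx2 : (1 - ε) • f.centroid + ε • w ∈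
      convexHull ℝ ((insert w' (univ.image f.1) : Finset _) : Set (Fin 4 → ℝ)) := by
    have he : (1 - ε) • f.centroid + ε • w = (ε * c) • w' +
        ∑ i, ((1 - ε) * ((k : ℝ) + 1)⁻¹ + ε * d i) • f.1 i := by
      conv_lhs => rw [hspan]
      simp only [Simplex.centroid, smul_add, smul_sum, smul_smul, add_smul, sum_add_distrib]
      abel
    have hs : ∑ i, Fin.cons (α := fun _ => ℝ) (ε * c)
          (fun i => (1 - ε) * ((k : ℝ) + 1)⁻¹ + ε * d i) i •
        Fin.cons (α := fun _ => Fin 4 → ℝ) w' f.1 i = (1 - ε) • f.centroid + ε • w := by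
      rw [Fin.sum_univ_succ, he]
      simp
    rw [← hs]
    refine (convex_convexHull ℝ _).sum_mem (fun i _ => ?_) ?_ (fun i _ => ?_)
    · refine Fin.cases ?_ (fun i => ?_) i
      · simpa using (mul_pos h0 hc).le
      · simpa using (hε i).le
    · rw [Fin.sum_univ_succ]
      simp only [Fin.cons_zero, Fin.cons_succ, sum_add_distrib, sum_const, card_univ,
        Fintype.card_fin, nsmul_eq_mul, ← mul_sum]
      push_cast
      have : ((k : ℝ) + 1) * ((1 - ε) * ((k : ℝ) + 1)⁻¹) = 1 - ε := by
        field_simp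
      rw [this, show ∑ i, d i = 1 - c by linarith]
      ring
    · refine Fin.cases ?_ (fun i => ?_) i
      · exact subset_convexHull ℝ _ (by simp)
      · exact subset_convexHull ℝ _ (by simp)
  by_contra hne
  have hx := T.K.inter_subset_convexHull h h' ⟨hx1, hx2⟩
  have hle : convexHull ℝ (((insert w (univ.image f.1) : Finset _) : Set (Fin 4 → ℝ)) ∩
      (insert w' (univ.image f.1) : Finset _)) ⊆ LinearMap.ker ℓ := by
    refine convexHull_min ?_ (Submodule.convex _)
    rintro y ⟨hy, hy'⟩
    rw [mem_coe, Finset.mem_insert] at hy hy'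
    have : y ∈ univ.image f.1 := by
      rcases hy with rfl | hy
      · rcases hy' with hy' | hy'
        · exact (hne hy').elim
        · exact hy'
      · exact hy
    obtain ⟨i, -, rfl⟩ := Finset.mem_image.1 this
    exact hf i
  have := hle hx
  simp only [SetLike.mem_coe, LinearMap.mem_ker, map_add, map_smul, f.map_centroid hf,
    smul_eq_mul, mul_zero, zero_add] at this
  exact absurd this (mul_pos h0 hw).ne'

/-! ### Volume forms on coordinate subspaces -/

/-- The subspace on which the coordinates in `I` vanish. -/
def coordSub (I : Finset (Fin 4)) : Submodule ℝ (Fin 4 → ℝ) where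
  carrier := {x | ∀ i ∈ I, x i = 0}
  add_mem' hx hy i hi := by simp [hx i hi, hy i hi]
  zero_mem' _ _ := rfl
  smul_mem' c x hx i hi := by simp [hx i hi]

theorem mem_coordSub {I : Finset (Fin 4)} {x : Fin 4 → ℝ} :
    x ∈ coordSub I ↔ ∀ i ∈ I, x i = 0 := Iff.rfl

theorem corner_apply (i j : Fin 4) : corner i j = if j = i then 1 else 0 := by
  simp [corner, Pi.single_apply]

theorem corner_mem_coordSub {I : Finset (Fin 4)} {i : Fin 4} (hi : i ∉ I) :
    corner i ∈ coordSub I := by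
  intro j hj
  rw [corner_apply, if_neg]
  rintro rfl
  exact hi hj

theorem eq_sum_corner (x : Fin 4 → ℝ) : x = ∑ i, x i • corner i := by
  ext j
  simp [corner_apply]

theorem coordSub_eq_span (I : Finset (Fin 4)) :
    coordSub I = Submodule.span ℝ (Set.range fun i : {i // i ∉ I} => corner i.1) := by
  apply le_antisymm
  · intro x hx
    rw [eq_sum_corner x]
    refine Submodule.sum_mem _ fun i _ => ?_
    by_cases hi : i ∈ I
    · rw [hx i hi, zero_smul]
      exact Submodule.zero_mem _
    · exact Submodule.smul_mem _ _ (Submodule.subset_span ⟨⟨i, hi⟩, rfl⟩)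
  · rw [Submodule.span_le]
    rintro _ ⟨i, rfl⟩
    exact corner_mem_coordSub i.2

theorem finrank_coordSub (I : Finset (Fin 4)) :
    Module.finrank ℝ (coordSub I) + I.card = 4 := by
  have hli : LinearIndependent ℝ fun i : {i // i ∉ I} => corner i.1 := by
    have := (Pi.basisFun ℝ (Fin 4)).linearIndependent.comp
      (Subtype.val : {i // i ∉ I} → Fin 4) Subtype.val_injective
    convert this using 1
    ext i j
    simp [corner]
  rw [coordSub_eq_span, finrank_span_eq_card hli]
  have := Fintype.card_subtype_compl (fun i : Fin 4 => i ∈ I)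
  rw [this]
  simp only [Fintype.card_fin, Fintype.card_coe]
  have : I.card ≤ 4 := by simpa using card_le_univ I
  omega

/-- `D` is a volume form on the subspace where the coordinates in `I` vanish. -/
structure IsVolume {n : ℕ} (I : Finset (Fin 4)) (D : (Fin 4 → ℝ) [⋀^Fin n]→ₗ[ℝ] ℝ) : Prop where
  card : n + I.card = 4
  ne_zero : ∀ v : Fin n → Fin 4 → ℝ, (∀ j, v j ∈ coordSub I) → LinearIndependent ℝ v → D v ≠ 0

theorem isVolume_det : IsVolume ∅ (Matrix.detRowAlternating (R := ℝ) (n := Fin 4)) where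
  card := rfl
  ne_zero v _ hv := by
    have := (Matrix.linearIndependent_rows_iff_isUnit (A := Matrix.of v)).1 hv
    exact ((Matrix.isUnit_iff_isUnit_det _).1 this).ne_zero

theorem linearIndependent_cons_corner {n : ℕ} {j : Fin 4} {v : Fin n → Fin 4 → ℝ}
    (hv : LinearIndependent ℝ v) (hj : ∀ m, v m j = 0) :
    LinearIndependent ℝ (Fin.cons (corner j) v : Fin (n + 1) → Fin 4 → ℝ) := by
  rw [linearIndependent_finCons]
  refine ⟨hv, fun hmem => ?_⟩
  have hle : Submodule.span ℝ (Set.range v) ≤ coordSub {j} := by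
    rw [Submodule.span_le]
    rintro _ ⟨m, rfl⟩ i hi
    rw [Finset.mem_singleton.1 hi]
    exact hj m
  have := hle hmem j (mem_singleton_self j)
  simp [corner_apply] at this

/-- Contraction with the corner opposite to a face is the induced boundary orientation, "inward
vector first". Iterating it yields the forms behind `bdrySign` and `hingeSign`. -/
theorem IsVolume.curryLeft {n : ℕ} {I : Finset (Fin 4)} {D : (Fin 4 → ℝ) [⋀^Fin (n + 1)]→ₗ[ℝ] ℝ}
    (hD : IsVolume I D) {j : Fin 4} (hj : j ∉ I) :
    IsVolume (insert j I) (D.curryLeft (corner j)) where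
  card := by
    rw [card_insert_of_notMem hj]
    have := hD.card
    omega
  ne_zero v hv hli := by
    rw [AlternatingMap.curryLeft_apply_apply]
    refine hD.ne_zero _ ?_ (linearIndependent_cons_corner hli fun m => hv m j (mem_insert_self _ _))
    intro m
    refine Fin.cases ?_ (fun m => ?_) m
    · exact corner_mem_coordSub hj
    · exact fun i hi => hv m i (mem_insert_of_mem hi)

section

variable {n : ℕ} {I : Finset (Fin 4)} {D : (Fin 4 → ℝ) [⋀^Fin n]→ₗ[ℝ] ℝ}

/-- By dimension: `n` vectors in a subspace of dimension `n - 1` are dependent. -/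
theorem IsVolume.eq_zero (hD : IsVolume I D) {j : Fin 4} (hj : j ∉ I) {v : Fin n → Fin 4 → ℝ}
    (hv : ∀ m, v m ∈ coordSub (insert j I)) : D v = 0 := by
  apply AlternatingMap.map_linearDependent
  intro hli
  have h1 : Submodule.span ℝ (Set.range v) ≤ coordSub (insert j I) := by
    rw [Submodule.span_le]
    rintro _ ⟨m, rfl⟩
    exact hv m
  have h2 := Submodule.finrank_mono h1
  rw [finrank_span_eq_card hli, Fintype.card_fin] at h2
  have h3 := finrank_coordSub (insert j I)
  rw [card_insert_of_notMem hj] at h3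
  have := hD.card
  omega

theorem IsVolume.mem_span (hD : IsVolume I D) {v : Fin n → Fin 4 → ℝ}
    (hv : ∀ m, v m ∈ coordSub I) (hli : LinearIndependent ℝ v) {x : Fin 4 → ℝ}
    (hx : x ∈ coordSub I) : x ∈ Submodule.span ℝ (Set.range v) := by
  have h1 : Submodule.span ℝ (Set.range v) ≤ coordSub I := by
    rw [Submodule.span_le]
    rintro _ ⟨m, rfl⟩
    exact hv m
  rw [Submodule.eq_of_le_of_finrank_eq h1 ?_]
  · exact hx
  · rw [finrank_span_eq_card hli, Fintype.card_fin]
    have := hD.card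
    have := finrank_coordSub I
    omega

end

/-- The corners outside `I` span the coordinate subspace, whose dimension is `n + 1`, so they cannot
all lie in the span of `n` vectors. This provides a direction transversal to an interior facet. -/
theorem IsVolume.exists_corner {n : ℕ} {I : Finset (Fin 4)}
    {D : (Fin 4 → ℝ) [⋀^Fin (n + 1)]→ₗ[ℝ] ℝ} (hD : IsVolume I D) {v : Fin n → Fin 4 → ℝ}
    (hv : ∀ m, v m ∈ coordSub I) (hli : LinearIndependent ℝ v) :
    ∃ i ∉ I, D (Fin.cons (corner i) v) ≠ 0 := by
  obtain ⟨i, hi, hmem⟩ : ∃ i ∉ I, corner i ∉ Submodule.span ℝ (Set.range v) := by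
    by_contra! h
    have hle : coordSub I ≤ Submodule.span ℝ (Set.range v) := by
      rw [coordSub_eq_span, Submodule.span_le]
      rintro _ ⟨i, rfl⟩
      exact h i.1 i.2
    have h2 := Submodule.finrank_mono hle
    rw [finrank_span_eq_card hli, Fintype.card_fin] at h2
    have := hD.card
    have := finrank_coordSub I
    omega
  refine ⟨i, hi, hD.ne_zero _ ?_ (linearIndependent_finCons.2 ⟨hli, hmem⟩)⟩
  intro m
  refine Fin.cases ?_ (fun m => ?_) m
  · exact corner_mem_coordSub hi
  · exact hv m

/-! ### Stokes' theorem -/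

/-- The facet of `s` opposite to its vertex number `i`. -/
def Simplex.facet {k : ℕ} (s : Simplex T (k + 1)) (i : Fin (k + 2)) : Simplex T k :=
  s.sub i.succAbove (Fin.strictMono_succAbove i)

/-- All vertices of the simplex have vanishing coordinates in `I`. -/
def Simplex.InCoordSub {k : ℕ} (I : Finset (Fin 4)) (s : Simplex T k) : Prop :=
  ∀ i, s.1 i ∈ coordSub I

theorem Simplex.InCoordSub.facet {k : ℕ} {I : Finset (Fin 4)} {s : Simplex T (k + 1)}
    (hs : s.InCoordSub I) (i : Fin (k + 2)) : (s.facet i).InCoordSub I := fun _ => hs _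

/-- The coboundary of a cochain. -/
def coboundary {R : Type} [CommRing R] {k : ℕ} (M : Cochain T k R) : Cochain T (k + 1) R :=
  fun s => ∑ i : Fin (k + 2), (-1) ^ (i : ℕ) * M (s.facet i)

/-- The sign of a real number as an integer. -/
def intSign (x : ℝ) : ℤ := (SignType.sign x : ℤ)

theorem intSign_pos {x : ℝ} (h : 0 < x) : intSign x = 1 := by simp [intSign, sign_pos h]
theorem intSign_neg {x : ℝ} (h : x < 0) : intSign x = -1 := by simp [intSign, sign_neg h]

theorem intSign_neg_one_pow_mul (i : ℕ) (x : ℝ) :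
    intSign ((-1) ^ i * x) = (-1) ^ i * intSign x := by
  rcases neg_one_pow_eq_or ℝ i with h | h <;> rcases neg_one_pow_eq_or ℤ i with h' | h'
  · rw [h, h', one_mul, one_mul]
  · exfalso
    have : ((-1 : ℤ) : ℝ) ^ i = ((-1 : ℤ) : ℝ) := by exact_mod_cast congrArg (Int.cast (R := ℝ)) h'
    norm_num [h] at this
  · exfalso
    have : ((-1 : ℤ) : ℝ) ^ i = ((1 : ℤ) : ℝ) := by exact_mod_cast congrArg (Int.cast (R := ℝ)) h'
    norm_num [h] at this
  · rw [h, h', neg_one_mul, neg_one_mul]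
    simp [intSign, Left.sign_neg]

theorem sum_intSign {α : Type*} (Q : Finset α) (g : α → ℝ) :
    ∑ p ∈ Q, intSign (g p) = ((Q.filter fun p => 0 < g p).card : ℤ) -
      (Q.filter fun p => g p < 0).card := by
  rw [card_filter, card_filter]
  push_cast
  rw [← sum_sub_distrib]
  refine sum_congr rfl fun p _ => ?_
  rcases lt_trichotomy (g p) 0 with h | h | h
  · simp [intSign_neg h, h, h.not_gt]
  · simp [h, intSign]
  · simp [intSign_pos h, h, h.not_gt]

/-- The volume form with all but the first argument fixed. -/
def sideFunctional {n : ℕ} (D : (Fin 4 → ℝ) [⋀^Fin (n + 1)]→ₗ[ℝ] ℝ) (v : Fin n → Fin 4 → ℝ) :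
    (Fin 4 → ℝ) →ₗ[ℝ] ℝ where
  toFun w := D.curryLeft w v
  map_add' x y := by simp
  map_smul' c x := by simp

theorem sideFunctional_apply {n : ℕ} (D : (Fin 4 → ℝ) [⋀^Fin (n + 1)]→ₗ[ℝ] ℝ)
    (v : Fin n → Fin 4 → ℝ) (w : Fin 4 → ℝ) :
    sideFunctional D v w = D (Fin.cons w v : Fin (n + 1) → Fin 4 → ℝ) := rfl

theorem sideFunctional_self {n : ℕ} (D : (Fin 4 → ℝ) [⋀^Fin (n + 1)]→ₗ[ℝ] ℝ)
    (v : Fin n → Fin 4 → ℝ) (i : Fin n) : sideFunctional D v (v i) = 0 := by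
  rw [sideFunctional_apply]
  exact D.map_eq_zero_of_eq _ (i := 0) (j := i.succ) (by simp) (Fin.succ_ne_zero i).symm

/-- Moving vertex `i` to the front is a cycle of sign `(-1)^i`. So the incidence sign in the
coboundary times the orientation of `s` only records on which side of the facet the opposite vertex
lies. -/
theorem sideFunctional_facet {k : ℕ} (D : (Fin 4 → ℝ) [⋀^Fin (k + 2)]→ₗ[ℝ] ℝ)
    (s : Simplex T (k + 1)) (i : Fin (k + 2)) :
    sideFunctional D (s.facet i).1 (s.1 i) = (-1) ^ (i : ℕ) * D s.1 := by
  have h := Fin.cons_removeNth_eq_comp_cycleRange_symm s.1 i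
  rw [sideFunctional_apply]
  have h2 : (Fin.cons (s.1 i) (s.facet i).1 : Fin (k + 2) → Fin 4 → ℝ) =
      s.1 ∘ i.cycleRange.symm := h
  rw [h2, AlternatingMap.map_perm, Equiv.Perm.sign_symm, Fin.sign_cycleRange]
  rcases neg_one_pow_eq_or ℤˣ (i : ℕ) with h | h <;>
    rcases neg_one_pow_eq_or ℝ (i : ℕ) with h' | h'
  · simp [h, h']
  · exfalso
    have := congrArg (fun u : ℤˣ => ((u : ℤ) : ℝ)) h
    norm_num [h'] at this
  · exfalso
    have := congrArg (fun u : ℤˣ => ((u : ℤ) : ℝ)) h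
    norm_num [h'] at this
  · simp [h, h']

theorem Simplex.image_facet {k : ℕ} (s : Simplex T (k + 1)) (i : Fin (k + 2)) :
    insert (s.1 i) (univ.image (s.facet i).1) = univ.image s.1 := by
  ext x
  simp only [Finset.mem_insert, Finset.mem_image, mem_univ, true_and]
  constructor
  · rintro (rfl | ⟨j, rfl⟩)
    · exact ⟨i, rfl⟩
    · exact ⟨i.succAbove j, rfl⟩
  · rintro ⟨j, rfl⟩
    by_cases h : j = i
    · exact Or.inl (by rw [h])
    · obtain ⟨m, hm⟩ := Fin.exists_succAbove_eq h
      exact Or.inr ⟨m, by rw [← hm]; rfl⟩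

theorem Simplex.facet_vertex_inj {k : ℕ} {s s' : Simplex T (k + 1)} {i i' : Fin (k + 2)}
    (h : s.facet i = s'.facet i') (hv : s.1 i = s'.1 i') : s = s' ∧ i = i' := by
  have hs : s = s' := by
    apply Simplex.ext_image
    rw [← s.image_facet i, ← s'.image_facet i', h, hv]
  subst hs
  exact ⟨rfl, s.injective hv⟩

theorem Simplex.exists_facet {k : ℕ} (f : Simplex T k) {w : Fin 4 → ℝ}
    (hw : w ∉ univ.image f.1) (h : insert w (univ.image f.1) ∈ T.K.faces) :
    ∃ (s : Simplex T (k + 1)) (i : Fin (k + 2)), s.facet i = f ∧ s.1 i = w := by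
  have hc : (insert w (univ.image f.1)).card = (k + 1) + 1 := by
    rw [card_insert_of_notMem hw, card_image_of_injective _ f.injective]
    simp
  obtain ⟨s, hs⟩ := exists_simplex h hc
  have hws : w ∈ univ.image s.1 := by rw [hs]; exact mem_insert_self _ _
  obtain ⟨i, -, hi⟩ := Finset.mem_image.1 hws
  refine ⟨s, i, Simplex.ext_image ?_, hi⟩
  have h1 := s.image_facet i
  rw [hs, hi] at h1
  have h2 : w ∉ univ.image (s.facet i).1 := by
    intro hm
    obtain ⟨j, -, hj⟩ := Finset.mem_image.1 hm
    rw [← hi] at hj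
    exact Fin.succAbove_ne i j (s.injective hj)
  rw [← erase_insert h2, h1, erase_insert hw]

open Classical in
/-- The `(k+1)`-simplices of the subspace together with one of their vertices such that the
opposite facet is `f`. -/
def cofaces {k : ℕ} (I : Finset (Fin 4)) (f : Simplex T k) :
    Finset (Simplex T (k + 1) × Fin (k + 2)) :=
  univ.filter fun p => p.1.InCoordSub I ∧ p.1.facet p.2 = f

theorem mem_cofaces {k : ℕ} {I : Finset (Fin 4)} {f : Simplex T k}
    {p : Simplex T (k + 1) × Fin (k + 2)} :
    p ∈ cofaces I f ↔ p.1.InCoordSub I ∧ p.1.facet p.2 = f := by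
  simp [cofaces]

/-- Existence is `exists_coface`, uniqueness is `coface_unique`. The scalar `ε` in `hu` and in the
conclusion serves to select the side; the bound `ε` of `hP` is a step length. -/
theorem card_cofaces_side {k : ℕ} {I : Finset (Fin 4)} {D : (Fin 4 → ℝ) [⋀^Fin (k + 2)]→ₗ[ℝ] ℝ}
    (hD : IsVolume I D) {f : Simplex T k} (hf : f.InCoordSub I) {ε : ℝ}
    {u : Fin 4 → ℝ} (hu : 0 < ε * sideFunctional D f.1 u) {δ : ℝ} (hδ : 0 < δ)
    (hP : ∀ ε, 0 < ε → ε < δ → f.centroid + ε • u ∈ stdSimplex ℝ (Fin 4) ∧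
      ∀ i ∈ I, (f.centroid + ε • u) i = 0) :
    ((cofaces I f).filter fun p => 0 < ε * sideFunctional D f.1 (p.1.1 p.2)).card = 1 := by
  classical
  have hz : ∀ i, (ε • sideFunctional D f.1) (f.1 i) = 0 := fun i => by
    simp [sideFunctional_self]
  obtain ⟨w, hw, hwf, hwI⟩ := f.exists_coface hz (I := I) (u := u) (by simpa using hu) hδ hP
  have hw' : w ∉ univ.image f.1 := by
    intro hm
    obtain ⟨j, -, rfl⟩ := Finset.mem_image.1 hm
    rw [hz j] at hw
    exact lt_irrefl _ hw
  obtain ⟨s, i, hsi, hsw⟩ := f.exists_facet hw' hwf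
  rw [card_eq_one]
  refine ⟨(s, i), ?_⟩
  have hsI : s.InCoordSub I := by
    intro m
    have : s.1 m ∈ insert (s.1 i) (univ.image (s.facet i).1) := by
      rw [s.image_facet]; exact s.mem_image m
    rw [hsi, hsw, Finset.mem_insert] at this
    rcases this with h | h
    · rw [h]; exact hwI
    · obtain ⟨j, -, hj⟩ := Finset.mem_image.1 h
      rw [← hj]; exact hf j
  ext ⟨s', i'⟩
  simp only [mem_filter, mem_cofaces, Finset.mem_singleton]
  constructor
  · rintro ⟨⟨hI', hf'⟩, hpos⟩
    have hspan : s'.1 i' ∈ Submodule.span ℝ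
        (Set.range (Fin.cons w f.1 : Fin (k + 2) → Fin 4 → ℝ)) := by
      refine hD.mem_span ?_ ?_ (hI' i')
      · intro m
        refine Fin.cases ?_ (fun m => ?_) m
        · exact hwI
        · exact hf m
      · by_contra hli
        have := D.map_linearDependent _ hli
        rw [← sideFunctional_apply] at this
        simp [this] at hw
    rw [Submodule.mem_span_range_iff_exists_fun] at hspan
    obtain ⟨c, hc⟩ := hspan
    rw [Fin.sum_univ_succ] at hc
    simp only [Fin.cons_zero, Fin.cons_succ] at hc
    have himg := s'.image_facet i'
    rw [hf'] at himg
    have heq := f.coface_unique hz (w := s'.1 i') (w' := w) (by simpa using hpos) hw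
      (by rw [himg]; exact s'.2.1) hwf hc.symm
    have := Simplex.facet_vertex_inj (hf'.trans hsi.symm) (heq.trans hsw.symm)
    rw [this.1, this.2]
  · rintro h
    rw [Prod.mk.injEq] at h
    rw [h.1, h.2]
    refine ⟨⟨hsI, hsi⟩, ?_⟩
    rw [hsw]
    simpa using hw

theorem corner_mem_stdSimplex (i : Fin 4) : corner i ∈ stdSimplex ℝ (Fin 4) :=
  single_mem_stdSimplex ℝ i

theorem Simplex.InCoordSub.centroid {k : ℕ} {I : Finset (Fin 4)} {f : Simplex T k}
    (hf : f.InCoordSub I) : f.centroid ∈ coordSub I :=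
  Submodule.sum_mem _ fun i _ => Submodule.smul_mem _ _ (hf i)

theorem Simplex.towards_corner {k : ℕ} {I : Finset (Fin 4)} {f : Simplex T k}
    (hf : f.InCoordSub I) {j : Fin 4} (hj : j ∉ I) (ε : ℝ) (h0 : 0 < ε) (h1 : ε < 1) :
    f.centroid + ε • (corner j - f.centroid) ∈ stdSimplex ℝ (Fin 4) ∧
      ∀ i ∈ I, (f.centroid + ε • (corner j - f.centroid)) i = 0 := by
  refine ⟨?_, fun i hi => ?_⟩
  · have := convex_stdSimplex ℝ (Fin 4) f.centroid_mem_stdSimplex (corner_mem_stdSimplex j)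
      (a := 1 - ε) (b := ε) (by linarith) h0.le (by ring)
    convert this using 1
    module
  · have h1 := hf.centroid i hi
    have h2 := corner_mem_coordSub hj i hi
    simp [h1, h2]

/-- The only coordinate that can decrease is number `j`, by less than the step length, whence the
bound `f.centroid j`. Together with `towards_corner` this reaches both sides of an interior facet.
-/
theorem Simplex.away_from_corner {k : ℕ} {I : Finset (Fin 4)} {f : Simplex T k}
    (hf : f.InCoordSub I) {j : Fin 4} (hj : j ∉ I) (ε : ℝ) (h0 : 0 < ε)
    (h1 : ε < f.centroid j) :
    f.centroid + ε • (f.centroid - corner j) ∈ stdSimplex ℝ (Fin 4) ∧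
      ∀ i ∈ I, (f.centroid + ε • (f.centroid - corner j)) i = 0 := by
  obtain ⟨hn, hs⟩ := f.centroid_mem_stdSimplex
  refine ⟨⟨fun i => ?_, ?_⟩, fun i hi => ?_⟩
  · simp only [Pi.add_apply, Pi.smul_apply, Pi.sub_apply, smul_eq_mul, corner_apply]
    have := hn i
    split_ifs with h
    · subst h
      nlinarith
    · nlinarith
  · have hc : ∑ i, corner j i = 1 := (corner_mem_stdSimplex j).2
    simp only [Pi.add_apply, Pi.smul_apply, Pi.sub_apply, smul_eq_mul, sum_add_distrib,
      ← mul_sum, sum_sub_distrib, hs, hc]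
    ring
  · have h1 := hf.centroid i hi
    have h2 := corner_mem_coordSub hj i hi
    simp [h1, h2]

theorem Simplex.centroid_pos {k : ℕ} {f : Simplex T k} {j : Fin 4} (hj : ¬ f.OnFace j) :
    0 < f.centroid j := by
  simp only [Simplex.OnFace, not_forall] at hj
  obtain ⟨i, hi⟩ := hj
  simp only [Simplex.centroid, Finset.sum_apply, Pi.smul_apply, smul_eq_mul]
  refine sum_pos' (fun m _ => ?_) ⟨i, mem_univ i, ?_⟩
  · have := f.coord_nonneg m j
    positivity
  · have := lt_of_le_of_ne (f.coord_nonneg i j) (Ne.symm hi)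
    positivity

/-- Some corner is transversal to `f`. Moving towards it and away from it finds exactly one coface
on each side, and the two signs cancel. -/
theorem sum_cofaces_interior {k : ℕ} {I : Finset (Fin 4)}
    {D : (Fin 4 → ℝ) [⋀^Fin (k + 2)]→ₗ[ℝ] ℝ} (hD : IsVolume I D) {f : Simplex T k}
    (hf : f.InCoordSub I) (hint : ∀ i ∉ I, ¬ f.OnFace i) :
    ∑ p ∈ cofaces I f, intSign (sideFunctional D f.1 (p.1.1 p.2)) = 0 := by
  obtain ⟨i, hi, hne⟩ := hD.exists_corner hf f.linearIndependent
  rw [← sideFunctional_apply] at hne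
  have hz := f.map_centroid (sideFunctional_self D f.1)
  have hcard : ∀ ε : ℝ, ε ≠ 0 →
      ((cofaces I f).filter fun p => 0 < ε * sideFunctional D f.1 (p.1.1 p.2)).card = 1 := by
    intro ε hε
    rcases lt_or_gt_of_ne (mul_ne_zero hε hne) with h | h
    · exact card_cofaces_side hD hf (u := f.centroid - corner i) (by rw [map_sub, hz]; linarith)
        (Simplex.centroid_pos (hint i hi)) (Simplex.away_from_corner hf hi)
    · exact card_cofaces_side hD hf (u := corner i - f.centroid) (by rw [map_sub, hz]; linarith)
        one_pos (Simplex.towards_corner hf hi)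
  rw [sum_intSign]
  have h1 := hcard 1 one_ne_zero
  have h2 := hcard (-1) (by norm_num)
  simp only [one_mul] at h1
  simp only [neg_mul, one_mul, Left.neg_pos_iff] at h2
  rw [h1, h2]
  rfl

/-- The corners outside `insert j I`, together with `f`, lie in a subspace too small for `D`, so
only coordinate `j` of `w` contributes. As barycentric coordinates are nonnegative, all cofaces lie
on the inner side. -/
theorem sideFunctional_boundary {k : ℕ} {I : Finset (Fin 4)}
    {D : (Fin 4 → ℝ) [⋀^Fin (k + 2)]→ₗ[ℝ] ℝ} (hD : IsVolume I D) {f : Simplex T k} {j : Fin 4}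
    (hj : j ∉ I) (hf : f.InCoordSub (insert j I)) {w : Fin 4 → ℝ} (hw : w ∈ coordSub I) :
    sideFunctional D f.1 w = w j * sideFunctional D f.1 (corner j) := by
  conv_lhs => rw [eq_sum_corner w, map_sum]
  rw [sum_eq_single j]
  · simp
  · intro i _ hij
    rw [map_smul, smul_eq_mul]
    by_cases hi : i ∈ I
    · rw [hw i hi, zero_mul]
    · rw [sideFunctional_apply, hD.eq_zero hj, mul_zero]
      intro m
      refine Fin.cases ?_ (fun m => ?_) m
      · exact corner_mem_coordSub (by simp [hij, hi])
      · exact hf m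
  · simp

theorem Simplex.InCoordSub.of_insert {k : ℕ} {I : Finset (Fin 4)} {f : Simplex T k} {j : Fin 4}
    (hf : f.InCoordSub (insert j I)) : f.InCoordSub I :=
  fun m i hi => hf m i (mem_insert_of_mem hi)

theorem sum_cofaces_boundary {k : ℕ} {I : Finset (Fin 4)}
    {D : (Fin 4 → ℝ) [⋀^Fin (k + 2)]→ₗ[ℝ] ℝ} (hD : IsVolume I D) {f : Simplex T k} {j : Fin 4}
    (hj : j ∉ I) (hf : f.InCoordSub (insert j I)) :
    ∑ p ∈ cofaces I f, intSign (sideFunctional D f.1 (p.1.1 p.2)) =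
      intSign (D.curryLeft (corner j) f.1) := by
  have hz := f.map_centroid (sideFunctional_self D f.1)
  have hne : sideFunctional D f.1 (corner j) ≠ 0 :=
    (hD.curryLeft hj).ne_zero _ hf f.linearIndependent
  have hcard : ∀ ε : ℝ, 0 < ε * sideFunctional D f.1 (corner j) →
      ((cofaces I f).filter fun p => 0 < ε * sideFunctional D f.1 (p.1.1 p.2)).card = 1 := by
    intro ε hε
    exact card_cofaces_side hD hf.of_insert (u := corner j - f.centroid) (by rw [map_sub, hz]; linarith) one_pos
      (Simplex.towards_corner hf.of_insert hj)
  have hzero : ∀ ε : ℝ, ε * sideFunctional D f.1 (corner j) < 0 →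
      ((cofaces I f).filter fun p => 0 < ε * sideFunctional D f.1 (p.1.1 p.2)).card = 0 := by
    intro ε hε
    rw [card_eq_zero, filter_eq_empty_iff]
    intro p hp
    have hpI := (mem_cofaces.1 hp).1 p.2
    rw [sideFunctional_boundary hD hj hf hpI]
    have := p.1.coord_nonneg p.2 j
    nlinarith
  rw [sum_intSign]
  change _ = intSign (sideFunctional D f.1 (corner j))
  rcases lt_or_gt_of_ne hne with h | h
  · have h1 := hzero 1 (by linarith)
    have h2 := hcard (-1) (by linarith)
    simp only [one_mul] at h1
    simp only [neg_mul, one_mul, Left.neg_pos_iff] at h2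
    rw [h1, h2, intSign_neg h]
    rfl
  · have h1 := hcard 1 (by linarith)
    have h2 := hzero (-1) (by linarith)
    simp only [one_mul] at h1
    simp only [neg_mul, one_mul, Left.neg_pos_iff] at h2
    rw [h1, h2, intSign_pos h]
    rfl

open Classical in
/-- Stokes' theorem on a face of the tetrahedron, for a cochain that vanishes on all but one of the
facets of that face. -/
theorem stokes {R : Type} [CommRing R] {k : ℕ} {I : Finset (Fin 4)}
    {D : (Fin 4 → ℝ) [⋀^Fin (k + 2)]→ₗ[ℝ] ℝ} (hD : IsVolume I D) {j : Fin 4} (hj : j ∉ I)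
    (M : Cochain T k R)
    (hM : ∀ f : Simplex T k, f.InCoordSub I → ∀ i ∉ I, i ≠ j → f.OnFace i → M f = 0) :
    ∑ s : Simplex T (k + 1) with s.InCoordSub I, (intSign (D s.1) : R) * coboundary M s =
      ∑ f : Simplex T k with f.InCoordSub (insert j I),
        (intSign (D.curryLeft (corner j) f.1) : R) * M f := by
  -- The left side becomes a sum over pairs of a simplex and one of its vertices, weighted by the
  -- side of the opposite facet on which the vertex lies. Grouping the pairs by that facet reduces
  -- the theorem to the coface counts.
  have h1 : ∑ s : Simplex T (k + 1) with s.InCoordSub I, (intSign (D s.1) : R) * coboundary M s =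
      ∑ p : Simplex T (k + 1) × Fin (k + 2) with p.1.InCoordSub I,
        (intSign (sideFunctional D (p.1.facet p.2).1 (p.1.1 p.2)) : R) * M (p.1.facet p.2) := by
    rw [sum_filter, sum_filter, Fintype.sum_prod_type]
    refine sum_congr rfl fun s _ => ?_
    split_ifs
    · rw [coboundary, mul_sum]
      refine sum_congr rfl fun i _ => ?_
      rw [sideFunctional_facet, intSign_neg_one_pow_mul]
      push_cast
      ring
    · simp
  rw [h1, ← sum_fiberwise _ (fun p => p.1.facet p.2), sum_filter]
  refine sum_congr rfl fun f _ => ?_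
  have h2 : ∑ p ∈ univ.filter (fun p : Simplex T (k + 1) × Fin (k + 2) => p.1.InCoordSub I) with
        p.1.facet p.2 = f,
        (intSign (sideFunctional D (p.1.facet p.2).1 (p.1.1 p.2)) : R) * M (p.1.facet p.2) =
      ((∑ p ∈ cofaces I f, intSign (sideFunctional D f.1 (p.1.1 p.2)) : ℤ) : R) * M f := by
    rw [filter_filter, cofaces]
    push_cast
    rw [sum_mul]
    refine sum_congr rfl fun p hp => ?_
    rw [(mem_filter.1 hp).2.2]
  rw [h2]
  by_cases hf : f.InCoordSub I
  · split_ifs with hfj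
    · rw [sum_cofaces_boundary hD hj hfj]
    -- A facet in a face other than `j` is killed by `hM`; one in no face is interior and its
    -- cofaces cancel.
    · by_cases hb : ∃ i ∉ I, f.OnFace i
      · obtain ⟨i, hi, hfi⟩ := hb
        rw [hM f hf i hi _ hfi, mul_zero]
        rintro rfl
        apply hfj
        intro m i' hi'
        rcases Finset.mem_insert.1 hi' with rfl | h
        · exact hfi m
        · exact hf m i' h
      · push Not at hb
        rw [sum_cofaces_interior hD hf hb]
        simp
  · have h3 : cofaces I f = ∅ := by
      refine eq_empty_of_forall_notMem fun p hpm => ?_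
      obtain ⟨hp, hpf⟩ := mem_cofaces.1 hpm
      rw [← hpf] at hf
      exact hf (hp.facet _)
    rw [h3, if_neg fun h => hf h.of_insert]
    simp

/-! ### Connectedness of the faces of the tetrahedron -/

theorem exists_common_mem {s t : Finset (Fin 4 → ℝ)} (hs : s ∈ T.K.faces) (ht : t ∈ T.K.faces)
    {x : Fin 4 → ℝ} (hxs : x ∈ convexHull ℝ (s : Set (Fin 4 → ℝ)))
    (hxt : x ∈ convexHull ℝ (t : Set (Fin 4 → ℝ))) : ∃ u ∈ s, u ∈ t := by
  have h := T.K.inter_subset_convexHull hs ht ⟨hxs, hxt⟩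
  obtain ⟨u, hu⟩ := convexHull_nonempty_iff.1 ⟨x, h⟩
  exact ⟨u, hu.1, hu.2⟩

theorem mem_stdSimplex_of_mem_convexHull {t : Finset (Fin 4 → ℝ)} (ht : t ∈ T.K.faces)
    {x : Fin 4 → ℝ} (hx : x ∈ convexHull ℝ (t : Set (Fin 4 → ℝ))) :
    x ∈ stdSimplex ℝ (Fin 4) := by
  rw [← T.space_eq]
  exact T.K.convexHull_subset_space ht hx

/-- A function on a connected set that is constant on each face is constant. -/
theorem eq_of_constant_on_faces {α : Type*} {C : Set (Fin 4 → ℝ)} (hC : IsPreconnected C)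
    (hCs : C ⊆ stdSimplex ℝ (Fin 4)) (h : (Fin 4 → ℝ) → α)
    (hc : ∀ t ∈ T.K.faces, ∀ x ∈ C, ∀ y ∈ C, x ∈ convexHull ℝ (t : Set (Fin 4 → ℝ)) →
      y ∈ convexHull ℝ (t : Set (Fin 4 → ℝ)) → h x = h y)
    {x y : Fin 4 → ℝ} (hx : x ∈ C) (hy : y ∈ C) : h x = h y := by
  by_contra hne
  have hclosed : ∀ P : Finset (Fin 4 → ℝ) → Prop,
      IsClosed (⋃ t ∈ {t | t ∈ T.K.faces ∧ P t}, convexHull ℝ (t : Set (Fin 4 → ℝ))) := fun P =>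
    (T.finite_faces.subset fun t ht => ht.1).isClosed_biUnion fun t _ =>
      t.finite_toSet.isClosed_convexHull ℝ
  have hcover : ∀ z ∈ C, ∃ t ∈ T.K.faces, z ∈ convexHull ℝ (t : Set (Fin 4 → ℝ)) := fun z hz => by
    have := hCs hz
    rwa [← T.space_eq, T.K.mem_space_iff] at this
  have hmem : ∀ (Q : (Fin 4 → ℝ) → Prop), ∀ z ∈ C, Q z → z ∈ ⋃ t ∈ {t | t ∈ T.K.faces ∧
      ∃ z ∈ C, z ∈ convexHull ℝ (t : Set (Fin 4 → ℝ)) ∧ Q z},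
      convexHull ℝ (t : Set (Fin 4 → ℝ)) := fun Q z hz hq => by
    obtain ⟨t, ht, hzt⟩ := hcover z hz
    exact Set.mem_biUnion (show t ∈ {t | _} from ⟨ht, z, hz, hzt, hq⟩) hzt
  -- The faces on which `h` takes the value `h x` and those on which it takes another value form two
  -- closed sets covering `C`. By connectedness they meet in `C`, contradicting constancy on faces.
  obtain ⟨p, hp, hpA, hpB⟩ := isPreconnected_closed_iff.1 hC _ _
    (hclosed fun t => ∃ z ∈ C, z ∈ convexHull ℝ (t : Set (Fin 4 → ℝ)) ∧ h z = h x)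
    (hclosed fun t => ∃ z ∈ C, z ∈ convexHull ℝ (t : Set (Fin 4 → ℝ)) ∧ h z ≠ h x)
    (fun z hz => (em (h z = h x)).imp (hmem (fun z => h z = h x) z hz)
      (hmem (fun z => h z ≠ h x) z hz))
    ⟨x, hx, hmem (fun z => h z = h x) x hx rfl⟩
    ⟨y, hy, hmem (fun z => h z ≠ h x) y hy (Ne.symm hne)⟩
  obtain ⟨t, ⟨ht, z, hz, hzt, hzx⟩, hpt⟩ := Set.mem_iUnion₂.1 hpA
  obtain ⟨t', ⟨ht', z', hz', hzt', hzx'⟩, hpt'⟩ := Set.mem_iUnion₂.1 hpB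
  exact hzx' ((hc t' ht' z' hz' p hp hzt' hpt').trans ((hc t ht p hp z hz hpt hzt).trans hzx))

theorem exists_edge {u v : Fin 4 → ℝ} (h : {u, v} ∈ T.K.faces) (hne : u ≠ v) :
    ∃ e : Simplex T 1, (e.1 0 = u ∧ e.1 1 = v) ∨ (e.1 0 = v ∧ e.1 1 = u) := by
  obtain ⟨e, he⟩ := exists_simplex h (k := 1) (card_pair hne)
  refine ⟨e, ?_⟩
  have h0 : e.1 0 ∈ ({u, v} : Finset _) := by rw [← he]; exact e.mem_image 0
  have h1 : e.1 1 ∈ ({u, v} : Finset _) := by rw [← he]; exact e.mem_image 1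
  have h01 : e.1 0 ≠ e.1 1 := fun h => absurd (e.injective h) (by decide)
  simp only [Finset.mem_insert, Finset.mem_singleton] at h0 h1
  grind

theorem convex_face (I : Finset (Fin 4)) :
    Convex ℝ (stdSimplex ℝ (Fin 4) ∩ (coordSub I : Set (Fin 4 → ℝ))) :=
  (convex_stdSimplex ℝ (Fin 4)).inter (coordSub I).convex

/-- The 1-skeleton of each face of the tetrahedron is connected. -/
theorem eq_of_eq_on_edges {α : Type*} {I : Finset (Fin 4)} (l : (Fin 4 → ℝ) → α)
    (hl : ∀ e : Simplex T 1, e.InCoordSub I → l (e.1 0) = l (e.1 1)) {v v' : Simplex T 0}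
    (hv : v.InCoordSub I) (hv' : v'.InCoordSub I) : l (v.1 0) = l (v'.1 0) := by
  have hface : ∀ t ∈ T.K.faces, ∀ u ∈ t, ∀ w ∈ t, u ∈ coordSub I → w ∈ coordSub I →
      l u = l w := by
    intro t ht u hu w hw huI hwI
    by_cases hne : u = w
    · rw [hne]
    obtain ⟨e, he⟩ := exists_edge (pair_mem_faces ht hu hw) hne
    have heI : e.InCoordSub I := by
      intro m
      fin_cases m <;> rcases he with ⟨h0, h1⟩ | ⟨h0, h1⟩ <;> simp [h0, h1, huI, hwI]
    rcases he with ⟨h0, h1⟩ | ⟨h0, h1⟩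
    · rw [← h0, ← h1, hl e heI]
    · rw [← h0, ← h1, hl e heI]
  -- To each point is attached a vertex `u` whose label agrees with every admissible vertex of every
  -- face containing the point. The label of this vertex is then constant on faces, so connectedness
  -- applies to it. Points outside get the dummy vertex 0.
  have hV : ∀ x : Fin 4 → ℝ, ∃ u : Fin 4 → ℝ, x ∈ stdSimplex ℝ (Fin 4) ∩ coordSub I →
      ∀ t ∈ T.K.faces, x ∈ convexHull ℝ (t : Set (Fin 4 → ℝ)) → ∀ w ∈ t, w ∈ coordSub I →
        l u = l w := by
    intro x
    by_cases hx : x ∈ stdSimplex ℝ (Fin 4) ∩ coordSub I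
    · obtain ⟨s, hs, hxs, hsI⟩ := exists_face (T := T) hx.1
      have hsI' : ∀ w ∈ s, w ∈ coordSub I := fun w hw i hi => hsI w hw i (hx.2 i hi)
      obtain ⟨u, hu⟩ := T.K.nonempty_of_mem_faces hs
      refine ⟨u, fun _ t ht hxt w hw hwI => ?_⟩
      obtain ⟨z, hzs, hzt⟩ := exists_common_mem hs ht hxs hxt
      rw [hface s hs u hu z hzs (hsI' u hu) (hsI' z hzs), hface t ht z hzt w hw (hsI' z hzs) hwI]
    · exact ⟨0, fun h => (hx h).elim⟩
  choose V hV using hV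
  have hsing : ∀ v : Simplex T 0, v.InCoordSub I → v.1 0 ∈ stdSimplex ℝ (Fin 4) ∩ coordSub I ∧
      l (V (v.1 0)) = l (v.1 0) := by
    intro v hv
    have h1 : v.1 0 ∈ stdSimplex ℝ (Fin 4) ∩ coordSub I := ⟨v.mem_stdSimplex 0, hv 0⟩
    exact ⟨h1, hV _ h1 _ v.2.1 (subset_convexHull ℝ _ (mem_coe.2 (v.mem_image 0))) _
      (v.mem_image 0) (hv 0)⟩
  rw [← (hsing v hv).2, ← (hsing v' hv').2]
  refine eq_of_constant_on_faces (T := T) (convex_face I).isPreconnected Set.inter_subset_left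
    (fun x => l (V x)) ?_ (hsing v hv).1 (hsing v' hv').1
  intro t ht x hx y hy hxt hyt
  obtain ⟨s, hs, hxs, hsI⟩ := exists_face (T := T) hx.1
  obtain ⟨z, hzs, hzt⟩ := exists_common_mem hs ht hxs hxt
  have hzI : z ∈ coordSub I := fun i hi => hsI z hzs i (hx.2 i hi)
  rw [hV x hx t ht hxt z hzt hzI, hV y hy t ht hyt z hzt hzI]

/-! ### Flat gauge fields are pure gauge -/

/-- The value of a 1-cochain on the pair `u, v`. -/
def pairValue (a : Cochain T 1 (ZMod 2)) (u v : Fin 4 → ℝ) : ZMod 2 :=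
  -- The value 0 at `u = v` makes the cocycle identity of `pairValue_add` valid for degenerate
  -- triples.
  open Classical in if h : ∃ e : Simplex T 1, univ.image e.1 = {u, v} then a h.choose else 0

theorem pairValue_comm (a : Cochain T 1 (ZMod 2)) (u v : Fin 4 → ℝ) :
    pairValue a u v = pairValue a v u := by
  simp only [pairValue, pair_comm]

theorem pairValue_edge (a : Cochain T 1 (ZMod 2)) (e : Simplex T 1) :
    pairValue a (e.1 0) (e.1 1) = a e := by
  have h0 : univ.image e.1 = {e.1 0, e.1 1} := by
    ext x
    simp [eq_comm]
  have h : ∃ e' : Simplex T 1, univ.image e'.1 = {e.1 0, e.1 1} := ⟨e, h0⟩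
  rw [pairValue, dif_pos h]
  congr 1
  exact Simplex.ext_image (h.choose_spec.trans h0.symm)

theorem pairValue_self (a : Cochain T 1 (ZMod 2)) (u : Fin 4 → ℝ) : pairValue a u u = 0 := by
  rw [pairValue, dif_neg]
  rintro ⟨e, he⟩
  have := congrArg card he
  rw [card_image_of_injective _ e.injective] at this
  simp at this

theorem add_eq_of_triangle (g : Fin 3 → Fin 3 → ZMod 2) (hg : ∀ i j, g i j = g j i)
    (h : g 1 2 + g 0 2 + g 0 1 = 0) (i j k : Fin 3) (hij : i ≠ j) (hik : i ≠ k) (hjk : j ≠ k) :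
    g i j + g i k = g j k := by
  have c1 := hg 1 0
  have c2 := hg 2 0
  have c3 := hg 2 1
  fin_cases i <;> fin_cases j <;> simp at hij <;> fin_cases k <;> simp at hik hjk <;> grind

theorem pairValue_add (a : Cochain T 1 (ZMod 2))
    (ha : ∀ f : Simplex T 2, ∑ i, a (f.facet i) = 0) {t : Finset (Fin 4 → ℝ)}
    (ht : t ∈ T.K.faces) {u v w : Fin 4 → ℝ} (hu : u ∈ t) (hv : v ∈ t) (hw : w ∈ t) :
    pairValue a u v + pairValue a u w = pairValue a v w := by
  by_cases huv : u = v
  · rw [huv, pairValue_self, zero_add]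
  by_cases huw : u = w
  · rw [huw, pairValue_self, add_zero, pairValue_comm]
  by_cases hvw : v = w
  · rw [hvw, pairValue_self, CharTwo.add_self_eq_zero]
  obtain ⟨f, hf⟩ := exists_simplex (triple_mem_faces ht hu hv hw) (k := 2)
    (card_eq_three.2 ⟨u, v, w, huv, huw, hvw, rfl⟩)
  have h1 := ha f
  rw [Fin.sum_univ_three, ← pairValue_edge a (f.facet 0), ← pairValue_edge a (f.facet 1),
    ← pairValue_edge a (f.facet 2)] at h1
  change pairValue a (f.1 1) (f.1 2) + pairValue a (f.1 0) (f.1 2) +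
    pairValue a (f.1 0) (f.1 1) = 0 at h1
  have hmem : ∀ x ∈ ({u, v, w} : Finset _), ∃ i, f.1 i = x := by
    intro x hx
    rw [← hf] at hx
    obtain ⟨i, -, hi⟩ := Finset.mem_image.1 hx
    exact ⟨i, hi⟩
  obtain ⟨i, rfl⟩ := hmem u (by simp)
  obtain ⟨j, rfl⟩ := hmem v (by simp)
  obtain ⟨k, rfl⟩ := hmem w (by simp)
  exact add_eq_of_triangle (fun i j => pairValue a (f.1 i) (f.1 j))
    (fun i j => pairValue_comm a _ _) h1 i j k (fun h => huv (by rw [h]))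
    (fun h => huw (by rw [h])) (fun h => hvw (by rw [h]))

variable (T) in
/-- A continuous choice, over the points of `C`, of potentials of `α` near the point. -/
structure IsSection (α : (Fin 4 → ℝ) → (Fin 4 → ℝ) → ZMod 2) (C : Set (Fin 4 → ℝ))
    (F : (Fin 4 → ℝ) → (Fin 4 → ℝ) → ZMod 2) : Prop where
  potential : ∀ x ∈ C, ∀ t ∈ T.K.faces, x ∈ convexHull ℝ (t : Set (Fin 4 → ℝ)) →
    ∀ v ∈ t, ∀ w ∈ t, F x v + F x w = α v w
  constant : ∀ t ∈ T.K.faces, ∀ x ∈ C, ∀ y ∈ C, x ∈ convexHull ℝ (t : Set (Fin 4 → ℝ)) →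
    y ∈ convexHull ℝ (t : Set (Fin 4 → ℝ)) → ∀ v ∈ t, F x v = F y v

/-- In a small enough ball, every face that occurs contains `x`, hence contains the common vertex
`u` of the faces through `x`. The potential based at `u` works for all of them at once. -/
theorem exists_local_section {α : (Fin 4 → ℝ) → (Fin 4 → ℝ) → ZMod 2}
    (hα : ∀ t ∈ T.K.faces, ∀ u ∈ t, ∀ v ∈ t, ∀ w ∈ t, α u v + α u w = α v w) (x : Fin 4 → ℝ) :
    ∃ ε > 0, ∀ C ⊆ Metric.ball x ε, ∃ F, IsSection T α C F := by
  have hev : ∀ᶠ y in nhds x, ∀ t ∈ T.K.faces, x ∉ convexHull ℝ (t : Set (Fin 4 → ℝ)) →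
      y ∉ convexHull ℝ (t : Set (Fin 4 → ℝ)) := by
    rw [Filter.eventually_all_finite T.finite_faces]
    intro t _
    by_cases hc : x ∈ convexHull ℝ (t : Set (Fin 4 → ℝ))
    · exact Filter.Eventually.of_forall fun ε h => (h hc).elim
    · have hcl : IsClosed (convexHull ℝ (t : Set (Fin 4 → ℝ))) :=
        t.finite_toSet.isClosed_convexHull ℝ
      filter_upwards [hcl.isOpen_compl.mem_nhds hc] with y hy _ using hy
  obtain ⟨ε, hε, hb⟩ := Metric.eventually_nhds_iff_ball.1 hev
  have hu : ∃ u : Fin 4 → ℝ, ∀ t ∈ T.K.faces, x ∈ convexHull ℝ (t : Set (Fin 4 → ℝ)) → u ∈ t := by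
    by_cases hx : x ∈ stdSimplex ℝ (Fin 4)
    · exact exists_common_vertex hx
    · exact ⟨0, fun t ht hxt => (hx (mem_stdSimplex_of_mem_convexHull ht hxt)).elim⟩
  obtain ⟨u, hu⟩ := hu
  refine ⟨ε, hε, fun C hC => ⟨fun _ v => α u v, ?_, fun _ _ _ _ _ _ _ _ _ _ => rfl⟩⟩
  intro y hy t ht hyt v hv w hw
  have hxt : x ∈ convexHull ℝ (t : Set (Fin 4 → ℝ)) := by
    by_contra h
    exact hb y (hC hy) t ht h hyt
  exact hα t ht u (hu t ht hxt) v hv w hw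

/-- Two potentials of the same field differ by a constant. On the convex, hence connected, slice `x
i = m` this constant `c` is the same everywhere, and adding `c` to `F` makes the two sections match.
-/
theorem exists_glued_section {α : (Fin 4 → ℝ) → (Fin 4 → ℝ) → ZMod 2} {C : Set (Fin 4 → ℝ)}
    (hC : Convex ℝ C) (hCs : C ⊆ stdSimplex ℝ (Fin 4)) (i : Fin 4) (m : ℝ)
    {F G : (Fin 4 → ℝ) → (Fin 4 → ℝ) → ZMod 2} (hF : IsSection T α (C ∩ {x | x i ≤ m}) F)
    (hG : IsSection T α (C ∩ {x | m ≤ x i}) G) : ∃ H, IsSection T α C H := by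
  classical
  obtain ⟨c, hc⟩ : ∃ c : ZMod 2, ∀ x ∈ C, x i = m → ∀ t ∈ T.K.faces,
      x ∈ convexHull ℝ (t : Set (Fin 4 → ℝ)) → ∀ v ∈ t, F x v + G x v = c := by
    by_cases hne : ∃ x ∈ C, x i = m
    · obtain ⟨x₀, hx₀, hx₀m⟩ := hne
      have hV : ∀ x : Fin 4 → ℝ, ∃ u : Fin 4 → ℝ, x ∈ C ∩ {x | x i = m} →
          ∀ t ∈ T.K.faces, x ∈ convexHull ℝ (t : Set (Fin 4 → ℝ)) → ∀ w ∈ t,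
            F x u + G x u = F x w + G x w := by
        intro x
        by_cases hx : x ∈ C ∩ {x | x i = m}
        · obtain ⟨u, hu⟩ := exists_common_vertex (T := T) (hCs hx.1)
          refine ⟨u, fun _ t ht hxt w hw => ?_⟩
          have h1 := hF.potential x ⟨hx.1, hx.2.le⟩ t ht hxt u (hu t ht hxt) w hw
          have h2 := hG.potential x ⟨hx.1, hx.2.ge⟩ t ht hxt u (hu t ht hxt) w hw
          have h3 : ∀ a b c d : ZMod 2, a + b = c + d → a + c = b + d := by decide
          exact h3 _ _ _ _ (h1.trans h2.symm)
        · exact ⟨0, fun h => (hx h).elim⟩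
      choose V hV using hV
      refine ⟨F x₀ (V x₀) + G x₀ (V x₀), fun x hx hxm t ht hxt v hv => ?_⟩
      rw [← hV x ⟨hx, hxm⟩ t ht hxt v hv]
      have hconv : Convex ℝ (C ∩ {x | x i = m}) :=
        hC.inter (convex_hyperplane (f := fun x : Fin 4 → ℝ => x i)
          ⟨fun _ _ => rfl, fun _ _ => rfl⟩ m)
      refine eq_of_constant_on_faces (T := T) hconv.isPreconnected
        (fun x hx => hCs hx.1) (fun x => F x (V x) + G x (V x)) ?_ ⟨hx, hxm⟩ ⟨hx₀, hx₀m⟩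
      intro s hs y hy z hz hys hzs
      obtain ⟨w, hw⟩ := T.K.nonempty_of_mem_faces hs
      rw [hV y hy s hs hys w hw, hV z hz s hs hzs w hw,
        hF.constant s hs y ⟨hy.1, hy.2.le⟩ z ⟨hz.1, hz.2.le⟩ hys hzs w hw,
        hG.constant s hs y ⟨hy.1, hy.2.ge⟩ z ⟨hz.1, hz.2.ge⟩ hys hzs w hw]
    · exact ⟨0, fun x hx hxm => (hne ⟨x, hx, hxm⟩).elim⟩
  have hadd : ∀ a b c d : ZMod 2, a + c + (b + c) = a + b := by decide
  have hcross : ∀ t ∈ T.K.faces, ∀ x ∈ C, ∀ y ∈ C, x i ≤ m → m ≤ y i →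
      x ∈ convexHull ℝ (t : Set (Fin 4 → ℝ)) → y ∈ convexHull ℝ (t : Set (Fin 4 → ℝ)) →
      ∀ v ∈ t, F x v + c = G y v := by
    intro t ht x hx y hy hxm hym hxt hyt v hv
    -- A face that meets both halves within `C` also meets the slice there, by the intermediate
    -- value theorem on a convex set; `F` and `G` are compared at that point.
    obtain ⟨z, ⟨hzC, hzt⟩, hzm⟩ : ∃ z ∈ C ∩ convexHull ℝ (t : Set (Fin 4 → ℝ)), z i = m := by
      have hpre := (hC.inter (convex_convexHull ℝ (t : Set (Fin 4 → ℝ)))).isPreconnected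
      exact hpre.intermediate_value ⟨hx, hxt⟩ ⟨hy, hyt⟩ (continuous_apply i).continuousOn
        ⟨hxm, hym⟩
    rw [hF.constant t ht x ⟨hx, hxm⟩ z ⟨hzC, hzm.le⟩ hxt hzt v hv,
      hG.constant t ht y ⟨hy, hym⟩ z ⟨hzC, hzm.ge⟩ hyt hzt v hv, ← hc z hzC hzm t ht hzt v hv]
    have : ∀ a b : ZMod 2, a + (a + b) = b := by decide
    exact this _ _
  refine ⟨fun x v => if x i ≤ m then F x v + c else G x v, ?_, ?_⟩
  · intro x hx t ht hxt v hv w hw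
    split_ifs with h
    · rw [← hF.potential x ⟨hx, h⟩ t ht hxt v hv w hw]
      exact hadd _ _ _ 0
    · exact hG.potential x ⟨hx, (not_le.1 h).le⟩ t ht hxt v hv w hw
  · intro t ht x hx y hy hxt hyt v hv
    split_ifs with h h' h'
    · rw [hF.constant t ht x ⟨hx, h⟩ y ⟨hy, h'⟩ hxt hyt v hv]
    · exact hcross t ht x hx y hy h (not_le.1 h').le hxt hyt v hv
    · exact (hcross t ht y hy x hx h' (not_le.1 h).le hyt hxt v hv).symm
    · exact hG.constant t ht x ⟨hx, (not_le.1 h).le⟩ y ⟨hy, (not_le.1 h').le⟩ hxt hyt v hv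

/-- The coordinates in `S` are bisected one after the other, each time keeping a half on which `p`
fails. -/
theorem exists_half_box {p : (Fin 4 → ℝ) → (Fin 4 → ℝ) → Prop}
    (hp : ∀ l u i, p l (Function.update u i ((l i + u i) / 2)) →
      p (Function.update l i ((l i + u i) / 2)) u → p l u)
    {l u : Fin 4 → ℝ} (hlu : l ≤ u) (h : ¬ p l u) (S : Finset (Fin 4)) :
    ∃ l' u', l ≤ l' ∧ l' ≤ u' ∧ u' ≤ u ∧ ¬ p l' u' ∧
      (∀ i ∈ S, u' i - l' i = (u i - l i) / 2) ∧ ∀ i ∉ S, l' i = l i ∧ u' i = u i := by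
  induction S using Finset.induction_on with
  | empty => exact ⟨l, u, le_rfl, hlu, le_rfl, h, by simp, by simp⟩
  | insert j S hj ih =>
    obtain ⟨l', u', h1, h2, h3, h4, h5, h6⟩ := ih
    have hle := h2 j
    by_cases hpl : p l' (Function.update u' j ((l' j + u' j) / 2))
    · have hpu : ¬ p (Function.update l' j ((l' j + u' j) / 2)) u' := fun hpu =>
        h4 (hp l' u' j hpl hpu)
      refine ⟨_, u', ?_, ?_, h3, hpu, ?_, ?_⟩
      · refine le_update_iff.2 ⟨?_, fun i _ => h1 i⟩
        have := h1 j
        linarith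
      · exact update_le_iff.2 ⟨by linarith, fun i _ => h2 i⟩
      · intro i hi
        rcases Finset.mem_insert.1 hi with rfl | hi'
        · rw [Function.update_self, (h6 i hj).1, (h6 i hj).2]
          ring
        · rw [Function.update_of_ne (by rintro rfl; exact hj hi')]
          exact h5 i hi'
      · intro i hi
        rw [Finset.mem_insert, not_or] at hi
        rw [Function.update_of_ne hi.1]
        exact h6 i hi.2
    · refine ⟨l', _, h1, ?_, ?_, hpl, ?_, ?_⟩
      · exact le_update_iff.2 ⟨by linarith, fun i _ => h2 i⟩
      · refine update_le_iff.2 ⟨?_, fun i _ => h3 i⟩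
        have := h3 j
        linarith
      · intro i hi
        rcases Finset.mem_insert.1 hi with rfl | hi'
        · rw [Function.update_self, (h6 i hj).1, (h6 i hj).2]
          ring
        · rw [Function.update_of_ne (by rintro rfl; exact hj hi')]
          exact h5 i hi'
      · intro i hi
        rw [Finset.mem_insert, not_or] at hi
        rw [Function.update_of_ne hi.1]
        exact h6 i hi.2

/-- A property of boxes that holds for small boxes and for the union of two halves of a box holds
for the unit cube. -/
theorem box_induction {p : (Fin 4 → ℝ) → (Fin 4 → ℝ) → Prop}
    (hp : ∀ l u i, p l (Function.update u i ((l i + u i) / 2)) →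
      p (Function.update l i ((l i + u i) / 2)) u → p l u)
    (hloc : ∀ x, ∃ ε > 0, ∀ l u, Set.Icc l u ⊆ Metric.ball x ε → p l u) : p 0 1 := by
  by_contra h
  let B := {b : (Fin 4 → ℝ) × (Fin 4 → ℝ) // b.1 ≤ b.2 ∧ ¬ p b.1 b.2}
  have hstep : ∀ b : B, ∃ b' : B, b.1.1 ≤ b'.1.1 ∧ b'.1.2 ≤ b.1.2 ∧
      ∀ i, b'.1.2 i - b'.1.1 i = (b.1.2 i - b.1.1 i) / 2 := by
    intro b
    obtain ⟨l', u', h1, h2, h3, h4, h5, -⟩ := exists_half_box hp b.2.1 b.2.2 univ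
    exact ⟨⟨(l', u'), h2, h4⟩, h1, h3, fun i => h5 i (mem_univ i)⟩
  choose next hn1 hn2 hn3 using hstep
  let b : ℕ → B := fun n => next^[n] ⟨(0, 1), zero_le_one, h⟩
  have hb : ∀ n, b (n + 1) = next (b n) := fun n => Function.iterate_succ_apply' _ _ _
  have hmono : Monotone fun n => (b n).1.1 := monotone_nat_of_le_succ fun n => by
    rw [hb]; exact hn1 _
  have hanti : Antitone fun n => (b n).1.2 := antitone_nat_of_succ_le fun n => by
    rw [hb]; exact hn2 _
  have hlen : ∀ n i, (b n).1.2 i - (b n).1.1 i = (1 / 2) ^ n := by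
    intro n i
    induction n with
    | zero => simp [b]
    | succ n ih => rw [hb, hn3, ih]; ring
  have hle : ∀ m n, (b m).1.1 ≤ (b n).1.2 := fun m n =>
    (hmono (le_max_left m n)).trans ((b (max m n)).2.1.trans (hanti (le_max_right m n)))
  -- The common point of the nested boxes. Their side length is `(1/2)^n`, so some box fits into the
  -- ball around `x` where `p` is known to hold.
  let x : Fin 4 → ℝ := fun i => ⨆ n, (b n).1.1 i
  have hx1 : ∀ n i, (b n).1.1 i ≤ x i := fun n i =>
    le_ciSup (f := fun n => (b n).1.1 i) ⟨_, by rintro _ ⟨m, rfl⟩; exact hle m 0 i⟩ n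
  have hx2 : ∀ n i, x i ≤ (b n).1.2 i := fun n i => ciSup_le fun m => hle m n i
  obtain ⟨ε, hε, hball⟩ := hloc x
  obtain ⟨n, hn⟩ := exists_pow_lt_of_lt_one hε (by norm_num : (1 / 2 : ℝ) < 1)
  refine (b n).2.2 (hball _ _ ?_)
  rintro y ⟨hy1, hy2⟩
  rw [Metric.mem_ball, dist_pi_lt_iff hε]
  intro i
  rw [Real.dist_eq, abs_lt]
  have h1 := hlen n i
  have h2 := hx1 n i
  have h3 := hx2 n i
  have h4 := hy1 i
  have h5 := hy2 i
  constructor <;> linarith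

theorem exists_section {α : (Fin 4 → ℝ) → (Fin 4 → ℝ) → ZMod 2}
    (hα : ∀ t ∈ T.K.faces, ∀ u ∈ t, ∀ v ∈ t, ∀ w ∈ t, α u v + α u w = α v w) :
    ∃ F, IsSection T α (stdSimplex ℝ (Fin 4)) F := by
  have key : ∃ F, IsSection T α (stdSimplex ℝ (Fin 4) ∩ Set.Icc 0 1) F := by
    refine box_induction (p := fun l u => ∃ F, IsSection T α (stdSimplex ℝ (Fin 4) ∩ Set.Icc l u) F)
      ?_ ?_
    · rintro l u i ⟨F, hF⟩ ⟨G, hG⟩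
      refine exists_glued_section ((convex_stdSimplex ℝ _).inter (convex_Icc l u))
        Set.inter_subset_left i ((l i + u i) / 2) (F := F) (G := G) ?_ ?_
      · refine ⟨fun x hx => hF.potential x ?_, fun t ht x hx y hy => hF.constant t ht x ?_ y ?_⟩
        · exact ⟨hx.1.1, hx.1.2.1, le_update_iff.2 ⟨hx.2, fun j _ => hx.1.2.2 j⟩⟩
        · exact ⟨hx.1.1, hx.1.2.1, le_update_iff.2 ⟨hx.2, fun j _ => hx.1.2.2 j⟩⟩
        · exact ⟨hy.1.1, hy.1.2.1, le_update_iff.2 ⟨hy.2, fun j _ => hy.1.2.2 j⟩⟩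
      · refine ⟨fun x hx => hG.potential x ?_, fun t ht x hx y hy => hG.constant t ht x ?_ y ?_⟩
        · exact ⟨hx.1.1, update_le_iff.2 ⟨hx.2, fun j _ => hx.1.2.1 j⟩, hx.1.2.2⟩
        · exact ⟨hx.1.1, update_le_iff.2 ⟨hx.2, fun j _ => hx.1.2.1 j⟩, hx.1.2.2⟩
        · exact ⟨hy.1.1, update_le_iff.2 ⟨hy.2, fun j _ => hy.1.2.1 j⟩, hy.1.2.2⟩
    · intro x
      obtain ⟨ε, hε, hloc⟩ := exists_local_section hα x
      exact ⟨ε, hε, fun l u h => hloc _ (Set.inter_subset_right.trans h)⟩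
  obtain ⟨F, hF⟩ := key
  have hsub : ∀ x ∈ stdSimplex ℝ (Fin 4), x ∈ stdSimplex ℝ (Fin 4) ∩ Set.Icc 0 1 := fun x hx =>
    ⟨hx, fun i => hx.1 i, fun i => by
      have := single_le_sum (f := x) (fun j _ => hx.1 j) (mem_univ i)
      rw [hx.2] at this
      exact this⟩
  exact ⟨F, fun x hx => hF.potential x (hsub x hx),
    fun t ht x hx y hy => hF.constant t ht x (hsub x hx) y (hsub y hy)⟩

/-- A flat gauge field on the tetrahedron is a coboundary. -/
theorem exists_potential (a : Cochain T 1 (ZMod 2))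
    (ha : ∀ f : Simplex T 2, ∑ i, a (f.facet i) = 0) :
    ∃ l : (Fin 4 → ℝ) → ZMod 2, ∀ e : Simplex T 1, a e = l (e.1 0) + l (e.1 1) := by
  obtain ⟨F, hF⟩ := exists_section (T := T) (α := pairValue a)
    fun t ht u hu v hv w hw => pairValue_add a ha ht hu hv hw
  -- The potential of a vertex is read off from the section over that vertex itself; along an edge
  -- the section does not change.
  refine ⟨fun v => F v v, fun e => ?_⟩
  have h0 := subset_convexHull ℝ _ (mem_coe.2 (e.mem_image 0))
  have h1 := subset_convexHull ℝ _ (mem_coe.2 (e.mem_image 1))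
  have h2 := hF.potential _ (e.mem_stdSimplex 0) _ e.2.1 h0 _ (e.mem_image 0) _ (e.mem_image 1)
  rw [pairValue_edge] at h2
  rw [← h2, hF.constant _ e.2.1 _ (e.mem_stdSimplex 0) _ (e.mem_stdSimplex 1) h0 h1 _
    (e.mem_image 1)]

/-! ### Potentials with boundary conditions -/

/-- The vertices of a simplex are faces of the triangulation. -/
theorem Simplex.singleton_mem {k : ℕ} (s : Simplex T k) (i : Fin (k + 1)) :
    {s.1 i} ∈ T.K.faces :=
  T.K.down_closed s.2.1 (singleton_subset_iff.2 (s.mem_image i)) (singleton_nonempty _)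

variable (T) in
theorem singleton_corner_mem (i : Fin 4) : {corner i} ∈ T.K.faces := by
  obtain ⟨t, ht, -, hv⟩ := exists_face (T := T) (corner_mem_stdSimplex i)
  obtain ⟨u, hu⟩ := T.K.nonempty_of_mem_faces ht
  have hz : ∀ j, j ≠ i → u j = 0 := fun j hj => hv u hu j (by rw [corner_apply, if_neg hj])
  have hs := sum_coord_of_mem ht hu
  rw [sum_eq_single i (fun j _ hj => hz j hj) (by simp)] at hs
  have : u = corner i := by
    ext j
    rw [corner_apply]
    split_ifs with h
    · rw [h, hs]
    · exact hz j h
  rw [← this]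
  exact T.K.down_closed ht (singleton_subset_iff.2 hu) (singleton_nonempty _)

theorem eq_of_eq_on_edges_of_mem {α : Type*} {I : Finset (Fin 4)} (l : (Fin 4 → ℝ) → α)
    (hl : ∀ e : Simplex T 1, e.InCoordSub I → l (e.1 0) = l (e.1 1)) {x y : Fin 4 → ℝ}
    (hx : {x} ∈ T.K.faces) (hy : {y} ∈ T.K.faces) (hxI : x ∈ coordSub I) (hyI : y ∈ coordSub I) :
    l x = l y := by
  have h : ∀ z : Fin 4 → ℝ, {z} ∈ T.K.faces → ∃ v : Simplex T 0, v.1 0 = z := by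
    intro z hz
    obtain ⟨v, hv⟩ := exists_simplex hz (k := 0) (card_singleton z)
    have := v.mem_image 0
    rw [hv, Finset.mem_singleton] at this
    exact ⟨v, this⟩
  obtain ⟨v, rfl⟩ := h x hx
  obtain ⟨w, rfl⟩ := h y hy
  refine eq_of_eq_on_edges l hl (v := v) (v' := w) (fun i => ?_) (fun i => ?_)
  · obtain rfl : i = 0 := Fin.fin_one_eq_zero i
    exact hxI
  · obtain rfl : i = 0 := Fin.fin_one_eq_zero i
    exact hyI

/-- A family of potentials for the four gauge fields. -/
abbrev Potential : Type := Color → (Fin 4 → ℝ) → ZMod 2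

/-- The gauge fields derived from potentials. -/
def config (l : Potential) : Config T := fun q => l q.2 (q.1.1 0) + l q.2 (q.1.1 1)

variable (T) in
/-- The boundary conditions of the potentials on the single-color parts of the boundary. -/
structure Normalized (l : Potential) : Prop where
  blue_face : ∀ x, {x} ∈ T.K.faces → x 0 = 0 → l blue x = 0
  red_face : ∀ x, {x} ∈ T.K.faces → x 1 = 0 → l red x = 0
  green_face : ∀ x, {x} ∈ T.K.faces → x 2 = 0 → l green x = 0
  yellow_face : ∀ x, {x} ∈ T.K.faces → x 3 = 0 → l yellow x = 0

variable (T) in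
/-- The boundary conditions of the potentials in the logical sector `k`. -/
structure IsGauge (k : ZMod 2) (l : Potential) : Prop extends Normalized T l where
  sum_face : ∀ x, {x} ∈ T.K.faces → x 3 = 0 → l red x + l green x + l blue x = k

/-- The configurations on which all `Z`-stabilizers act trivially. -/
structure IsFlat (a : Config T) : Prop where
  flat : ∀ (f : Simplex T 2) (c : Color), ∑ i, a (f.facet i, c) = 0
  blue_face : ∀ e : Simplex T 1, e.OnFace 0 → a (e, blue) = 0
  red_face : ∀ e : Simplex T 1, e.OnFace 1 → a (e, red) = 0
  green_face : ∀ e : Simplex T 1, e.OnFace 2 → a (e, green) = 0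
  sum_face : ∀ e : Simplex T 1, e.OnFace 3 → a (e, red) + a (e, green) + a (e, blue) = 0
  yellow_face : ∀ e : Simplex T 1, e.OnFace 3 → a (e, yellow) = 0

theorem zmod_two_eq_of_add_eq_zero {x y : ZMod 2} (h : x + y = 0) : x = y := by
  revert h; revert x y; decide

theorem IsGauge.isFlat {k : ZMod 2} {l : Potential} (hl : IsGauge T k l) :
    IsFlat (T := T) (config l) where
  flat f c := by
    rw [Fin.sum_univ_three]
    change l c (f.1 1) + l c (f.1 2) + (l c (f.1 0) + l c (f.1 2)) +
      (l c (f.1 0) + l c (f.1 1)) = 0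
    generalize l c (f.1 0) = x
    generalize l c (f.1 1) = y
    generalize l c (f.1 2) = z
    revert x y z
    decide
  blue_face e he := by
    simp [config, hl.blue_face _ (e.singleton_mem _) (he _)]
  red_face e he := by
    simp [config, hl.red_face _ (e.singleton_mem _) (he _)]
  green_face e he := by
    simp [config, hl.green_face _ (e.singleton_mem _) (he _)]
  yellow_face e he := by
    simp [config, hl.yellow_face _ (e.singleton_mem _) (he _)]
  sum_face e he := by
    have h0 := hl.sum_face _ (e.singleton_mem 0) (he 0)
    have h1 := hl.sum_face _ (e.singleton_mem 1) (he 1)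
    calc _ = l red (e.1 0) + l green (e.1 0) + l blue (e.1 0) +
        (l red (e.1 1) + l green (e.1 1) + l blue (e.1 1)) := by simp only [config]; ring
      _ = 0 := by rw [h0, h1, CharTwo.add_self_eq_zero]

theorem Simplex.InCoordSub.onFace {k : ℕ} {i : Fin 4} {s : Simplex T k}
    (h : s.InCoordSub {i}) : s.OnFace i := fun j => h j i (mem_singleton_self i)

theorem corner_mem_face {i j : Fin 4} (h : i ≠ j) : corner i ∈ coordSub {j} :=
  corner_mem_coordSub (by simpa using h)

theorem IsFlat.exists_isGauge {a : Config T} (ha : IsFlat a) :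
    ∃ k l, IsGauge T k l ∧ config l = a := by
  choose m hm using fun c => exists_potential (fun e => a (e, c)) fun f => ha.flat f c
  -- Each reference corner lies on the face where its color vanishes. Subtracting the value there
  -- makes the potential vanish on that whole face, by connectedness.
  let r : Color → Fin 4 := fun c => match c with
    | red => 0 | green => 0 | blue => 1 | yellow => 0
  let l : Potential := fun c x => m c x + m c (corner (r c))
  have hcfg : config l = a := by
    funext q
    obtain ⟨e, c⟩ := q
    rw [hm c e]
    change m c (e.1 0) + m c (corner (r c)) + (m c (e.1 1) + m c (corner (r c))) = _
    have h2 : ∀ x y z : ZMod 2, x + z + (y + z) = x + y := by decide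
    exact h2 _ _ _
  have hedge : ∀ c (e : Simplex T 1), l c (e.1 0) + l c (e.1 1) = a (e, c) := fun c e =>
    congrFun hcfg (e, c)
  have key : ∀ (c : Color) (i : Fin 4), r c ≠ i →
      (∀ e : Simplex T 1, e.OnFace i → a (e, c) = 0) →
      ∀ x, {x} ∈ T.K.faces → x i = 0 → l c x = 0 := by
    intro c i hi hz x hx hxi
    have h1 := eq_of_eq_on_edges_of_mem (T := T) (I := {i}) (l c) (fun e he =>
      zmod_two_eq_of_add_eq_zero ((hedge c e).trans (hz e he.onFace))) hx
      (singleton_corner_mem T (r c)) (by intro j hj; rw [Finset.mem_singleton.1 hj]; exact hxi)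
      (corner_mem_face hi)
    rw [h1]
    exact CharTwo.add_self_eq_zero _
  refine ⟨l red (corner 0) + l green (corner 0) + l blue (corner 0), l,
    ⟨⟨key _ _ (by decide) ha.blue_face, key _ _ (by decide) ha.red_face,
      key _ _ (by decide) ha.green_face, key _ _ (by decide) ha.yellow_face⟩, ?_⟩, hcfg⟩
  intro x hx hx3
  refine eq_of_eq_on_edges_of_mem (T := T) (I := {3})
    (fun x => l red x + l green x + l blue x) (fun e he => ?_) hx (singleton_corner_mem T 0)
    (by intro j hj; rw [Finset.mem_singleton.1 hj]; exact hx3) (corner_mem_face (by decide))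
  apply zmod_two_eq_of_add_eq_zero
  rw [← ha.sum_face e he.onFace, ← hedge, ← hedge, ← hedge]
  ring

/-- The potentials of a gauge field are determined by the boundary conditions. -/
theorem Normalized.eq {l l' : Potential} (hl : Normalized T l) (hl' : Normalized T l')
    (h : config (T := T) l = config l') (c : Color) {x : Fin 4 → ℝ} (hx : {x} ∈ T.K.faces) :
    l c x = l' c x := by
  have h1 : ∀ i, l c (corner i) + l' c (corner i) = l c x + l' c x := fun i =>
    eq_of_eq_on_edges_of_mem (T := T) (I := ∅) (fun x => l c x + l' c x) (fun e _ => by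
      have h2 : l c (e.1 0) + l c (e.1 1) = l' c (e.1 0) + l' c (e.1 1) := congrFun h (e, c)
      have h3 : ∀ a b c d : ZMod 2, a + b = c + d → a + c = b + d := by decide
      exact h3 _ _ _ _ h2) (singleton_corner_mem T i) hx (by simp [mem_coordSub])
      (by simp [mem_coordSub])
  apply zmod_two_eq_of_add_eq_zero
  have hc : ∀ i, {corner i} ∈ T.K.faces := singleton_corner_mem T
  cases c with
  | red =>
    rw [← h1 0, hl.red_face _ (hc 0) (by simp [corner_apply]),
      hl'.red_face _ (hc 0) (by simp [corner_apply]), add_zero]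
  | green =>
    rw [← h1 0, hl.green_face _ (hc 0) (by simp [corner_apply]),
      hl'.green_face _ (hc 0) (by simp [corner_apply]), add_zero]
  | blue =>
    rw [← h1 1, hl.blue_face _ (hc 1) (by simp [corner_apply]),
      hl'.blue_face _ (hc 1) (by simp [corner_apply]), add_zero]
  | yellow =>
    rw [← h1 0, hl.yellow_face _ (hc 0) (by simp [corner_apply]),
      hl'.yellow_face _ (hc 0) (by simp [corner_apply]), add_zero]

theorem IsGauge.sector_eq {k k' : ZMod 2} {l l' : Potential} (hl : IsGauge T k l)
    (hl' : IsGauge T k' l') (h : config (T := T) l = config l') : k = k' := by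
  have hc := singleton_corner_mem T 0
  have h3 : corner 0 3 = 0 := by simp [corner_apply]
  rw [← hl.sum_face _ hc h3, ← hl'.sum_face _ hc h3]
  simp only [hl.toNormalized.eq hl'.toNormalized h _ hc]

variable (T) in
-- A vertex of face 4 cannot lie on faces 1, 2 and 3 at once, since its coordinates sum to 1. So `k`
-- can be assigned to a single color free at the vertex: red off face 2, else blue off face 1, else
-- green.
theorem exists_isGauge (k : ZMod 2) : ∃ l, IsGauge T k l := by
  classical
  refine ⟨fun c x => match c with
    | red => if x 1 = 0 then 0 else k
    | blue => if x 1 = 0 then if x 0 = 0 then 0 else k else 0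
    | green => if x 1 = 0 then if x 0 = 0 then if x 2 = 0 then 0 else k else 0 else 0
    | yellow => 0, ⟨⟨?_, ?_, ?_, ?_⟩, ?_⟩⟩
  · intro x _ h
    simp [h]
  · intro x _ h
    simp [h]
  · intro x _ h
    simp [h]
  · intro x _ _
    rfl
  · intro x hx h3
    have hs := sum_coord_of_mem hx (mem_singleton_self x)
    rw [Fin.sum_univ_four] at hs
    by_cases h1 : x 1 = 0
    · by_cases h0 : x 0 = 0
      · by_cases h2 : x 2 = 0
        · simp [h0, h1, h2, h3] at hs
        · simp [h0, h1, h2]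
      · simp [h0, h1]
    · simp [h1]

/-! ### Coboundaries in low degrees -/

section

variable {R : Type} [CommRing R]

theorem coboundary_two (g : (Fin 4 → ℝ) → (Fin 4 → ℝ) → (Fin 4 → ℝ) → R) (s : Simplex T 3) :
    coboundary (fun f : Simplex T 2 => g (f.1 0) (f.1 1) (f.1 2)) s =
      g (s.1 1) (s.1 2) (s.1 3) - g (s.1 0) (s.1 2) (s.1 3) + g (s.1 0) (s.1 1) (s.1 3) -
        g (s.1 0) (s.1 1) (s.1 2) := by
  rw [coboundary, Fin.sum_univ_four]
  change (-1) ^ 0 * g (s.1 1) (s.1 2) (s.1 3) + (-1) ^ 1 * g (s.1 0) (s.1 2) (s.1 3) +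
    (-1) ^ 2 * g (s.1 0) (s.1 1) (s.1 3) + (-1) ^ 3 * g (s.1 0) (s.1 1) (s.1 2) = _
  ring

theorem coboundary_one (g : (Fin 4 → ℝ) → (Fin 4 → ℝ) → R) (s : Simplex T 2) :
    coboundary (fun f : Simplex T 1 => g (f.1 0) (f.1 1)) s =
      g (s.1 1) (s.1 2) - g (s.1 0) (s.1 2) + g (s.1 0) (s.1 1) := by
  rw [coboundary, Fin.sum_univ_three]
  change (-1) ^ 0 * g (s.1 1) (s.1 2) + (-1) ^ 1 * g (s.1 0) (s.1 2) +
    (-1) ^ 2 * g (s.1 0) (s.1 1) = _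
  ring

theorem coboundary_zero (g : (Fin 4 → ℝ) → R) (s : Simplex T 1) :
    coboundary (fun f : Simplex T 0 => g (f.1 0)) s = g (s.1 1) - g (s.1 0) := by
  rw [coboundary, Fin.sum_univ_two]
  change (-1) ^ 0 * g (s.1 1) + (-1) ^ 1 * g (s.1 0) = _
  ring

end

/-! ### Orientation signs and Stokes' theorem in the bulk -/

theorem bulkSign_eq (s : Simplex T 3) : bulkSign s = 1 ∨ bulkSign s = -1 := by
  have h := isVolume_det.ne_zero s.1 (fun j i hi => by simp at hi) s.linearIndependent
  change intSign (Matrix.detRowAlternating s.1) = 1 ∨ intSign (Matrix.detRowAlternating s.1) = -1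
  rcases lt_or_gt_of_ne h with h | h
  · exact Or.inr (intSign_neg h)
  · exact Or.inl (intSign_pos h)

theorem bulkSign_zmod_two (s : Simplex T 3) : (bulkSign s : ZMod 2) = 1 := by
  rcases bulkSign_eq s with h | h <;> rw [h] <;> decide

theorem inCoordSub_singleton {k : ℕ} {i : Fin 4} {s : Simplex T k} :
    s.InCoordSub {i} ↔ s.OnFace i :=
  ⟨fun h => h.onFace, fun h j m hm => by rw [Finset.mem_singleton.1 hm]; exact h j⟩

theorem inCoordSub_empty {k : ℕ} {s : Simplex T k} : s.InCoordSub ∅ := fun j i hi => by simp at hi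

theorem inCoordSub_insert {k : ℕ} {i : Fin 4} {I : Finset (Fin 4)} {s : Simplex T k} :
    s.InCoordSub (insert i I) ↔ s.OnFace i ∧ s.InCoordSub I := by
  constructor
  · intro h
    exact ⟨fun j => h j i (mem_insert_self _ _), h.of_insert⟩
  · rintro ⟨h1, h2⟩ j m hm
    rcases Finset.mem_insert.1 hm with rfl | hm
    · exact h1 j
    · exact h2 j m hm

theorem stokes_bulk {R : Type} [CommRing R] (M : Cochain T 2 R)
    (hM : ∀ f : Simplex T 2, ∀ i ≠ 3, f.OnFace i → M f = 0) :
    bulkIntegral (coboundary M) = bdryIntegral M := by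
  classical
  have h := stokes (T := T) isVolume_det (j := 3) (by simp) M fun f _ i _ hi => hM f i hi
  rw [filter_true_of_mem fun s _ => inCoordSub_empty] at h
  rw [bulkIntegral, bdryIntegral]
  refine h.trans (sum_congr ?_ fun s _ => ?_)
  · ext s
    simp [bdry, inCoordSub_singleton]
  · have h3 : s.1 = ![s.1 0, s.1 1, s.1 2] := by
      funext i
      fin_cases i <;> rfl
    change (intSign (Matrix.det (Matrix.of (Matrix.vecCons (corner 3) s.1))) : R) * M s = _
    rw [h3]
    rfl

/-- Modulo 2 the orientation signs disappear. This is the integration by parts used for the action.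
-/
theorem sum_coboundary_eq_zero (M : Cochain T 2 (ZMod 2))
    (hM : ∀ f : Simplex T 2, ∀ i, f.OnFace i → M f = 0) : ∑ s, coboundary M s = 0 := by
  have h := stokes_bulk M fun f i _ => hM f i
  simp only [bulkIntegral, bulkSign_zmod_two, one_mul] at h
  rw [h, bdryIntegral]
  refine sum_eq_zero fun f hf => ?_
  rw [hM f 3 (by simpa [bdry] using hf), mul_zero]

/-! ### The action -/

variable (T) in
/-- The phase exponent of the code states. -/
def action (l : Potential) : ZMod 2 :=
  ∑ s : Simplex T 3, l red (s.1 0) * (l yellow (s.1 0) + l yellow (s.1 1)) *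
    (l blue (s.1 1) + l blue (s.1 2)) * (l green (s.1 2) + l green (s.1 3))

theorem action_congr {l l' : Potential} (h : ∀ c x, {x} ∈ T.K.faces → l c x = l' c x) :
    action T l = action T l' := by
  refine sum_congr rfl fun s _ => ?_
  simp only [h _ _ (s.singleton_mem _)]

/-- Adding `m` to the potential of color `c`. -/
def shift (l : Potential) (c : Color) (m : (Fin 4 → ℝ) → ZMod 2) : Potential :=
  fun c' x => if c' = c then l c' x + m x else l c' x

theorem action_shift_red (l : Potential) (m : (Fin 4 → ℝ) → ZMod 2) :
    action T (shift l red m) = action T l + ∑ s : Simplex T 3, m (s.1 0) *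
      (l yellow (s.1 0) + l yellow (s.1 1)) * (l blue (s.1 1) + l blue (s.1 2)) *
        (l green (s.1 2) + l green (s.1 3)) := by
  rw [action, action, ← sum_add_distrib]
  refine sum_congr rfl fun s _ => ?_
  simp [shift]
  ring

/-- Integration by parts moves the coboundary from `m` to the red potential. The boundary term is
the integral of `l_r m ∪ dl_b ∪ dl_g`, which vanishes on faces 1, 2, 3 by the normalization of blue,
red, green and on face 4 by the condition on `m`. The blue and green shifts follow the same pattern,
with the condition on `m` placed at the face of the shifted color. -/
theorem action_shift_yellow {l : Potential} (hl : Normalized T l) {m : (Fin 4 → ℝ) → ZMod 2}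
    (hm : ∀ x, {x} ∈ T.K.faces → x 3 = 0 → m x = 0) :
    action T (shift l yellow m) = action T l + ∑ s : Simplex T 3, (l red (s.1 0) + l red (s.1 1)) *
      m (s.1 1) * (l blue (s.1 1) + l blue (s.1 2)) * (l green (s.1 2) + l green (s.1 3)) := by
  have h := sum_coboundary_eq_zero (T := T) (fun f => l red (f.1 0) * m (f.1 0) *
    (l blue (f.1 0) + l blue (f.1 1)) * (l green (f.1 1) + l green (f.1 2))) fun f i hf => by
      fin_cases i
      · simp [hl.blue_face _ (f.singleton_mem _) (hf _)]
      · simp [hl.red_face _ (f.singleton_mem _) (hf _)]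
      · simp [hl.green_face _ (f.singleton_mem _) (hf _)]
      · simp [hm _ (f.singleton_mem _) (hf _)]
  -- The added 0 is rewritten as the sum of the coboundary; the identity then holds on each
  -- 3-simplex.
  refine Eq.trans ?_ (add_zero _)
  rw [action, action, ← h, ← sum_add_distrib, ← sum_add_distrib]
  refine sum_congr rfl fun s _ => ?_
  rw [coboundary_two fun x y z => l red x * m x * (l blue x + l blue y) * (l green y + l green z)]
  simp [shift]
  grind

theorem action_shift_blue {l : Potential} (hl : Normalized T l) {m : (Fin 4 → ℝ) → ZMod 2}
    (hm : ∀ x, {x} ∈ T.K.faces → x 0 = 0 → m x = 0) :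
    action T (shift l blue m) = action T l + ∑ s : Simplex T 3, (l red (s.1 0) + l red (s.1 1)) *
      (l yellow (s.1 1) + l yellow (s.1 2)) * m (s.1 2) * (l green (s.1 2) + l green (s.1 3)) := by
  have h := sum_coboundary_eq_zero (T := T) (fun f => l red (f.1 0) *
    (l yellow (f.1 0) + l yellow (f.1 1)) * m (f.1 1) * (l green (f.1 1) + l green (f.1 2)))
    fun f i hf => by
      fin_cases i
      · simp [hm _ (f.singleton_mem _) (hf _)]
      · simp [hl.red_face _ (f.singleton_mem _) (hf _)]
      · simp [hl.green_face _ (f.singleton_mem _) (hf _)]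
      · simp [hl.yellow_face _ (f.singleton_mem _) (hf _)]
  refine Eq.trans ?_ (add_zero _)
  rw [action, action, ← h, ← sum_add_distrib, ← sum_add_distrib]
  refine sum_congr rfl fun s _ => ?_
  rw [coboundary_two fun x y z => l red x * (l yellow x + l yellow y) * m y *
    (l green y + l green z)]
  simp [shift]
  grind

theorem action_shift_green {l : Potential} (hl : Normalized T l) {m : (Fin 4 → ℝ) → ZMod 2}
    (hm : ∀ x, {x} ∈ T.K.faces → x 2 = 0 → m x = 0) :
    action T (shift l green m) = action T l + ∑ s : Simplex T 3, (l red (s.1 0) + l red (s.1 1)) *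
      (l yellow (s.1 1) + l yellow (s.1 2)) * (l blue (s.1 2) + l blue (s.1 3)) * m (s.1 3) := by
  have h := sum_coboundary_eq_zero (T := T) (fun f => l red (f.1 0) *
    (l yellow (f.1 0) + l yellow (f.1 1)) * (l blue (f.1 1) + l blue (f.1 2)) * m (f.1 2))
    fun f i hf => by
      fin_cases i
      · simp [hl.blue_face _ (f.singleton_mem _) (hf _)]
      · simp [hl.red_face _ (f.singleton_mem _) (hf _)]
      · simp [hm _ (f.singleton_mem _) (hf _)]
      · simp [hl.yellow_face _ (f.singleton_mem _) (hf _)]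
  refine Eq.trans ?_ (add_zero _)
  rw [action, action, ← h, ← sum_add_distrib, ← sum_add_distrib]
  refine sum_congr rfl fun s _ => ?_
  rw [coboundary_two fun x y z => l red x * (l yellow x + l yellow y) *
    (l blue y + l blue z) * m z]
  simp [shift]
  grind

/-! ### Diagonal operators and permutations -/

theorem diagOp_apply (f : Config T → ℂ) (ψ : State T) (a : Config T) :
    diagOp f ψ a = f a * ψ a := rfl

theorem permOp_apply (π : Equiv.Perm (Config T)) (ψ : State T) (a : Config T) :
    permOp π ψ a = ψ (π.symm a) := rfl

/-- `diagOp` as a homomorphism. -/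
def diagHom : (Config T → ℂ) →* Op T where
  toFun := diagOp
  map_one' := by
    ext ψ a
    simp [diagOp_apply]
  map_mul' f g := by
    ext ψ a
    simp [diagOp_apply, mul_assoc]

theorem diagOp_mul (f g : Config T → ℂ) : diagOp f * diagOp g = diagOp (f * g) :=
  (map_mul diagHom f g).symm

theorem opProd_diagOp {ι : Type} (S : Finset ι) (F : ι → Config T → ℂ) :
    opProd S (fun i => diagOp (F i)) = diagOp fun a => ∏ i ∈ S, F i a := by
  have h1 : (S.toList.map fun i => diagOp (F i)) = (S.toList.map F).map diagHom := by
    rw [List.map_map]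
    rfl
  rw [opProd, h1, ← map_list_prod, Finset.prod_map_toList]
  change diagOp _ = _
  congr 1
  ext a
  simp

/-- The sign `(-1)^x`. -/
def phase (x : ZMod 2) : ℂ := if x = 0 then 1 else -1

theorem zmod_two_cases (x : ZMod 2) : x = 0 ∨ x = 1 := by
  revert x; decide

@[simp] theorem phase_zero : phase 0 = 1 := if_pos rfl
@[simp] theorem phase_one : phase 1 = -1 := if_neg one_ne_zero

theorem phase_add (x y : ZMod 2) : phase (x + y) = phase x * phase y := by
  rcases zmod_two_cases x with rfl | rfl <;> rcases zmod_two_cases y with rfl | rfl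
  · simp
  · simp
  · simp
  · rw [CharTwo.add_self_eq_zero]; simp

theorem phase_mul_self (x : ZMod 2) : phase x * phase x = 1 := by
  rw [← phase_add, CharTwo.add_self_eq_zero, phase_zero]

theorem phase_sum {ι : Type*} (S : Finset ι) (f : ι → ZMod 2) :
    phase (∑ i ∈ S, f i) = ∏ i ∈ S, phase (f i) := by
  classical
  induction S using Finset.induction_on with
  | empty => simp
  | insert i S hi ih => rw [sum_insert hi, prod_insert hi, phase_add, ih]

theorem phase_eq_one_iff (x : ZMod 2) : phase x = 1 ↔ x = 0 := by
  rcases zmod_two_cases x with rfl | rfl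
  · simp
  · simp only [phase_one, one_ne_zero, iff_false]
    norm_num

theorem norm_phase (x : ZMod 2) : ‖phase x‖ = 1 := by
  rcases zmod_two_cases x with rfl | rfl <;> simp

theorem pauliZ_eq (q : Qubit T) : pauliZ q = diagOp fun a => phase (a q) := by
  rw [pauliZ, phaseGate]
  congr 1
  ext a
  rcases zmod_two_cases (a q) with h | h <;> simp [h]

theorem ccz_eq (q₁ q₂ q₃ : Qubit T) :
    ccz q₁ q₂ q₃ = diagOp fun a => phase (a q₁ * a q₂ * a q₃) := by
  rw [ccz, phaseGate]
  congr 1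
  ext a
  rcases zmod_two_cases (a q₁) with h1 | h1 <;> rcases zmod_two_cases (a q₂) with h2 | h2 <;>
    rcases zmod_two_cases (a q₃) with h3 | h3 <;> simp [h1, h2, h3]

theorem zStab_eq (f : Simplex T 2) (c : Color) :
    zStab f c = diagOp fun a => phase (∑ i, a (f.facet i, c)) := by
  simp only [zStab, pauliZ_eq]
  rw [opProd_diagOp]
  simp only [phase_sum]
  rfl

theorem logicalZ_eq : logicalZ T = diagOp fun a => phase (∑ e ∈ hinge T, a (e, red)) := by
  simp only [logicalZ, pauliZ_eq]
  rw [opProd_diagOp]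
  simp only [phase_sum]

/-! ### The `X`-stabilizers -/

/-- The vertex number `i` of a simplex. -/
def Simplex.vtx {k : ℕ} (s : Simplex T k) (i : Fin (k + 1)) : Simplex T 0 :=
  s.sub (fun _ => i) fun a b h => absurd (Subsingleton.elim (α := Fin 1) a b) h.ne

section

variable {R : Type} [CommRing R]

theorem cup_vertex_first (f : Cochain T 0 R) (g₁ g₂ g₃ : Cochain T 1 R) (s : Simplex T 3) :
    cup (cup (cup f g₁) g₂) g₃ s = f (s.vtx 0) * g₁ (s.edge 0 1 (by decide)) *
      g₂ (s.edge 1 2 (by decide)) * g₃ (s.edge 2 3 (by decide)) := by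
  have h0 : ((s.front 2 1).front 1 1).front 0 1 = s.vtx 0 :=
    Subtype.ext (funext fun i => by fin_cases i; rfl)
  have h1 : ((s.front 2 1).front 1 1).back 0 1 = s.edge 0 1 (by decide) :=
    Subtype.ext (funext fun i => by fin_cases i <;> rfl)
  have h2 : (s.front 2 1).back 1 1 = s.edge 1 2 (by decide) :=
    Subtype.ext (funext fun i => by fin_cases i <;> rfl)
  have h3 : s.back 2 1 = s.edge 2 3 (by decide) :=
    Subtype.ext (funext fun i => by fin_cases i <;> rfl)
  rw [← h0, ← h1, ← h2, ← h3]
  rfl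

theorem cup_vertex_second (f : Cochain T 0 R) (g₁ g₂ g₃ : Cochain T 1 R) (s : Simplex T 3) :
    cup (cup (cup g₁ f) g₂) g₃ s = g₁ (s.edge 0 1 (by decide)) * f (s.vtx 1) *
      g₂ (s.edge 1 2 (by decide)) * g₃ (s.edge 2 3 (by decide)) := by
  have h0 : ((s.front 2 1).front 1 1).back 1 0 = s.vtx 1 :=
    Subtype.ext (funext fun i => by fin_cases i; rfl)
  have h1 : ((s.front 2 1).front 1 1).front 1 0 = s.edge 0 1 (by decide) :=
    Subtype.ext (funext fun i => by fin_cases i <;> rfl)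
  have h2 : (s.front 2 1).back 1 1 = s.edge 1 2 (by decide) :=
    Subtype.ext (funext fun i => by fin_cases i <;> rfl)
  have h3 : s.back 2 1 = s.edge 2 3 (by decide) :=
    Subtype.ext (funext fun i => by fin_cases i <;> rfl)
  rw [← h0, ← h1, ← h2, ← h3]
  rfl

theorem cup_vertex_third (f : Cochain T 0 R) (g₁ g₂ g₃ : Cochain T 1 R) (s : Simplex T 3) :
    cup (cup (cup g₁ g₂) f) g₃ s = g₁ (s.edge 0 1 (by decide)) * g₂ (s.edge 1 2 (by decide)) *
      f (s.vtx 2) * g₃ (s.edge 2 3 (by decide)) := by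
  have h0 : (s.front 2 1).back 2 0 = s.vtx 2 :=
    Subtype.ext (funext fun i => by fin_cases i; rfl)
  have h1 : ((s.front 2 1).front 2 0).front 1 1 = s.edge 0 1 (by decide) :=
    Subtype.ext (funext fun i => by fin_cases i <;> rfl)
  have h2 : ((s.front 2 1).front 2 0).back 1 1 = s.edge 1 2 (by decide) :=
    Subtype.ext (funext fun i => by fin_cases i <;> rfl)
  have h3 : s.back 2 1 = s.edge 2 3 (by decide) :=
    Subtype.ext (funext fun i => by fin_cases i <;> rfl)
  rw [← h0, ← h1, ← h2, ← h3]
  rfl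

theorem cup_vertex_fourth (f : Cochain T 0 R) (g₁ g₂ g₃ : Cochain T 1 R) (s : Simplex T 3) :
    cup (cup (cup g₁ g₂) g₃) f s = g₁ (s.edge 0 1 (by decide)) * g₂ (s.edge 1 2 (by decide)) *
      g₃ (s.edge 2 3 (by decide)) * f (s.vtx 3) := by
  have h0 : s.back 3 0 = s.vtx 3 :=
    Subtype.ext (funext fun i => by fin_cases i; rfl)
  have h1 : ((s.front 3 0).front 2 1).front 1 1 = s.edge 0 1 (by decide) :=
    Subtype.ext (funext fun i => by fin_cases i <;> rfl)
  have h2 : ((s.front 3 0).front 2 1).back 1 1 = s.edge 1 2 (by decide) :=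
    Subtype.ext (funext fun i => by fin_cases i <;> rfl)
  have h3 : (s.front 3 0).back 2 1 = s.edge 2 3 (by decide) :=
    Subtype.ext (funext fun i => by fin_cases i <;> rfl)
  rw [← h0, ← h1, ← h2, ← h3]
  rfl

theorem cup_three (g₁ g₂ g₃ : Cochain T 1 R) (s : Simplex T 3) :
    cup (cup g₁ g₂) g₃ s = g₁ (s.edge 0 1 (by decide)) * g₂ (s.edge 1 2 (by decide)) *
      g₃ (s.edge 2 3 (by decide)) := by
  have h1 : (s.front 2 1).front 1 1 = s.edge 0 1 (by decide) :=
    Subtype.ext (funext fun i => by fin_cases i <;> rfl)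
  have h2 : (s.front 2 1).back 1 1 = s.edge 1 2 (by decide) :=
    Subtype.ext (funext fun i => by fin_cases i <;> rfl)
  have h3 : s.back 2 1 = s.edge 2 3 (by decide) :=
    Subtype.ext (funext fun i => by fin_cases i <;> rfl)
  rw [← h1, ← h2, ← h3]
  rfl

theorem cup_two (g₁ g₂ : Cochain T 1 R) (s : Simplex T 2) :
    cup g₁ g₂ s = g₁ (s.edge 0 1 (by decide)) * g₂ (s.edge 1 2 (by decide)) := by
  have h1 : s.front 1 1 = s.edge 0 1 (by decide) :=
    Subtype.ext (funext fun i => by fin_cases i <;> rfl)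
  have h2 : s.back 1 1 = s.edge 1 2 (by decide) :=
    Subtype.ext (funext fun i => by fin_cases i <;> rfl)
  rw [← h1, ← h2]
  rfl

end

/-- The indicator function of a vertex. -/
def vertexIndicator (v : Simplex T 0) (x : Fin 4 → ℝ) : ZMod 2 := if v.1 0 = x then 1 else 0

theorem indicator_vtx (v : Simplex T 0) {k : ℕ} (s : Simplex T k) (i : Fin (k + 1)) :
    indicator (ZMod 2) v (s.vtx i) = vertexIndicator v (s.1 i) := by
  have h : s.vtx i = v ↔ v.1 0 = s.1 i := by
    constructor
    · rintro rfl
      rfl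
    · intro h
      refine Subtype.ext (funext fun j => ?_)
      obtain rfl : j = 0 := Fin.fin_one_eq_zero j
      exact h.symm
  rw [indicator, vertexIndicator, Pi.single_apply]
  simp only [h]

/-- The bracket counts, with weights, the 3-simplices having `t` as consecutive edges. Interchanging
the sums turns the `CCZ` exponent over triples of edges into an integral over 3-simplices. -/
theorem sum_indicator_mul (w : Simplex T 3 → ZMod 2) (e₁ e₂ e₃ : Simplex T 3 → Simplex T 1)
    (A B C : Simplex T 1 → ZMod 2) :
    ∑ t : Simplex T 1 × Simplex T 1 × Simplex T 1, (∑ s, w s * indicator (ZMod 2) t.1 (e₁ s) *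
      indicator (ZMod 2) t.2.1 (e₂ s) * indicator (ZMod 2) t.2.2 (e₃ s)) *
        (A t.1 * B t.2.1 * C t.2.2) = ∑ s, w s * A (e₁ s) * B (e₂ s) * C (e₃ s) := by
  simp only [sum_mul]
  rw [sum_comm]
  refine sum_congr rfl fun s _ => ?_
  rw [sum_eq_single (e₁ s, e₂ s, e₃ s)]
  · simp [indicator]
    ring
  · rintro ⟨t1, t2, t3⟩ _ hne
    have : t1 ≠ e₁ s ∨ t2 ≠ e₂ s ∨ t3 ≠ e₃ s := by
      by_contra! h
      exact hne (by rw [h.1, h.2.1, h.2.2])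
    rcases this with h | h | h <;> simp [indicator, Pi.single_eq_of_ne h.symm]
  · simp

/-- In `ZMod 2`, restricting to nonzero `N t` is the same as weighting by `N t`. -/
theorem opProd_filter_phase {ι : Type} [Fintype ι] (N : ι → ZMod 2)
    [DecidablePred fun t => N t ≠ 0] (A : ι → Config T → ZMod 2) :
    opProd (univ.filter fun t => N t ≠ 0) (fun t => diagOp fun a => phase (A t a)) =
      diagOp fun a => phase (∑ t, N t * A t a) := by
  rw [opProd_diagOp]
  congr 1
  ext a
  rw [prod_filter, phase_sum]
  refine prod_congr rfl fun t _ => ?_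
  rcases zmod_two_cases (N t) with h | h <;> simp [h]

/-- The phase exponent of the dressing of the `X`-stabilizers. -/
def dressingExponent (v : Simplex T 0) (a : Config T) : Color → ZMod 2
  | red => ∑ s : Simplex T 3, vertexIndicator v (s.1 0) * a (s.edge 0 1 (by decide), yellow) *
      a (s.edge 1 2 (by decide), blue) * a (s.edge 2 3 (by decide), green)
  | yellow => ∑ s : Simplex T 3, vertexIndicator v (s.1 1) * a (s.edge 0 1 (by decide), red) *
      a (s.edge 1 2 (by decide), blue) * a (s.edge 2 3 (by decide), green)
  | blue => ∑ s : Simplex T 3, vertexIndicator v (s.1 2) * a (s.edge 0 1 (by decide), red) *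
      a (s.edge 1 2 (by decide), yellow) * a (s.edge 2 3 (by decide), green)
  | green => ∑ s : Simplex T 3, vertexIndicator v (s.1 3) * a (s.edge 0 1 (by decide), red) *
      a (s.edge 1 2 (by decide), yellow) * a (s.edge 2 3 (by decide), blue)

theorem dressing_eq (v : Simplex T 0) (c : Color) :
    dressing v c = diagOp fun a => phase (dressingExponent v a c) := by
  cases c
  · simp only [dressing, ccz_eq]
    rw [opProd_filter_phase]
    congr 1
    ext a
    congr 1
    rw [dressingExponent, ← sum_indicator_mul _ _ _ _ (fun e => a (e, yellow))
      (fun e => a (e, blue)) (fun e => a (e, green))]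
    refine sum_congr rfl fun t _ => ?_
    congr 1
    refine sum_congr rfl fun s _ => ?_
    rw [cup_vertex_first, bulkSign_zmod_two, indicator_vtx]
    ring
  · simp only [dressing, ccz_eq]
    rw [opProd_filter_phase]
    congr 1
    ext a
    congr 1
    rw [dressingExponent, ← sum_indicator_mul _ _ _ _ (fun e => a (e, red))
      (fun e => a (e, yellow)) (fun e => a (e, blue))]
    refine sum_congr rfl fun t _ => ?_
    congr 1
    refine sum_congr rfl fun s _ => ?_
    rw [cup_vertex_fourth, bulkSign_zmod_two, indicator_vtx]
    ring
  · simp only [dressing, ccz_eq]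
    rw [opProd_filter_phase]
    congr 1
    ext a
    congr 1
    rw [dressingExponent, ← sum_indicator_mul _ _ _ _ (fun e => a (e, red))
      (fun e => a (e, yellow)) (fun e => a (e, green))]
    refine sum_congr rfl fun t _ => ?_
    congr 1
    refine sum_congr rfl fun s _ => ?_
    rw [cup_vertex_third, bulkSign_zmod_two, indicator_vtx]
    ring
  · simp only [dressing, ccz_eq]
    rw [opProd_filter_phase]
    congr 1
    ext a
    congr 1
    rw [dressingExponent, ← sum_indicator_mul _ _ _ _ (fun e => a (e, red))
      (fun e => a (e, blue)) (fun e => a (e, green))]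
    refine sum_congr rfl fun t _ => ?_
    congr 1
    refine sum_congr rfl fun s _ => ?_
    rw [cup_vertex_second, bulkSign_zmod_two, indicator_vtx]
    ring

/-- The configuration that is `1` on the qubits of color `c` at the edges containing `v`. -/
def starConfig (v : Simplex T 0) (c : Color) : Config T :=
  fun q => if q.2 = c then vertexIndicator v (q.1.1 0) + vertexIndicator v (q.1.1 1) else 0

theorem sum_edgeStar (v : Simplex T 0) (c : Color) :
    ∑ e ∈ edgeStar v, (Pi.single (e, c) 1 : Config T) = starConfig v c := by
  classical
  funext q
  obtain ⟨e, c'⟩ := q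
  rw [Finset.sum_apply, starConfig]
  by_cases hc : c' = c
  · subst hc
    have h1 : ∀ e' : Simplex T 1, (Pi.single (e', c') 1 : Config T) (e, c') =
        if e = e' then 1 else 0 := fun e' => by
      rw [Pi.single_apply]
      simp
    simp only [h1, if_true]
    rw [sum_ite_eq]
    have hne : e.1 0 ≠ e.1 1 := fun h => absurd (e.injective h) (by decide)
    simp only [edgeStar, mem_filter, mem_univ, true_and, vertexIndicator]
    by_cases h0 : v.1 0 = e.1 0
    · have h1 : v.1 0 ≠ e.1 1 := fun h => hne (h0.symm.trans h)
      simp [h0, hne]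
    · by_cases h1 : v.1 0 = e.1 1
      · simp [h1, hne.symm]
      · simp [h0, h1]
  · rw [if_neg hc]
    refine sum_eq_zero fun e' _ => ?_
    rw [Pi.single_apply, if_neg]
    rw [Prod.mk.injEq]
    exact fun h => hc h.2

theorem opProd_pauliX_apply {ι : Type} (S : Finset ι) (q : ι → Qubit T) (ψ : State T)
    (a : Config T) :
    opProd S (fun i => pauliX (q i)) ψ a = ψ (a + ∑ i ∈ S, Pi.single (q i) 1) := by
  rw [opProd, ← Finset.sum_map_toList]
  generalize S.toList = L
  induction L generalizing a with
  | nil => simp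
  | cons i L ih =>
    rw [List.map_cons, List.prod_cons, Module.End.mul_apply, pauliX, permOp_apply, ih,
      List.map_cons, List.sum_cons]
    refine congrArg ψ.ofLp ?_
    funext x
    simp only [Equiv.addRight_symm, Equiv.coe_addRight, Pi.add_apply, Pi.neg_apply,
      CharTwo.neg_eq]
    ring

/-- The dressing of color `c` involves only the other three colors, so it commutes with the Pauli
`X` part. -/
theorem dressingExponent_add_star (v : Simplex T 0) (c : Color) (a : Config T) :
    dressingExponent v (a + starConfig v c) c = dressingExponent v a c := by
  cases c <;> simp [dressingExponent, starConfig]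

theorem xStab_apply (v : Simplex T 0) (c : Color) (ψ : State T) (a : Config T) :
    xStab v c ψ a = phase (dressingExponent v a c) * ψ (a + starConfig v c) := by
  rw [xStab, Module.End.mul_apply, opProd_pauliX_apply, sum_edgeStar, dressing_eq, diagOp_apply,
    dressingExponent_add_star]

/-- The `X` operators around a vertex are a gauge transformation: they flip one potential at that
vertex. -/
theorem config_shift (l : Potential) (v : Simplex T 0) (c : Color) :
    config (T := T) (shift l c (vertexIndicator v)) = config l + starConfig v c := by
  funext q
  obtain ⟨e, c'⟩ := q
  simp only [config, shift, starConfig, Pi.add_apply]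
  split_ifs with h
  · ring
  · rw [add_zero]

/-- The conditions under which the dressing is the variation of the action. -/
def Admissible (v : Simplex T 0) (c : Color) : Prop := Unbroken v c ∧ (v.OnFace 3 → c ≠ yellow)

theorem onFace_zero_iff {v : Simplex T 0} {i : Fin 4} : v.OnFace i ↔ v.1 0 i = 0 :=
  ⟨fun h => h 0, fun h j => by obtain rfl : j = 0 := Fin.fin_one_eq_zero j; exact h⟩

theorem vertexIndicator_eq_zero {v : Simplex T 0} {i : Fin 4} (hv : ¬ v.OnFace i) {x : Fin 4 → ℝ}
    (hx : x i = 0) : vertexIndicator v x = 0 := by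
  rw [vertexIndicator, if_neg]
  rintro rfl
  exact hv (onFace_zero_iff.2 hx)

/-- This is why the dressing has its form: `v` in the slot of color `c` is what remains of the
varied action after integration by parts. Admissibility makes the indicator of `v` vanish on the
face of color `c`, as the boundary terms require. -/
theorem action_shift {l : Potential} (hl : Normalized T l) {v : Simplex T 0} {c : Color}
    (h : Admissible v c) : action T (shift l c (vertexIndicator v)) =
      action T l + dressingExponent v (config l) c := by
  cases c
  · rw [action_shift_red]
    rfl
  · rw [action_shift_green hl fun x _ hx => vertexIndicator_eq_zero (fun hv => h.1.2.2 hv rfl) hx]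
    congr 1
    refine sum_congr rfl fun s _ => ?_
    change _ = vertexIndicator v (s.1 3) * (l red (s.1 0) + l red (s.1 1)) *
      (l yellow (s.1 1) + l yellow (s.1 2)) * (l blue (s.1 2) + l blue (s.1 3))
    ring
  · rw [action_shift_blue hl fun x _ hx => vertexIndicator_eq_zero (fun hv => h.1.1 hv rfl) hx]
    congr 1
    refine sum_congr rfl fun s _ => ?_
    change _ = vertexIndicator v (s.1 2) * (l red (s.1 0) + l red (s.1 1)) *
      (l yellow (s.1 1) + l yellow (s.1 2)) * (l green (s.1 2) + l green (s.1 3))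
    ring
  · rw [action_shift_yellow hl fun x _ hx => vertexIndicator_eq_zero (fun hv => h.2 hv rfl) hx]
    congr 1
    refine sum_congr rfl fun s _ => ?_
    change _ = vertexIndicator v (s.1 1) * (l red (s.1 0) + l red (s.1 1)) *
      (l blue (s.1 1) + l blue (s.1 2)) * (l green (s.1 2) + l green (s.1 3))
    ring

theorem Normalized.shift {l : Potential} (hl : Normalized T l) {v : Simplex T 0} {c : Color}
    (h : Admissible v c) : Normalized T (shift l c (vertexIndicator v)) := by
  refine ⟨fun x hx h0 => ?_, fun x hx h0 => ?_, fun x hx h0 => ?_, fun x hx h0 => ?_⟩ <;>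
    simp only [SqrtTCode.shift] <;> split_ifs with hc
  · rw [hl.blue_face x hx h0, vertexIndicator_eq_zero (fun hv => h.1.1 hv hc.symm) h0, add_zero]
  · exact hl.blue_face x hx h0
  · rw [hl.red_face x hx h0, vertexIndicator_eq_zero (fun hv => h.1.2.1 hv hc.symm) h0, add_zero]
  · exact hl.red_face x hx h0
  · rw [hl.green_face x hx h0, vertexIndicator_eq_zero (fun hv => h.1.2.2 hv hc.symm) h0, add_zero]
  · exact hl.green_face x hx h0
  · rw [hl.yellow_face x hx h0, vertexIndicator_eq_zero (fun hv => h.2 hv hc.symm) h0, add_zero]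
  · exact hl.yellow_face x hx h0

/-- An `X`-stabilizer in terms of potentials. -/
theorem xStab_apply_config {l : Potential} (hl : Normalized T l) {v : Simplex T 0} {c : Color}
    (h : Admissible v c) (ψ : State T) :
    phase (action T l) * xStab v c ψ (config l) =
      phase (action T (shift l c (vertexIndicator v))) *
        ψ (config (shift l c (vertexIndicator v))) := by
  rw [xStab_apply, action_shift hl h, phase_add, config_shift]
  ring

/-! ### The transversal `CNOT` -/

/-- The action of the `CNOT` gates on configurations. -/
def mix (a : Config T) : Config T :=
  fun q => if q.2 = yellow then a q + a (q.1, red) + a (q.1, green) + a (q.1, blue) else a q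

theorem V_apply (ψ : State T) (a : Config T) : V T ψ a = ψ (mix a) := by
  classical
  -- Induction on the set of edges already treated. The list has no duplicates, so each yellow qubit
  -- is a target only at its own edge, and controls are never changed.
  have key : ∀ L : List (Simplex T 1), L.Nodup → ∀ a : Config T,
      (L.map fun e : Simplex T 1 => cnot (e, red) (e, yellow) (by simp) *
        cnot (e, green) (e, yellow) (by simp) * cnot (e, blue) (e, yellow) (by simp)).prod ψ a =
      ψ fun q => if q.1 ∈ L then mix a q else a q := by
    intro L
    induction L with
    | nil => intro _ a; simp
    | cons e L ih =>
      intro hL a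
      rw [List.nodup_cons] at hL
      rw [List.map_cons, List.prod_cons, Module.End.mul_apply, Module.End.mul_apply,
        Module.End.mul_apply, cnot, permOp_apply, cnot, permOp_apply, cnot, permOp_apply,
        ih hL.2]
      refine congrArg ψ.ofLp ?_
      funext q
      obtain ⟨e', c⟩ := q
      simp only [List.mem_cons, Equiv.coe_fn_symm_mk]
      by_cases he : e' = e
      · subst he
        cases c <;> simp [hL.1, mix]
      · cases c <;> simp [he, mix]
  rw [V, opProd, key _ (nodup_toList _)]
  refine congrArg ψ.ofLp ?_
  funext q
  simp

/-! ### `W` as a circuit -/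

/-- The phase of `W` at a configuration. -/
def wPhase (a : Config T) : ℂ :=
  Complex.exp (Real.pi * Complex.I *
    ((bulkIntegral (cup (cup (lift a red) (lift a blue)) (lift a green)) : ℤ) / 2
      + ((bulkIntegral (cup (cup (gauge a red) (cupOne (gauge a green) (gauge a blue)))
            (gauge a green)) : ZMod 2).val : ℂ)
      - (bdryIntegral (cup (lift a red) (lift a green)) : ℤ) / 4
      + (hingeIntegral (lift a red) : ℤ) / 8))

theorem W_eq : W T = diagOp wPhase := rfl

theorem exp_pi_val (x : ZMod 2) : Complex.exp (Real.pi * Complex.I * (x.val : ℂ)) = phase x := by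
  rcases zmod_two_cases x with rfl | rfl
  · simp
  · simp [ZMod.val_one]

/-! ### The phase of `W` on gauge configurations -/

/-- The lift of a bit to `ZMod 16`. -/
def bit (x : ZMod 2) : ZMod 16 := (x.val : ZMod 16)

/-- The embedding of `ZMod 2` into `ZMod 16`. -/
def eight : ZMod 2 →+ ZMod 16 where
  toFun x := 8 * bit x
  map_zero' := by decide
  map_add' := by decide

/-- First step of the descent, in units of `2π/16`, where the coefficients `1/2` and `1` of `W`
become 4 and 8. The `p` are red potentials at vertices, the `b` and `g` blue and green edge values.
The last term on the left is the variation of the action under `V`; the right side is the coboundary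
of `4pbg + 8pgbg`. -/
theorem bulk_identity : ∀ p₀ p₁ b₀₁ b₁₂ g₀₁ g₁₂ g₂₃ : ZMod 2,
    4 * (bit (p₀ + p₁) * bit b₁₂ * bit g₂₃) + 8 * bit ((p₀ + p₁) * (g₁₂ * b₁₂) * g₂₃) +
        8 * bit (p₀ * (p₀ + p₁ + g₀₁ + b₀₁) * b₁₂ * g₂₃) =
      (4 * bit p₁ * bit b₁₂ * bit g₂₃ + 8 * bit p₁ * bit g₁₂ * bit b₁₂ * bit g₂₃) -
        (4 * bit p₀ * bit (b₀₁ + b₁₂) * bit g₂₃ +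
          8 * bit p₀ * bit (g₀₁ + g₁₂) * bit (b₀₁ + b₁₂) * bit g₂₃) +
        (4 * bit p₀ * bit b₀₁ * bit (g₁₂ + g₂₃) +
          8 * bit p₀ * bit g₀₁ * bit b₀₁ * bit (g₁₂ + g₂₃)) -
        (4 * bit p₀ * bit b₀₁ * bit g₁₂ + 8 * bit p₀ * bit g₀₁ * bit b₀₁ * bit g₁₂) := by
  decide

/-- Second step: on face 4 the constant color sum expresses the blue edge value by the red and green
ones. The primitive of the bulk term, corrected by the face term of `W`, is then the coboundary of
`-2pg`. -/
theorem bdry_identity : ∀ p₀ p₁ g₀₁ g₁₂ : ZMod 2,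
    4 * bit p₀ * bit (p₀ + p₁ + g₀₁) * bit g₁₂ +
        8 * bit p₀ * bit g₀₁ * bit (p₀ + p₁ + g₀₁) * bit g₁₂ -
        2 * (bit (p₀ + p₁) * bit g₁₂) =
      -2 * bit p₁ * bit g₁₂ - -2 * bit p₀ * bit (g₀₁ + g₁₂) + -2 * bit p₀ * bit g₀₁ := by
  decide

/-- Last step: on the hinge blue vanishes, so the green edge value equals the red one, and adding
the `1/8` term of `W` leaves the coboundary of the lifted red potential. -/
theorem hinge_identity : ∀ p₀ p₁ : ZMod 2,
    -2 * bit p₀ * bit (p₀ + p₁) + bit (p₀ + p₁) = bit p₁ - bit p₀ := by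
  decide

theorem bit_zero : bit 0 = 0 := by decide

/-! ### Stokes' theorem on face 4 and on the hinge -/

/-- The volume form of the 4th face. -/
def bdryForm : (Fin 4 → ℝ) [⋀^Fin 3]→ₗ[ℝ] ℝ :=
  (Matrix.detRowAlternating (R := ℝ) (n := Fin 4)).curryLeft (corner 3)

/-- The volume form of the hinge between the 1st and the 4th face. -/
def hingeForm : (Fin 4 → ℝ) [⋀^Fin 2]→ₗ[ℝ] ℝ := bdryForm.curryLeft (corner 0)

theorem bdrySign_eq (s : Simplex T 2) : bdrySign s = intSign (bdryForm s.1) := by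
  have h3 : s.1 = ![s.1 0, s.1 1, s.1 2] := by
    funext i
    fin_cases i <;> rfl
  have h4 : bdryForm s.1 = Matrix.det (Matrix.of (Matrix.vecCons (corner 3) s.1)) := rfl
  rw [h4, h3]
  rfl

theorem hingeSign_eq (s : Simplex T 1) : hingeSign s = intSign (hingeForm s.1) := by
  have h3 : s.1 = ![s.1 0, s.1 1] := by
    funext i
    fin_cases i <;> rfl
  have h4 : hingeForm s.1 = Matrix.det (Matrix.of (Matrix.vecCons (corner 3)
    (Matrix.vecCons (corner 0) s.1))) := rfl
  rw [h4, h3]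
  rfl

theorem isVolume_bdryForm : IsVolume {3} bdryForm := isVolume_det.curryLeft (by simp)

theorem isVolume_hingeForm : IsVolume {0, 3} hingeForm := isVolume_bdryForm.curryLeft (by simp)

/-- This sign says that the hinge runs from `corner 2` to `corner 1`. It decides that the final
phase is `e^{2πi/16}` and not its conjugate. -/
theorem det_corners :
    Matrix.det (Matrix.of ![corner 3, corner 0, corner 2, corner 1]) = (1 : ℝ) := by
  rw [Matrix.det_succ_row_zero]
  simp [corner_apply, Matrix.det_fin_three, Fin.succAbove]
  norm_num

theorem hingeForm_corners (v : Fin 1 → Fin 4 → ℝ) (hv : v 0 = corner 1) :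
    hingeForm.curryLeft (corner 2) v = 1 := by
  have h1 : v = ![corner 1] := by
    funext i
    obtain rfl : i = 0 := Fin.fin_one_eq_zero i
    exact hv
  have h4 : hingeForm.curryLeft (corner 2) v = Matrix.det (Matrix.of (Matrix.vecCons (corner 3)
    (Matrix.vecCons (corner 0) (Matrix.vecCons (corner 2) v)))) := rfl
  rw [h4, h1]
  exact det_corners

theorem stokes_bdry {R : Type} [CommRing R] (N : Cochain T 1 R)
    (hN : ∀ f : Simplex T 1, f.OnFace 3 → f.OnFace 1 ∨ f.OnFace 2 → N f = 0) :
    bdryIntegral (coboundary N) = hingeIntegral N := by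
  classical
  have h := stokes (T := T) isVolume_bdryForm (j := 0) (by simp) N fun f hf i hi h0 hfi => by
    refine hN f (inCoordSub_singleton.1 hf) ?_
    fin_cases i
    · exact (h0 rfl).elim
    · exact Or.inl hfi
    · exact Or.inr hfi
    · simp at hi
  rw [bdryIntegral, hingeIntegral]
  refine Eq.trans (Eq.trans (sum_congr ?_ fun s _ => ?_) h) (sum_congr ?_ fun s _ => ?_)
  · ext s
    simp [bdry, inCoordSub_singleton]
  · rw [bdrySign_eq]
  · ext s
    simp [hinge, inCoordSub_singleton, inCoordSub_insert]
  · rw [hingeSign_eq, hingeForm]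

theorem stokes_hinge {R : Type} [CommRing R] (g : (Fin 4 → ℝ) → R) (hg : g (corner 2) = 0) :
    hingeIntegral (coboundary fun v : Simplex T 0 => g (v.1 0)) = g (corner 1) := by
  classical
  have hcorner : ∀ (v : Simplex T 0) (i : Fin 4), (∀ j ≠ i, v.1 0 j = 0) → v.1 0 = corner i := by
    intro v i hv
    have hs := v.sum_coord 0
    rw [sum_eq_single i (fun j _ hj => hv j hj) (by simp)] at hs
    ext j
    rw [corner_apply]
    split_ifs with h
    · rw [h, hs]
    · exact hv j h
  have h := stokes (T := T) isVolume_hingeForm (j := 2) (by simp) (fun v : Simplex T 0 => g (v.1 0))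
    fun v hv i hi h2 hvi => by
      have h0 := hv 0 0 (by simp)
      have h3 := hv 0 3 (by simp)
      -- The hinge has two ends; the one on face 2 is `corner 2`, where `g` vanishes, so only
      -- `corner 1` contributes.
      have h1 : v.1 0 = corner 2 := by
        apply hcorner
        intro j hj
        fin_cases i
        · simp at hi
        · fin_cases j
          · exact h0
          · exact hvi 0
          · exact (hj rfl).elim
          · exact h3
        · exact (h2 rfl).elim
        · simp at hi
      change g (v.1 0) = 0
      rw [h1, hg]
  obtain ⟨w, hw⟩ := exists_simplex (singleton_corner_mem T 1) (k := 0) (card_singleton _)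
  have hw1 : w.1 0 = corner 1 := by
    have := w.mem_image 0
    rwa [hw, Finset.mem_singleton] at this
  rw [hingeIntegral]
  refine Eq.trans (Eq.trans (sum_congr ?_ fun s _ => ?_) h) ?_
  · ext s
    simp [hinge, inCoordSub_singleton, inCoordSub_insert]
  · rw [hingeSign_eq]
  · have hset : (univ.filter fun v : Simplex T 0 => v.InCoordSub (insert 2 {0, 3})) = {w} := by
      ext v
      simp only [mem_filter, mem_univ, true_and, Finset.mem_singleton]
      constructor
      · intro hv
        apply Simplex.ext_image
        have h1 : v.1 0 = corner 1 := by
          apply hcorner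
          intro j hj
          fin_cases j
          · exact hv 0 0 (by simp)
          · exact (hj rfl).elim
          · exact hv 0 2 (by simp)
          · exact hv 0 3 (by simp)
        ext x
        simp [h1, hw1]
      · rintro rfl i j hj
        obtain rfl : i = 0 := Fin.fin_one_eq_zero i
        rw [hw1, corner_apply, if_neg]
        rintro rfl
        simp at hj
    rw [hset, sum_singleton, hw1]
    rw [hingeForm_corners _ hw1, intSign_pos one_pos]
    simp

/-- The variation of the action under the transversal `CNOT`. -/
def mixExponent (l : Potential) : ZMod 2 :=
  ∑ s : Simplex T 3, l red (s.1 0) * (l red (s.1 0) + l red (s.1 1) +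
    (l green (s.1 0) + l green (s.1 1)) + (l blue (s.1 0) + l blue (s.1 1))) *
    (l blue (s.1 1) + l blue (s.1 2)) * (l green (s.1 2) + l green (s.1 3))

/-! ### Exponentials of integrals as products of controlled phases -/

theorem exp_mul_sum {ι : Type*} (S : Finset ι) (z : ℂ) (σ : ι → ℤ) (n : ι → ℤ) :
    Complex.exp (z * ((∑ i ∈ S, σ i * n i : ℤ) : ℂ)) =
      ∏ i ∈ S, (Complex.exp z ^ σ i) ^ n i := by
  push_cast
  rw [mul_sum, Complex.exp_sum]
  refine prod_congr rfl fun i _ => ?_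
  rw [← zpow_mul, ← Complex.exp_int_mul]
  congr 1
  push_cast
  ring

theorem zpow_val_three (x : ℂ) (p q r : ZMod 2) :
    x ^ ((p.val : ℤ) * q.val * r.val) = if p = 1 ∧ q = 1 ∧ r = 1 then x else 1 := by
  rcases zmod_two_cases p with rfl | rfl <;> rcases zmod_two_cases q with rfl | rfl <;>
    rcases zmod_two_cases r with rfl | rfl <;> simp [ZMod.val_one]

theorem zpow_val_two (x : ℂ) (p q : ZMod 2) :
    x ^ ((p.val : ℤ) * q.val) = if p = 1 ∧ q = 1 then x else 1 := by
  rcases zmod_two_cases p with rfl | rfl <;> rcases zmod_two_cases q with rfl | rfl <;>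
    simp [ZMod.val_one]

theorem zpow_val_one (x : ℂ) (p : ZMod 2) : x ^ (p.val : ℤ) = if p = 1 then x else 1 := by
  rcases zmod_two_cases p with rfl | rfl <;> simp [ZMod.val_one]

theorem phase_mul_four (p q r t : ZMod 2) :
    phase (p * (q * r) * t) = if p = 1 ∧ q = 1 ∧ r = 1 ∧ t = 1 then -1 else 1 := by
  rcases zmod_two_cases p with rfl | rfl <;> rcases zmod_two_cases q with rfl | rfl <;>
    rcases zmod_two_cases r with rfl | rfl <;> rcases zmod_two_cases t with rfl | rfl <;> simp

theorem wPhase_eq (a : Config T) : wPhase a =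
    Complex.exp (Real.pi * Complex.I / 2 *
        (bulkIntegral (cup (cup (lift a red) (lift a blue)) (lift a green)) : ℤ)) *
      phase (bulkIntegral (cup (cup (gauge a red) (cupOne (gauge a green) (gauge a blue)))
        (gauge a green))) *
      Complex.exp (-(Real.pi * Complex.I / 4) *
        (bdryIntegral (cup (lift a red) (lift a green)) : ℤ)) *
      Complex.exp (2 * Real.pi * Complex.I / 16 * (hingeIntegral (lift a red) : ℤ)) := by
  rw [wPhase, ← exp_pi_val, ← Complex.exp_add, ← Complex.exp_add, ← Complex.exp_add]
  congr 1
  ring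

theorem exp_pi_I_div_two : Complex.exp (Real.pi * Complex.I / 2) = Complex.I := by
  rw [show (Real.pi * Complex.I / 2 : ℂ) = Real.pi / 2 * Complex.I by ring]
  exact Complex.exp_pi_div_two_mul_I

/-- The exponential of an integral is a product over simplices. A product of lifted bits in the
exponent is 1 exactly when all bits are 1, so each factor is a multiply controlled phase. -/
theorem W_eq_circuitW : W T = circuitW T := by
  rw [W_eq, circuitW]
  simp only [phaseGate, diagOp_mul]
  rw [opProd_diagOp, opProd_diagOp, opProd_diagOp, diagOp_mul, diagOp_mul]
  congr 1
  funext a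
  rw [wPhase_eq]
  simp only [Pi.mul_apply, prod_mul_distrib]
  refine congrArg₂ _ (congrArg₂ _ (congrArg₂ _ ?_ ?_) ?_) ?_
  · simp only [bulkIntegral, Int.cast_id, cup_three]
    rw [exp_mul_sum, exp_pi_I_div_two]
    refine prod_congr rfl fun s _ => ?_
    rw [lift, lift, lift, zpow_val_three]
    simp
  · simp only [bulkIntegral, bulkSign_zmod_two, one_mul, cup_three]
    rw [phase_sum]
    refine prod_congr rfl fun s _ => ?_
    rw [gauge, gauge, cupOne, gauge, phase_mul_four]
    simp [gauge]
    rfl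
  · simp only [bdryIntegral, Int.cast_id, cup_two]
    rw [exp_mul_sum]
    refine prod_congr rfl fun s _ => ?_
    rw [lift, lift, zpow_val_two]
    simp
  · simp only [hingeIntegral, Int.cast_id]
    rw [exp_mul_sum]
    refine prod_congr rfl fun s _ => ?_
    rw [lift, zpow_val_one]
    simp

/-! ### Descent of the phase from the bulk to the end of the hinge -/

theorem bulkSign_mul_eight (s : Simplex T 3) (x : ZMod 2) :
    (bulkSign s : ZMod 16) * eight x = eight x := by
  rcases bulkSign_eq s with h | h <;> rw [h] <;> revert x <;> decide

theorem lift_cast (a : Config T) (c : Color) (e : Simplex T 1) :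
    ((lift a c e : ℤ) : ZMod 16) = bit (a (e, c)) := by
  simp [lift, bit]

/-- The integral of the densities of `W` over the tetrahedron, corrected by the variation of the
action, is the logical sector. -/
theorem exponent_eq {k : ZMod 2} {l : Potential} (hl : IsGauge T k l) :
    4 * ((bulkIntegral (cup (cup (lift (T := T) (config l) red) (lift (config l) blue))
        (lift (config l) green)) : ℤ) : ZMod 16) +
      eight (bulkIntegral (cup (cup (gauge (T := T) (config l) red)
        (cupOne (gauge (config l) green) (gauge (config l) blue))) (gauge (config l) green))) +
      eight (mixExponent (T := T) l) -
      2 * ((bdryIntegral (cup (lift (T := T) (config l) red) (lift (config l) green)) : ℤ) :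
        ZMod 16) +
      ((hingeIntegral (lift (T := T) (config l) red) : ℤ) : ZMod 16) = bit k := by
  let p := l red
  let b := l blue
  let g := l green
  -- `M` and `N` are the primitives of `bulk_identity` and `bdry_identity`. Each is supplied by
  -- Stokes' theorem with the next, lower-dimensional integral.
  let M : (Fin 4 → ℝ) → (Fin 4 → ℝ) → (Fin 4 → ℝ) → ZMod 16 := fun x y z =>
    4 * bit (p x) * bit (b x + b y) * bit (g y + g z) +
      8 * bit (p x) * bit (g x + g y) * bit (b x + b y) * bit (g y + g z)
  let N : (Fin 4 → ℝ) → (Fin 4 → ℝ) → ZMod 16 := fun x y => -2 * bit (p x) * bit (g x + g y)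
  have hself : ∀ x y z : ZMod 2, x + y + (y + z) = x + z := by decide
  have h1 : 4 * ((bulkIntegral (cup (cup (lift (T := T) (config l) red) (lift (config l) blue))
        (lift (config l) green)) : ℤ) : ZMod 16) +
      eight (bulkIntegral (cup (cup (gauge (T := T) (config l) red)
        (cupOne (gauge (config l) green) (gauge (config l) blue))) (gauge (config l) green))) +
      eight (mixExponent (T := T) l) =
        bulkIntegral (coboundary fun f : Simplex T 2 => M (f.1 0) (f.1 1) (f.1 2)) := by
    simp only [bulkIntegral, mixExponent, bulkSign_zmod_two, one_mul, map_sum, Int.cast_sum,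
      Int.cast_mul, mul_sum, cup_three, lift_cast, ← sum_add_distrib, Int.cast_id]
    refine sum_congr rfl fun s _ => ?_
    rw [coboundary_two M]
    -- The terms with coefficient 8 carry no orientation sign; modulo 16 one can be inserted freely,
    -- so that all terms share the sign of the simplex.
    refine Eq.trans (congrArg₂ _ (congrArg₂ _ rfl (bulkSign_mul_eight s _).symm)
      (bulkSign_mul_eight s _).symm) ?_
    change 4 * ((bulkSign s : ZMod 16) * (bit (p (s.1 0) + p (s.1 1)) *
        bit (b (s.1 1) + b (s.1 2)) * bit (g (s.1 2) + g (s.1 3)))) +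
      (bulkSign s : ZMod 16) * (8 * bit ((p (s.1 0) + p (s.1 1)) *
        ((g (s.1 1) + g (s.1 2)) * (b (s.1 1) + b (s.1 2))) * (g (s.1 2) + g (s.1 3)))) +
      (bulkSign s : ZMod 16) * (8 * bit (p (s.1 0) * (p (s.1 0) + p (s.1 1) +
        (g (s.1 0) + g (s.1 1)) + (b (s.1 0) + b (s.1 1))) * (b (s.1 1) + b (s.1 2)) *
          (g (s.1 2) + g (s.1 3)))) = _
    have := bulk_identity (p (s.1 0)) (p (s.1 1)) (b (s.1 0) + b (s.1 1)) (b (s.1 1) + b (s.1 2))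
      (g (s.1 0) + g (s.1 1)) (g (s.1 1) + g (s.1 2)) (g (s.1 2) + g (s.1 3))
    simp only [hself] at this
    simp only [M]
    rw [← this]
    ring
  have h2 : bulkIntegral (coboundary fun f : Simplex T 2 => M (f.1 0) (f.1 1) (f.1 2)) =
      bdryIntegral fun f : Simplex T 2 => M (f.1 0) (f.1 1) (f.1 2) := by
    -- Each summand of `M` has a red, a blue and a green factor, so it vanishes on faces 1, 2 and 3.
    refine stokes_bulk _ fun f i hi hf => ?_
    fin_cases i
    · simp [M, b, hl.blue_face _ (f.singleton_mem _) (hf _), bit_zero]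
    · simp [M, p, hl.red_face _ (f.singleton_mem _) (hf _), bit_zero]
    · simp [M, g, hl.green_face _ (f.singleton_mem _) (hf _), bit_zero]
    · exact (hi rfl).elim
  have h3 : (bdryIntegral fun f : Simplex T 2 => M (f.1 0) (f.1 1) (f.1 2)) -
      2 * ((bdryIntegral (cup (lift (T := T) (config l) red) (lift (config l) green)) : ℤ) :
        ZMod 16) = bdryIntegral (coboundary fun f : Simplex T 1 => N (f.1 0) (f.1 1)) := by
    simp only [bdryIntegral, Int.cast_sum, Int.cast_mul, mul_sum, cup_two, lift_cast,
      ← sum_sub_distrib, Int.cast_id]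
    refine sum_congr rfl fun s hs => ?_
    have hs3 : s.OnFace 3 := by simpa [bdry] using hs
    have h0 := hl.sum_face _ (s.singleton_mem 0) (hs3 0)
    have h1 := hl.sum_face _ (s.singleton_mem 1) (hs3 1)
    have hb : b (s.1 0) + b (s.1 1) = p (s.1 0) + p (s.1 1) + (g (s.1 0) + g (s.1 1)) := by
      have h4 : ∀ k p p' g g' b b' : ZMod 2, p + g + b = k → p' + g' + b' = k →
        b + b' = p + p' + (g + g') := by decide
      exact h4 _ _ _ _ _ _ _ h0 h1
    rw [coboundary_one N]
    change (bdrySign s : ZMod 16) * M (s.1 0) (s.1 1) (s.1 2) - 2 * ((bdrySign s : ZMod 16) *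
      (bit (p (s.1 0) + p (s.1 1)) * bit (g (s.1 1) + g (s.1 2)))) = _
    have := bdry_identity (p (s.1 0)) (p (s.1 1)) (g (s.1 0) + g (s.1 1)) (g (s.1 1) + g (s.1 2))
    simp only [hself] at this
    simp only [M, N]
    rw [← this, hb]
    ring
  have h4 : bdryIntegral (coboundary fun f : Simplex T 1 => N (f.1 0) (f.1 1)) =
      hingeIntegral fun f : Simplex T 1 => N (f.1 0) (f.1 1) := by
    refine stokes_bdry _ fun f _ hf => ?_
    rcases hf with hf | hf
    · simp [N, p, hl.red_face _ (f.singleton_mem _) (hf _), bit_zero]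
    · simp [N, g, hl.green_face _ (f.singleton_mem _) (hf _), bit_zero]
  have h5 : (hingeIntegral fun f : Simplex T 1 => N (f.1 0) (f.1 1)) +
      ((hingeIntegral (lift (T := T) (config l) red) : ℤ) : ZMod 16) =
        hingeIntegral (coboundary fun v : Simplex T 0 => bit (p (v.1 0))) := by
    simp only [hingeIntegral, Int.cast_sum, Int.cast_mul, lift_cast, ← sum_add_distrib,
      Int.cast_id]
    refine sum_congr rfl fun s hs => ?_
    have hs' : s.OnFace 0 ∧ s.OnFace 3 := by simpa [hinge] using hs
    have h0 := hl.sum_face _ (s.singleton_mem 0) (hs'.2 0)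
    have h1 := hl.sum_face _ (s.singleton_mem 1) (hs'.2 1)
    rw [hl.blue_face _ (s.singleton_mem _) (hs'.1 _)] at h0 h1
    have hg : g (s.1 0) + g (s.1 1) = p (s.1 0) + p (s.1 1) := by
      have h4 : ∀ k p p' g g' : ZMod 2, p + g + 0 = k → p' + g' + 0 = k → g + g' = p + p' := by
        decide
      exact h4 _ _ _ _ _ h0 h1
    rw [coboundary_zero fun x => bit (p x)]
    change (hingeSign s : ZMod 16) * N (s.1 0) (s.1 1) + (hingeSign s : ZMod 16) *
      bit (p (s.1 0) + p (s.1 1)) = _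
    rw [← hinge_identity]
    simp only [N]
    rw [hg]
    ring
  have h6 : hingeIntegral (coboundary fun v : Simplex T 0 => bit (p (v.1 0))) =
      bit (p (corner 1)) := by
    refine stokes_hinge (fun x => bit (p x)) ?_
    change bit (l red (corner 2)) = 0
    rw [hl.red_face _ (singleton_corner_mem T 2) (by simp [corner_apply]), bit_zero]
  -- `corner 1` lies on faces 1, 3 and 4, so blue and green vanish there and red carries the whole
  -- sum `k`.
  have h7 : p (corner 1) = k := by
    have h := hl.sum_face _ (singleton_corner_mem T 1) (by simp [corner_apply])
    rw [hl.green_face _ (singleton_corner_mem T 1) (by simp [corner_apply]),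
      hl.blue_face _ (singleton_corner_mem T 1) (by simp [corner_apply]), add_zero, add_zero] at h
    exact h
  rw [h1, h2, h3, h4, h5, h6, h7]

theorem exp_int_congr {m n : ℤ} (h : (m : ZMod 16) = n) :
    Complex.exp (2 * Real.pi * Complex.I / 16 * m) =
      Complex.exp (2 * Real.pi * Complex.I / 16 * n) := by
  rw [ZMod.intCast_eq_intCast_iff_dvd_sub] at h
  obtain ⟨j, hj⟩ := h
  have : n = m + 16 * j := by push_cast at hj; linarith
  rw [this, Complex.exp_eq_exp_iff_exists_int]
  refine ⟨-j, ?_⟩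
  push_cast
  ring

/-- The phase of `W` in the logical sector `k`. -/
theorem wPhase_config {k : ZMod 2} {l : Potential} (hl : IsGauge T k l) :
    wPhase (T := T) (config l) = Complex.exp (2 * Real.pi * Complex.I / 16 * (k.val : ℂ)) *
      phase (mixExponent (T := T) l) := by
  have h := exponent_eq hl
  set A := bulkIntegral (cup (cup (lift (T := T) (config l) red) (lift (config l) blue))
        (lift (config l) green))
  set C := bulkIntegral (cup (cup (gauge (T := T) (config l) red)
        (cupOne (gauge (config l) green) (gauge (config l) blue))) (gauge (config l) green))
  set B := bdryIntegral (cup (lift (T := T) (config l) red) (lift (config l) green))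
  set H := hingeIntegral (lift (T := T) (config l) red)
  have h2 : Complex.exp (2 * Real.pi * Complex.I / 16 *
      ((4 * A + 8 * C.val + 8 * (mixExponent (T := T) l).val - 2 * B + H : ℤ) : ℂ)) =
      Complex.exp (2 * Real.pi * Complex.I / 16 * ((k.val : ℤ) : ℂ)) := by
    apply exp_int_congr
    push_cast
    exact h
  -- Including the variation of the action makes the total exponent an integer multiple of `2πi/16`,
  -- known modulo 16 from `exponent_eq`.
  have h3 : wPhase (T := T) (config l) * phase (mixExponent (T := T) l) =
      Complex.exp (2 * Real.pi * Complex.I / 16 *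
        ((4 * A + 8 * C.val + 8 * (mixExponent (T := T) l).val - 2 * B + H : ℤ) : ℂ)) := by
    rw [wPhase, ← exp_pi_val, ← Complex.exp_add]
    congr 1
    push_cast
    ring
  rw [h2] at h3
  rw [← Int.cast_natCast (k.val), ← h3, mul_assoc, phase_mul_self, mul_one]

/-! ### The code states -/

open Classical in
/-- The amplitudes of the (unnormalized) code state of the logical sector `k`. -/
def amplitude (k : ZMod 2) (a : Config T) : ℂ :=
  if h : ∃ l, IsGauge T k l ∧ config l = a then phase (action T h.choose) else 0

theorem action_eq_of_config_eq {l l' : Potential} (hl : Normalized T l) (hl' : Normalized T l')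
    (h : config (T := T) l = config l') : action T l = action T l' :=
  action_congr fun c _ hx => hl.eq hl' h c hx

/-- The choice in `amplitude` is harmless: a configuration determines its normalized potentials on
the vertices, hence the action and the sector. -/
theorem amplitude_config {k k' : ZMod 2} {l : Potential} (hl : IsGauge T k' l) :
    amplitude (T := T) k (config l) = if k = k' then phase (action T l) else 0 := by
  rw [amplitude]
  split_ifs with h hk hk
  · rw [action_eq_of_config_eq h.choose_spec.1.toNormalized hl.toNormalized h.choose_spec.2]
  · exact (hk (h.choose_spec.1.sector_eq hl h.choose_spec.2)).elim
  · exact (h ⟨l, hk ▸ hl, rfl⟩).elim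
  · rfl

theorem amplitude_eq_zero {k : ZMod 2} {a : Config T} (ha : ¬ IsFlat a) : amplitude k a = 0 := by
  rw [amplitude, dif_neg]
  rintro ⟨l, hl, rfl⟩
  exact ha hl.isFlat

variable (T) in
/-- The (unnormalized) code state of the logical sector `k`. -/
def codeState (k : ZMod 2) : State T := WithLp.toLp 2 (amplitude k)

theorem codeState_apply (k : ZMod 2) (a : Config T) : codeState T k a = amplitude k a := rfl

theorem diagOp_codeState {k : ZMod 2} {f : Config T → ℂ} {z : ℂ}
    (h : ∀ l, IsGauge T k l → f (config l) = z) : diagOp f (codeState T k) = z • codeState T k := by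
  ext a
  rw [diagOp_apply, PiLp.smul_apply, codeState_apply, smul_eq_mul]
  by_cases ha : ∃ l, IsGauge T k l ∧ config l = a
  · obtain ⟨l, hl, rfl⟩ := ha
    rw [h l hl]
  · rw [amplitude, dif_neg ha, mul_zero, mul_zero]

/-- The operator `S` translates configurations by `t`, which amounts to applying `m` to potentials;
its phases are the variation of the action. -/
structure IsMove (S : Op T) (t : Config T) (m : Potential → Potential) : Prop where
  factor : ∀ (ψ : State T) a, ∃ z : ℂ, S ψ a = z * ψ (a + t)
  isGauge : ∀ k l, IsGauge T k l → IsGauge T k (m l)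
  config : ∀ l, config (m l) = config l + t
  phase : ∀ k l, IsGauge T k l → ∀ ψ : State T,
    phase (action T l) * S ψ (SqrtTCode.config l) =
      SqrtTCode.phase (action T (m l)) * ψ (SqrtTCode.config (m l))

theorem add_add_self_config (a t : Config T) : a + t + t = a := by
  funext q
  rw [Pi.add_apply, Pi.add_apply, add_assoc, CharTwo.add_self_eq_zero, add_zero]

/-- On flat configurations the phase of `S` cancels the change of the action. Off them both
amplitudes vanish, because translation by `t` is an involution preserving flatness. -/
theorem IsMove.codeState {S : Op T} {t : Config T} {m : Potential → Potential}
    (h : IsMove S t m) (k : ZMod 2) : S (codeState T k) = codeState T k := by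
  ext a
  by_cases ha : IsFlat a
  · obtain ⟨k', l, hl, rfl⟩ := ha.exists_isGauge
    have h1 := h.phase k' l hl (SqrtTCode.codeState T k)
    rw [codeState_apply, amplitude_config (h.isGauge k' l hl), mul_ite, phase_mul_self,
      mul_zero] at h1
    have h2 : ∀ z : ℂ, z = SqrtTCode.phase (action T l) * (SqrtTCode.phase (action T l) * z) := by
      intro z
      rw [← mul_assoc, phase_mul_self, one_mul]
    rw [codeState_apply, amplitude_config hl, h2 (S _ _), h1]
    split_ifs <;> simp
  · obtain ⟨z, hz⟩ := h.factor (SqrtTCode.codeState T k) a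
    have h1 : ¬ IsFlat (a + t) := by
      intro hf
      obtain ⟨k', l, hl, hla⟩ := hf.exists_isGauge
      have h2 := h.config l
      rw [hla, add_add_self_config] at h2
      rw [← h2] at ha
      exact ha (h.isGauge k' l hl).isFlat
    rw [hz, codeState_apply, codeState_apply, amplitude_eq_zero h1, amplitude_eq_zero ha, mul_zero]

/-- Off face 4 the color sum on that face, and with it the sector, is untouched. -/
theorem isMove_xStab {v : Simplex T 0} {c : Color} (hv : ¬ v.OnFace 3) (hc : Unbroken v c) :
    IsMove (xStab v c) (starConfig v c) fun l => shift l c (vertexIndicator v) where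
  factor ψ a := ⟨_, xStab_apply v c ψ a⟩
  isGauge k l hl := by
    refine ⟨hl.toNormalized.shift ⟨hc, fun h => (hv h).elim⟩, fun x hx h3 => ?_⟩
    rw [← hl.sum_face x hx h3]
    simp [shift, vertexIndicator_eq_zero hv h3]
  config l := config_shift l v c
  phase k l hl ψ := xStab_apply_config hl.toNormalized ⟨hc, fun h => (hv h).elim⟩ ψ

/-- On face 4 flipping one of red, green, blue would break the constancy of their sum; flipping two
of them preserves it. -/
theorem isMove_xStab_pair {v : Simplex T 0} {c c' : Color} (hcc' : c ≠ c') (hy : c ≠ yellow)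
    (hy' : c' ≠ yellow) (hc : Unbroken v c) (hc' : Unbroken v c') :
    IsMove (xStab v c * xStab v c') (starConfig v c + starConfig v c')
      fun l => shift (shift l c (vertexIndicator v)) c' (vertexIndicator v) where
  factor ψ a := by
    rw [Module.End.mul_apply, xStab_apply, xStab_apply, ← mul_assoc, add_assoc]
    exact ⟨_, rfl⟩
  isGauge k l hl := by
    refine ⟨(hl.toNormalized.shift ⟨hc, fun _ => hy⟩).shift ⟨hc', fun _ => hy'⟩,
      fun x hx h3 => ?_⟩
    rw [← hl.sum_face x hx h3]
    have h2 : vertexIndicator v x + vertexIndicator v x = 0 := CharTwo.add_self_eq_zero _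
    cases c <;> cases c' <;> simp [shift] at hcc' hy hy' ⊢ <;> linear_combination h2
  config l := by rw [config_shift, config_shift, add_assoc]
  phase k l hl ψ := by
    have hl' := hl.toNormalized.shift (v := v) (c := c) ⟨hc, fun _ => hy⟩
    rw [Module.End.mul_apply, xStab_apply_config hl.toNormalized ⟨hc, fun _ => hy⟩,
      xStab_apply_config hl' ⟨hc', fun _ => hy'⟩]

theorem phase_mul_eq_self_iff {x : ZMod 2} {z : ℂ} (hz : z ≠ 0) : phase x * z = z ↔ x = 0 := by
  rw [← phase_eq_one_iff, mul_eq_right₀ hz]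

theorem pauliZ_face4_eq (e : Simplex T 1) :
    pauliZ (e, red) * pauliZ (e, green) * pauliZ (e, blue) =
      diagOp fun a => phase (a (e, red) + a (e, green) + a (e, blue)) := by
  rw [pauliZ_eq, pauliZ_eq, pauliZ_eq, diagOp_mul, diagOp_mul]
  congr 1
  ext a
  simp only [phase_add, Pi.mul_apply]

/-- Code states are supported on flat configurations. -/
theorem isFlat_of_mem_codeSpace {ψ : State T} (hψ : ψ ∈ codeSpace T) {a : Config T}
    (ha : ψ a ≠ 0) : IsFlat a := by
  have key : ∀ (S : Op T) (x : Config T → ZMod 2), IsStabilizer T S →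
      S = diagOp (fun a => phase (x a)) → x a = 0 := by
    rintro S x hS rfl
    have h := congrArg (fun φ : State T => φ a) (hψ _ hS)
    exact (phase_mul_eq_self_iff ha).1 h
  exact
    { flat := fun f c => key _ (fun a => ∑ i, a (f.facet i, c)) (.z f c) (zStab_eq f c)
      blue_face := fun e h => key _ (fun a => a (e, blue)) (.z_face1 e h) (pauliZ_eq _)
      red_face := fun e h => key _ (fun a => a (e, red)) (.z_face2 e h) (pauliZ_eq _)
      green_face := fun e h => key _ (fun a => a (e, green)) (.z_face3 e h) (pauliZ_eq _)
      sum_face := fun e h => key _ (fun a => a (e, red) + a (e, green) + a (e, blue))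
        (.z_face4 e h) (pauliZ_face4_eq _)
      yellow_face := fun e h => key _ (fun a => a (e, yellow)) (.z_face4' e h) (pauliZ_eq _) }

theorem codeState_mem (k : ZMod 2) : codeState T k ∈ codeSpace T := by
  have hdiag : ∀ x : Config T → ZMod 2, (∀ a, IsFlat a → x a = 0) →
      diagOp (fun a => phase (x a)) (codeState T k) = codeState T k := by
    intro x hx
    rw [diagOp_codeState (z := 1), one_smul]
    intro l hl
    rw [hx _ hl.isFlat, phase_zero]
  intro S hS
  cases hS with
  | z f c => rw [zStab_eq]; exact hdiag _ fun a ha => ha.flat f c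
  | z_face1 e h => rw [pauliZ_eq]; exact hdiag _ fun a ha => ha.blue_face e h
  | z_face2 e h => rw [pauliZ_eq]; exact hdiag _ fun a ha => ha.red_face e h
  | z_face3 e h => rw [pauliZ_eq]; exact hdiag _ fun a ha => ha.green_face e h
  | z_face4 e h =>
    rw [pauliZ_face4_eq]
    exact hdiag (fun a => a (e, red) + a (e, green) + a (e, blue)) fun a ha => ha.sum_face e h
  | z_face4' e h => rw [pauliZ_eq]; exact hdiag _ fun a ha => ha.yellow_face e h
  | x v c h hc => exact (isMove_xStab h hc).codeState k
  | x_face4 v c c' h hcc' hy hy' hc hc' =>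
    exact (isMove_xStab_pair hcc' hy hy' hc hc').codeState k

/-! ### The code space is spanned by the code states -/

/-- The amplitude of a state relative to that of the code state. -/
def relAmplitude (ψ : State T) (l : Potential) : ℂ := phase (action T l) * ψ (config l)

theorem relAmplitude_congr (ψ : State T) {l l' : Potential}
    (h : ∀ c x, {x} ∈ T.K.faces → l c x = l' c x) : relAmplitude ψ l = relAmplitude ψ l' := by
  have hc : config (T := T) l = config l' := by
    funext q
    simp only [config, h _ _ (q.1.singleton_mem _)]
  rw [relAmplitude, relAmplitude, action_congr h, hc]

theorem IsMove.relAmplitude {S : Op T} {t : Config T} {m : Potential → Potential}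
    (h : IsMove S t m) {ψ : State T} (hS : S ψ = ψ) {k : ZMod 2} {l : Potential}
    (hl : IsGauge T k l) : relAmplitude ψ (m l) = relAmplitude ψ l := by
  have := h.phase k l hl ψ
  rw [hS] at this
  exact this.symm

theorem zmod_two_eq_add_one {x y : ZMod 2} (h : x ≠ y) : x + 1 = y := by
  revert h; revert x y; decide

theorem shift_self (l : Potential) (v : Simplex T 0) (c : Color) :
    shift l c (vertexIndicator v) c (v.1 0) = l c (v.1 0) + 1 := by
  simp [shift, vertexIndicator]

theorem shift_of_ne_color (l : Potential) (v : Simplex T 0) {c c' : Color} (h : c' ≠ c)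
    (x : Fin 4 → ℝ) : shift l c (vertexIndicator v) c' x = l c' x := by
  simp [shift, h]

theorem shift_of_ne (l : Potential) (v : Simplex T 0) (c c' : Color) {x : Fin 4 → ℝ}
    (h : x ≠ v.1 0) : shift l c (vertexIndicator v) c' x = l c' x := by
  simp [shift, vertexIndicator, h.symm]

theorem unbroken_of_ne {k k' : ZMod 2} {l l' : Potential} (hl : IsGauge T k l)
    (hl' : IsGauge T k' l') {v : Simplex T 0} {c : Color} (h : l c (v.1 0) ≠ l' c (v.1 0)) :
    Unbroken v c := by
  have hv := v.singleton_mem 0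
  refine ⟨?_, ?_, ?_⟩
  · rintro h0 rfl
    exact h ((hl.blue_face _ hv (h0 0)).trans (hl'.blue_face _ hv (h0 0)).symm)
  · rintro h0 rfl
    exact h ((hl.red_face _ hv (h0 0)).trans (hl'.red_face _ hv (h0 0)).symm)
  · rintro h0 rfl
    exact h ((hl.green_face _ hv (h0 0)).trans (hl'.green_face _ hv (h0 0)).symm)

/-- The colors in which `l` and `l'` differ at `v` are flipped one by one. Such a color is unbroken,
since on a face where it is fixed the boundary conditions would force agreement. -/
theorem relAmplitude_eq_of_eq_off_vertex_of_not_onFace {ψ : State T} (hψ : ψ ∈ codeSpace T)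
    {k : ZMod 2} {l l' : Potential} (hl : IsGauge T k l) (hl' : IsGauge T k l') {v : Simplex T 0}
    (hv : ¬ v.OnFace 3) (h : ∀ c x, x ≠ v.1 0 → l c x = l' c x) :
    relAmplitude ψ l = relAmplitude ψ l' := by
  have key : ∀ S : Finset Color, ∃ m, IsGauge T k m ∧ relAmplitude ψ m = relAmplitude ψ l ∧
      (∀ c x, x ≠ v.1 0 → m c x = l' c x) ∧ ∀ c ∈ S, m c (v.1 0) = l' c (v.1 0) := by
    intro S
    induction S using Finset.induction_on with
    | empty => exact ⟨l, hl, rfl, h, by simp⟩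
    | insert c S hc ih =>
      obtain ⟨m, h1, h2, h3, h4⟩ := ih
      by_cases hm : m c (v.1 0) = l' c (v.1 0)
      · refine ⟨m, h1, h2, h3, fun c' hc' => ?_⟩
        rcases Finset.mem_insert.1 hc' with rfl | hc'
        exacts [hm, h4 c' hc']
      · have hu := unbroken_of_ne h1 hl' hm
        have hmove := isMove_xStab hv hu
        refine ⟨_, hmove.isGauge k m h1, (hmove.relAmplitude (hψ _ (.x v c hv hu)) h1).trans h2,
          fun c' x hx => ?_, fun c' hc' => ?_⟩
        · rw [shift_of_ne _ _ _ _ hx, h3 c' x hx]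
        · by_cases hcc : c' = c
          · subst hcc
            rw [shift_self]
            exact zmod_two_eq_add_one hm
          · rw [shift_of_ne_color _ _ hcc]
            exact h4 c' (Finset.mem_of_mem_insert_of_ne hc' hcc)
  obtain ⟨m, -, h2, h3, h4⟩ := key univ
  rw [← h2]
  refine relAmplitude_congr ψ fun c x _ => ?_
  by_cases hx : x = v.1 0
  · rw [hx, h4 c (mem_univ c)]
  · exact h3 c x hx

/-- Both potentials have color sum `k` and vanishing yellow at `v`. So they differ there in none or
exactly two of red, green, blue, and a single pair stabilizer connects them. -/
theorem relAmplitude_eq_of_eq_off_vertex_of_onFace {ψ : State T} (hψ : ψ ∈ codeSpace T)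
    {k : ZMod 2} {l l' : Potential} (hl : IsGauge T k l) (hl' : IsGauge T k l') {v : Simplex T 0}
    (hv : v.OnFace 3) (h : ∀ c x, x ≠ v.1 0 → l c x = l' c x) :
    relAmplitude ψ l = relAmplitude ψ l' := by
  have hpair : ∀ c c' c'' : Color, c ≠ c' → c ≠ yellow → c' ≠ yellow → c'' ≠ c → c'' ≠ c' →
      c'' ≠ yellow → l c (v.1 0) ≠ l' c (v.1 0) → l c' (v.1 0) ≠ l' c' (v.1 0) →
      l c'' (v.1 0) = l' c'' (v.1 0) → relAmplitude ψ l = relAmplitude ψ l' := by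
    intro c c' c'' hcc' hy hy' h1 h2 hy'' hc hc' hc''
    have hu := unbroken_of_ne hl hl' hc
    have hu' := unbroken_of_ne hl hl' hc'
    have hmove := isMove_xStab_pair hcc' hy hy' hu hu'
    rw [← hmove.relAmplitude (hψ _ (.x_face4 v c c' hv hcc' hy hy' hu hu')) hl]
    refine relAmplitude_congr ψ fun d x _ => ?_
    by_cases hx : x = v.1 0
    · subst hx
      by_cases hd' : d = c'
      · subst hd'
        rw [shift_self, shift_of_ne_color _ _ hcc'.symm]
        exact zmod_two_eq_add_one hc'
      rw [shift_of_ne_color _ _ hd']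
      by_cases hd : d = c
      · subst hd
        rw [shift_self]
        exact zmod_two_eq_add_one hc
      rw [shift_of_ne_color _ _ hd]
      by_cases hdy : d = yellow
      · subst hdy
        rw [hl.yellow_face _ (v.singleton_mem 0) (hv 0), hl'.yellow_face _ (v.singleton_mem 0) (hv 0)]
      · have : d = c'' := by
          revert hcc' hy hy' h1 h2 hy'' hd hd' hdy
          clear * -
          revert c c' c'' d
          decide
        rw [this, hc'']
    · rw [shift_of_ne _ _ _ _ hx, shift_of_ne _ _ _ _ hx, h d x hx]
  have hs := (hl.sum_face _ (v.singleton_mem 0) (hv 0)).trans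
    (hl'.sum_face _ (v.singleton_mem 0) (hv 0)).symm
  have hcases : ∀ r g b r' g' b' : ZMod 2, r + g + b = r' + g' + b' →
      (r = r' ∧ g = g' ∧ b = b') ∨ (r ≠ r' ∧ g ≠ g' ∧ b = b') ∨ (r ≠ r' ∧ b ≠ b' ∧ g = g') ∨
        (g ≠ g' ∧ b ≠ b' ∧ r = r') := by decide
  rcases hcases _ _ _ _ _ _ hs with ⟨h1, h2, h3⟩ | ⟨h1, h2, h3⟩ | ⟨h1, h2, h3⟩ | ⟨h1, h2, h3⟩
  · refine relAmplitude_congr ψ fun c x _ => ?_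
    by_cases hx : x = v.1 0
    · subst hx
      cases c
      · exact h1
      · exact h2
      · exact h3
      · rw [hl.yellow_face _ (v.singleton_mem 0) (hv 0), hl'.yellow_face _ (v.singleton_mem 0) (hv 0)]
    · exact h c x hx
  · exact hpair red green blue (by decide) (by decide) (by decide) (by decide) (by decide)
      (by decide) h1 h2 h3
  · exact hpair red blue green (by decide) (by decide) (by decide) (by decide) (by decide)
      (by decide) h1 h2 h3
  · exact hpair green blue red (by decide) (by decide) (by decide) (by decide) (by decide)
      (by decide) h1 h2 h3

/-- Replace `l` by `l'` vertex by vertex. The boundary conditions are pointwise with the same `k`,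
so every intermediate potential satisfies them. -/
theorem relAmplitude_eq {ψ : State T} (hψ : ψ ∈ codeSpace T) {k : ZMod 2} {l l' : Potential}
    (hl : IsGauge T k l) (hl' : IsGauge T k l') : relAmplitude ψ l = relAmplitude ψ l' := by
  classical
  let m : Finset (Simplex T 0) → Potential := fun S c x =>
    if ∃ v ∈ S, v.1 0 = x then l' c x else l c x
  have hm : ∀ S, IsGauge T k (m S) := by
    intro S
    refine ⟨⟨fun x hx h => ?_, fun x hx h => ?_, fun x hx h => ?_, fun x hx h => ?_⟩,
      fun x hx h => ?_⟩ <;> simp only [m] <;> split_ifs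
    exacts [hl'.blue_face x hx h, hl.blue_face x hx h, hl'.red_face x hx h, hl.red_face x hx h,
      hl'.green_face x hx h, hl.green_face x hx h, hl'.yellow_face x hx h, hl.yellow_face x hx h,
      hl'.sum_face x hx h, hl.sum_face x hx h]
  have key : ∀ S, relAmplitude ψ (m S) = relAmplitude ψ l := by
    intro S
    induction S using Finset.induction_on with
    | empty => exact relAmplitude_congr ψ fun c x _ => by simp [m]
    | insert v S hv ih =>
      rw [← ih]
      have hoff : ∀ c x, x ≠ v.1 0 → m (insert v S) c x = m S c x := by
        intro c x hx
        simp only [m, Finset.exists_mem_insert, hx.symm, false_or]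
      by_cases h3 : v.OnFace 3
      · exact relAmplitude_eq_of_eq_off_vertex_of_onFace hψ (hm _) (hm _) h3 hoff
      · exact relAmplitude_eq_of_eq_off_vertex_of_not_onFace hψ (hm _) (hm _) h3 hoff
  rw [← key univ]
  refine relAmplitude_congr ψ fun c x hx => ?_
  obtain ⟨w, hw⟩ := exists_simplex hx (k := 0) (card_singleton _)
  have hw0 : w.1 0 = x := by
    have := w.mem_image 0
    rwa [hw, Finset.mem_singleton] at this
  exact if_pos ⟨w, mem_univ w, hw0⟩

/-- On flat configurations of sector `k` a code state is its constant relative amplitude times the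
code state of that sector; elsewhere it vanishes. -/
theorem exists_eq_of_mem_codeSpace {ψ : State T} (hψ : ψ ∈ codeSpace T) :
    ∃ c : ZMod 2 → ℂ, ψ = c 0 • codeState T 0 + c 1 • codeState T 1 := by
  choose l₀ hl₀ using exists_isGauge T
  refine ⟨fun k => relAmplitude ψ (l₀ k), ?_⟩
  ext a
  simp only [PiLp.add_apply, PiLp.smul_apply, codeState_apply, smul_eq_mul]
  by_cases ha : IsFlat a
  · obtain ⟨k, l, hl, rfl⟩ := ha.exists_isGauge
    rw [amplitude_config hl, amplitude_config hl]
    have h1 : ψ (config l) = relAmplitude ψ (l₀ k) * phase (action T l) := by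
      rw [relAmplitude_eq hψ (hl₀ k) hl, relAmplitude, mul_right_comm, phase_mul_self, one_mul]
    rw [h1]
    rcases zmod_two_cases k with rfl | rfl <;> simp
  · rw [amplitude_eq_zero ha, amplitude_eq_zero ha]
    by_contra hne
    exact ha (isFlat_of_mem_codeSpace hψ (by simpa using hne))

theorem codeState_ne_zero (k : ZMod 2) : codeState T k ≠ 0 := by
  obtain ⟨l, hl⟩ := exists_isGauge T k
  intro h
  have h1 := congrArg (fun φ : State T => φ (config l)) h
  simp only [codeState_apply, PiLp.zero_apply, amplitude_config hl, if_true] at h1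
  have := norm_phase (action T l)
  rw [h1] at this
  simp at this

/-- Different sectors have disjoint supports. -/
theorem inner_codeState {k k' : ZMod 2} (h : k ≠ k') :
    inner ℂ (codeState T k) (codeState T k') = 0 := by
  rw [PiLp.inner_apply]
  refine sum_eq_zero fun a _ => ?_
  rw [codeState_apply, codeState_apply]
  by_cases ha : IsFlat a
  · obtain ⟨k'', l, hl, rfl⟩ := ha.exists_isGauge
    rw [amplitude_config hl, amplitude_config hl]
    by_cases h1 : k = k''
    · have h2 : k' ≠ k'' := fun h2 => h (h1.trans h2.symm)
      simp [h2]
    · simp [h1]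
  · simp [amplitude_eq_zero ha]

/-! ### The logical operators -/

/-- The red holonomy is the difference of the red potentials at the ends of the hinge: 0 at `corner
2` and `k` at `corner 1`. -/
theorem sum_hinge {k : ZMod 2} {l : Potential} (hl : IsGauge T k l) :
    ∑ e ∈ hinge T, config l (e, red) = k := by
  have h := stokes_hinge (T := T) (fun x => l red x)
    (hl.red_face _ (singleton_corner_mem T 2) (by simp [corner_apply]))
  have h7 := hl.sum_face _ (singleton_corner_mem T 1) (by simp [corner_apply])
  rw [hl.green_face _ (singleton_corner_mem T 1) (by simp [corner_apply]),
    hl.blue_face _ (singleton_corner_mem T 1) (by simp [corner_apply]), add_zero, add_zero] at h7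
  rw [← h7, ← h, hingeIntegral]
  refine sum_congr rfl fun e he => ?_
  have he' : e.InCoordSub {0, 3} := by
    simpa [inCoordSub_insert, inCoordSub_singleton, hinge] using he
  have hs : (hingeSign e : ZMod 2) = 1 := by
    rw [hingeSign_eq]
    rcases lt_or_gt_of_ne (isVolume_hingeForm.ne_zero e.1 he' e.linearIndependent) with h | h
    · rw [intSign_neg h]; decide
    · rw [intSign_pos h]; decide
  rw [hs, one_mul, coboundary_zero (fun x => l red x), CharTwo.sub_eq_add, add_comm]
  rfl

theorem logicalZ_codeState (k : ZMod 2) : logicalZ T (codeState T k) = phase k • codeState T k := by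
  rw [logicalZ_eq]
  refine diagOp_codeState fun l hl => ?_
  rw [sum_hinge hl]

theorem U_apply (ψ : State T) (a : Config T) : U T ψ a = wPhase a * ψ (mix a) := by
  rw [U, Module.End.mul_apply, W_eq, diagOp_apply, V_apply]

theorem mix_mix (a : Config T) : mix (mix a) = a := by
  funext q
  obtain ⟨e, c⟩ := q
  have h : ∀ y r g b : ZMod 2, y + r + g + b + r + g + b = y := by decide
  cases c <;> simp [mix, h]

/-- The action of the `CNOT` gates on potentials in the sector `k`. -/
def mixPotential (k : ZMod 2) (l : Potential) : Potential :=
  fun c x => if c = yellow then l yellow x + (l red x + l green x + l blue x + k) else l c x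

theorem config_mixPotential (k : ZMod 2) (l : Potential) :
    config (T := T) (mixPotential k l) = mix (config l) := by
  funext q
  obtain ⟨e, c⟩ := q
  have h : ∀ y r g b y' r' g' b' k : ZMod 2, y + (r + g + b + k) + (y' + (r' + g' + b' + k)) =
      y + y' + (r + r') + (g + g') + (b + b') := by
    intro y r g b y' r' g' b' k
    have : k + k = 0 := CharTwo.add_self_eq_zero k
    linear_combination this
  cases c <;> simp [mix, config, mixPotential, h]

/-- The summand `k` cancels on edges but is needed here: it keeps the yellow potential zero on face
4, where the color sum equals `k`. -/
theorem IsGauge.mixPotential {k : ZMod 2} {l : Potential} (hl : IsGauge T k l) :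
    IsGauge T k (mixPotential k l) := by
  refine ⟨⟨hl.blue_face, hl.red_face, hl.green_face, fun x hx h => ?_⟩, hl.sum_face⟩
  change l yellow x + (l red x + l green x + l blue x + k) = 0
  rw [hl.yellow_face x hx h, hl.sum_face x hx h, CharTwo.add_self_eq_zero, add_zero]

theorem action_mixPotential (k : ZMod 2) (l : Potential) :
    action T (mixPotential k l) = action T l + mixExponent (T := T) l := by
  rw [action, action, mixExponent, ← sum_add_distrib]
  refine sum_congr rfl fun s _ => ?_
  have : k + k = 0 := CharTwo.add_self_eq_zero k
  simp only [mixPotential, if_true, reduceCtorEq, if_false]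
  linear_combination (l red (s.1 0) * (l blue (s.1 1) + l blue (s.1 2)) *
    (l green (s.1 2) + l green (s.1 3))) * this

variable (T) in
-- The phase of `W` contains the factor `(-1)^mixExponent`, which undoes the change of the action
-- caused by `V`. Only the sector-dependent phase survives.
theorem U_codeState (k : ZMod 2) : U T (codeState T k) =
    Complex.exp (2 * Real.pi * Complex.I / 16 * (k.val : ℂ)) • codeState T k := by
  ext a
  rw [U_apply, PiLp.smul_apply, smul_eq_mul, codeState_apply, codeState_apply]
  by_cases ha : IsFlat a
  · obtain ⟨k', l, hl, rfl⟩ := ha.exists_isGauge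
    rw [← config_mixPotential k', amplitude_config hl, amplitude_config hl.mixPotential]
    split_ifs with h
    · subst h
      rw [wPhase_config hl, action_mixPotential, phase_add, mul_assoc, mul_comm (phase _),
        mul_assoc (phase _), phase_mul_self, mul_one]
    · simp
  · have h1 : ¬ IsFlat (mix a) := by
      intro hf
      obtain ⟨k', l, hl, hla⟩ := hf.exists_isGauge
      have h2 := config_mixPotential (T := T) k' l
      rw [hla, mix_mix] at h2
      rw [← h2] at ha
      exact ha hl.mixPotential.isFlat
    rw [amplitude_eq_zero ha, amplitude_eq_zero h1, mul_zero, mul_zero]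

/-! ### Unitarity and invariance of the code space -/

theorem norm_wPhase (a : Config T) : ‖wPhase a‖ = 1 := by
  have h : ∀ (A C D : ℤ) (B : ℕ), ‖Complex.exp (Real.pi * Complex.I *
      ((A : ℂ) / 2 + (B : ℂ) - (C : ℂ) / 4 + (D : ℂ) / 8))‖ = 1 := by
    intro A C D B
    rw [← Complex.norm_exp_ofReal_mul_I (Real.pi * (A / 2 + B - C / 4 + D / 8))]
    congr 2
    push_cast
    ring
  rw [wPhase]
  exact h _ _ _ _

/-- `U` permutes the basis configurations by the involution `mix` and multiplies amplitudes by
phases of modulus 1. -/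
theorem inner_U (ψ φ : State T) : inner ℂ (U T ψ) (U T φ) = inner ℂ ψ φ := by
  rw [PiLp.inner_apply, PiLp.inner_apply]
  refine Eq.trans (sum_congr rfl fun a _ => ?_)
    (Equiv.sum_comp (Function.Involutive.toPerm (mix (T := T)) mix_mix)
      fun a => inner ℂ (ψ a) (φ a))
  rw [U_apply, U_apply]
  change inner ℂ (wPhase a • ψ (mix a)) (wPhase a • φ (mix a)) = inner ℂ (ψ (mix a)) (φ (mix a))
  rw [inner_smul_left, inner_smul_right, ← mul_assoc, ← Complex.normSq_eq_conj_mul_self,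
    Complex.normSq_eq_norm_sq, norm_wPhase]
  simp

theorem map_U_codeSpace : (codeSpace T).map (U T) = codeSpace T := by
  have hcomb : ∀ c d : ℂ, c • codeState T 0 + d • codeState T 1 ∈ codeSpace T := fun c d =>
    Submodule.add_mem _ (Submodule.smul_mem _ _ (codeState_mem 0))
      (Submodule.smul_mem _ _ (codeState_mem 1))
  apply le_antisymm
  · rintro _ ⟨ψ, hψ, rfl⟩
    obtain ⟨c, rfl⟩ := exists_eq_of_mem_codeSpace hψ
    rw [map_add, map_smul, map_smul, U_codeState, U_codeState, smul_smul, smul_smul]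
    exact hcomb _ _
  · intro ψ hψ
    obtain ⟨c, rfl⟩ := exists_eq_of_mem_codeSpace hψ
    have hne : ∀ k : ZMod 2, Complex.exp (2 * Real.pi * Complex.I / 16 * (k.val : ℂ)) ≠ 0 :=
      fun k => Complex.exp_ne_zero _
    refine ⟨_, hcomb (c 0 * (Complex.exp (2 * Real.pi * Complex.I / 16 *
      ((0 : ZMod 2).val : ℂ)))⁻¹) (c 1 * (Complex.exp (2 * Real.pi * Complex.I / 16 *
      ((1 : ZMod 2).val : ℂ)))⁻¹), ?_⟩
    rw [map_add, map_smul, map_smul, U_codeState, U_codeState, smul_smul, smul_smul,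
      inv_mul_cancel_right₀ (hne 0), inv_mul_cancel_right₀ (hne 1)]

/-! ### The orthonormal logical basis -/

variable (T) in
/-- The normalized code states. -/
def logicalKet (i : Fin 2) : codeSpace T :=
  ⟨((‖codeState T (![0, 1] i)‖ : ℂ)⁻¹) • codeState T (![0, 1] i),
    Submodule.smul_mem _ _ (codeState_mem _)⟩

theorem orthonormal_logicalKet : Orthonormal ℂ (logicalKet T) := by
  constructor
  · intro i
    rw [Submodule.coe_norm, logicalKet, norm_smul, norm_inv, Complex.norm_real, norm_norm,
      inv_mul_cancel₀ (norm_ne_zero_iff.2 (codeState_ne_zero _))]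
  · intro i j hij
    have hne : (![0, 1] : Fin 2 → ZMod 2) i ≠ ![0, 1] j := by
      revert i j
      decide
    rw [Submodule.coe_inner, logicalKet, logicalKet, inner_smul_left, inner_smul_right,
      inner_codeState hne, mul_zero, mul_zero]

theorem span_logicalKet : ⊤ ≤ Submodule.span ℂ (Set.range (logicalKet T)) := by
  rintro ⟨ψ, hψ⟩ -
  obtain ⟨c, rfl⟩ := exists_eq_of_mem_codeSpace hψ
  have h : ∀ (i : Fin 2) (c : ℂ) (h : c • codeState T (![0, 1] i) ∈ codeSpace T),
      (⟨_, h⟩ : codeSpace T) ∈ Submodule.span ℂ (Set.range (logicalKet T)) := by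
    intro i c h
    have h1 : (⟨_, h⟩ : codeSpace T) =
        (c * (‖codeState T (![0, 1] i)‖ : ℂ)) • logicalKet T i := by
      apply Subtype.ext
      change c • codeState T (![0, 1] i) = (c * (‖codeState T (![0, 1] i)‖ : ℂ)) •
        ((‖codeState T (![0, 1] i)‖ : ℂ)⁻¹) • codeState T (![0, 1] i)
      rw [smul_smul, mul_inv_cancel_right₀]
      exact_mod_cast norm_ne_zero_iff.2 (codeState_ne_zero _)
    rw [h1]
    exact Submodule.smul_mem _ _ (Submodule.subset_span ⟨i, rfl⟩)
  exact Submodule.add_mem _ (h 0 (c 0) (Submodule.smul_mem _ _ (codeState_mem _)))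
    (h 1 (c 1) (Submodule.smul_mem _ _ (codeState_mem _)))

variable (T) in
/-- The logical basis of the code space. -/
def logicalBasis : OrthonormalBasis (Fin 2) ℂ (codeSpace T) :=
  OrthonormalBasis.mk orthonormal_logicalKet span_logicalKet

theorem logicalBasis_apply (i : Fin 2) : (logicalBasis T i : State T) =
    ((‖codeState T (![0, 1] i)‖ : ℂ)⁻¹) • codeState T (![0, 1] i) := by
  rw [logicalBasis, OrthonormalBasis.coe_mk]
  rfl

end SqrtTCode

end

theorem mainTheorem4 (T : SqrtTCode.TriangulatedTetrahedron) :
    -- the code stores a single logical qubit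
    Module.finrank ℂ (SqrtTCode.codeSpace T) = 2 ∧
    -- `W` is the circuit of local gates
    SqrtTCode.W T = SqrtTCode.circuitW T ∧
    -- `U = W V` is unitary and preserves the code space
    (∀ ψ φ : SqrtTCode.State T, inner ℂ (SqrtTCode.U T ψ) (SqrtTCode.U T φ) = inner ℂ ψ φ) ∧
    (SqrtTCode.codeSpace T).map (SqrtTCode.U T) = SqrtTCode.codeSpace T ∧
    -- in the logical `Z` basis, `U` acts as `diag(1, e^{2πi/16})`
    ∃ ket : OrthonormalBasis (Fin 2) ℂ (SqrtTCode.codeSpace T),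
      SqrtTCode.logicalZ T (ket 0) = (ket 0 : SqrtTCode.State T) ∧
      SqrtTCode.logicalZ T (ket 1) = -(ket 1 : SqrtTCode.State T) ∧
      SqrtTCode.U T (ket 0) = (ket 0 : SqrtTCode.State T) ∧
      SqrtTCode.U T (ket 1) =
        Complex.exp (2 * Real.pi * Complex.I / 16) • (ket 1 : SqrtTCode.State T) := by
  refine ⟨?_, SqrtTCode.W_eq_circuitW, SqrtTCode.inner_U, SqrtTCode.map_U_codeSpace,
    SqrtTCode.logicalBasis T, ?_, ?_, ?_, ?_⟩
  · rw [Module.finrank_eq_card_basis (SqrtTCode.logicalBasis T).toBasis, Fintype.card_fin]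
  · rw [SqrtTCode.logicalBasis_apply, map_smul, SqrtTCode.logicalZ_codeState]
    simp
  · rw [SqrtTCode.logicalBasis_apply, map_smul, SqrtTCode.logicalZ_codeState]
    simp
  · rw [SqrtTCode.logicalBasis_apply, map_smul, SqrtTCode.U_codeState]
    simp
  · rw [SqrtTCode.logicalBasis_apply, map_smul, SqrtTCode.U_codeState, smul_comm]
    simp [ZMod.val_one]
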